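/- We consider first-order formulas without equality over relational signatures, built from atoms $R(v_1,\dots,v_k)$ by $\neg,\wedge,\vee,\exists,\forall$; structures have non-empty universes, and $\mathrm{free}(\phi)$ is the set of free variables of $\phi$. A hypergraph is given by a finite set $E$ of finite edges, with vertex set $\bigcup E$; its treewidth $\mathrm{tw}(E)$ is that of the graph joining any two distinct vertices that lie in a common edge. For a set $S$, $E$ is called $S$-connected if the graph with vertex set $E$, in which $e\neq f$ are adjacent iff $S\cap e\cap f\neq\emptyset$, is connected. Literals (atoms and negated atoms) are both $\exists$-layered and $\forall$-layered. If $n\ge 1$, $\phi_1,\dots,\phi_n$ are $\forall$-layered, $X\subseteq\bigcup_i\mathrm{free}(\phi_i)$, and $\{\mathrm{free}(\phi_1),\dots,\mathrm{free}(\phi_n)\}$ is $X$-connected, then $\exists X(\phi_1\wedge\dots\wedge\phi_n)$ is $\exists$-layered; dually, if the $\phi_i$ are $\exists$-layered, then $\forall X(\phi_1\vee\dots\vee\phi_n)$ is $\forall$-layered. A formula presented in this way is layered if moreover no variable is quantified twice in it and none is both quantified and free. The thickness of a literal is its number of variables; the thickness of a layered formula $\phi=\exists X(\bigwedge_i\phi_i)$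 or $\phi=\forall X(\bigvee_i\phi_i)$ is $$\mathrm{thick}_l(\phi)=\max\Big(\big\{1+\mathrm{tw}\big(\{\mathrm{free}(\phi_1),\dots,\mathrm{free}(\phi_n),\mathrm{free}(\phi)\}\big)\big\}\cup\{\mathrm{thick}_l(\phi_1),\dots,\mathrm{thick}_l(\phi_n)\}\Big)$$ (the treewidth of a hypergraph without vertices is counted as $0$). A layering algorithm is an algorithm $\mathrm{lay}$ that, given a formula $\phi$, outputs a combination $\mathrm{lay}(\phi)$ of layered formulas by $\wedge$ and $\vee$ that is logically equivalent to $\phi$ and contains only free variables of $\phi$ as free variables and only relation symbols of $\phi$. Given $\mathrm{lay}$, the thickness $\mathrm{thick}(\phi)$ is the maximum of $\mathrm{thick}_l(\psi)$ over the layered formulas $\psi$ that are combined in $\mathrm{lay}(\phi)$. **Theorem.** (1) The following procedure is a layering algorithm. By recursion on $\phi$, with negations pushed to the atoms, it computes a CNF and a DNF of formulas that are literals or have one of the forms $\exists v(\bigwedge_i\theta_i)$, $\forall v(\bigvee_i\theta_i)$ with each $\theta_i$ again of this kind and $v$ free in every $\theta_i$: the CNF of a conjunction is the conjunction of the CNFs;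 $\exists x$ is distributed over the disjuncts of the DNF, and in each disjunct the conjuncts without free $x$ are moved out of its scope ($\exists x$ being dropped if none is left); disjunctions and $\forall x$ are treated dually; and the other one of the two normal forms is obtained by distributivity. Finally, in each of the formulas of which the CNF for $\phi$ is composed, the quantified variables are renamed apart and directly nested quantifiers of the same type are merged into one set quantification. (2) For every layering algorithm $\mathrm{lay}$, with $\mathrm{thick}$ defined through it, there is an algorithm that, given any formula $\phi$, outputs a logically equivalent formula, over the relation symbols of $\phi$ and with no free variables other than those of $\phi$, in which at most $\max(\mathrm{thick}(\phi),|\mathrm{free}(\phi)|)$ variables occur (counting both free and quantified variables). In particular, for a sentence $\phi$ at most $\mathrm{thick}(\phi)$ variables occur in the output. -/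

import Mathlib

universe u

namespace Thickness

/-! ### Relational first-order logic without equality -/

/-- First-order formulas over relational signatures, with named variables `0, 1, 2, …`.
A relation symbol is a pair consisting of a name `R : ℕ` and an arity, and
`atom R [v₁, …, vₖ]` applies the `k`-ary symbol named `R` to `(v₁, …, vₖ)`; so there are countably
many symbols of every arity. -/
inductive Formula : Type
  | atom (R : ℕ) (vs : List ℕ)
  | not (φ : Formula)
  | and (φ ψ : Formula)
  | or (φ ψ : Formula)
  | ex (x : ℕ) (φ : Formula)
  | all (x : ℕ) (φ : Formula)

namespace Formula

/-- The free variables of a formula. -/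
def free : Formula → Finset ℕ
  | atom _ vs => vs.toFinset
  | not φ => φ.free
  | and φ ψ => φ.free ∪ ψ.free
  | or φ ψ => φ.free ∪ ψ.free
  | ex x φ => φ.free.erase x
  | all x φ => φ.free.erase x

/-- All variables that occur in a formula: in an atom, or next to a quantifier. -/
def vars : Formula → Finset ℕ
  | atom _ vs => vs.toFinset
  | not φ => φ.vars
  | and φ ψ => φ.vars ∪ ψ.vars
  | or φ ψ => φ.vars ∪ ψ.vars
  | ex x φ => insert x φ.vars
  | all x φ => insert x φ.vars

/-- The relation symbols (name, arity) that occur in a formula. -/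
def symbols : Formula → Finset (ℕ × ℕ)
  | atom R vs => {(R, vs.length)}
  | not φ => φ.symbols
  | and φ ψ => φ.symbols ∪ ψ.symbols
  | or φ ψ => φ.symbols ∪ ψ.symbols
  | ex _ φ => φ.symbols
  | all _ φ => φ.symbols

/-- `φ.Realize I s`: the structure with universe `A`, in which the `k`-ary symbol named `R` is
interpreted by the lists `l` of length `k` with `I R l`, satisfies `φ` under the assignment `s`. -/
def Realize {A : Type u} (I : ℕ → List A → Prop) : (ℕ → A) → Formula → Prop
  | s, atom R vs => I R (vs.map s)
  | s, not φ => ¬ Realize I s φ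
  | s, and φ ψ => Realize I s φ ∧ Realize I s ψ
  | s, or φ ψ => Realize I s φ ∨ Realize I s ψ
  | s, ex x φ => ∃ a : A, Realize I (Function.update s x a) φ
  | s, all x φ => ∀ a : A, Realize I (Function.update s x a) φ

/-- Logical equivalence: the same truth value in every structure under every assignment. -/
def Equivalent (φ ψ : Formula) : Prop :=
  ∀ (A : Type u) (I : ℕ → List A → Prop) (s : ℕ → A), Realize I s φ ↔ Realize I s ψ

/-- The conjunction `(⋯((φ₁ ∧ φ₂) ∧ φ₃)⋯)` of a nonempty list (the value at `[]` is irrelevant). -/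
def conj : List Formula → Formula
  | [] => atom 0 []
  | φ :: l => l.foldl and φ

/-- The disjunction `(⋯((φ₁ ∨ φ₂) ∨ φ₃)⋯)` of a nonempty list (the value at `[]` is irrelevant). -/
def disj : List Formula → Formula
  | [] => atom 0 []
  | φ :: l => l.foldl or φ

/-! A Gödel numbering, which is a bijection between formulas and natural numbers. -/

/-- The Gödel number of a formula. -/
def code : Formula → ℕ
  | atom R vs => 6 * Nat.pair R (Encodable.encode vs)
  | not φ => 6 * φ.code + 1
  | and φ ψ => 6 * Nat.pair φ.code ψ.code + 2
  | or φ ψ => 6 * Nat.pair φ.code ψ.code + 3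
  | ex x φ => 6 * Nat.pair x φ.code + 4
  | all x φ => 6 * Nat.pair x φ.code + 5

/-- The formula with a given Gödel number. -/
def ofCode (n : ℕ) : Formula :=
  if n % 6 = 0 then atom (n / 6).unpair.1 (Denumerable.ofNat (List ℕ) (n / 6).unpair.2)
  else if n % 6 = 1 then not (ofCode (n / 6))
  else if n % 6 = 2 then and (ofCode (n / 6).unpair.1) (ofCode (n / 6).unpair.2)
  else if n % 6 = 3 then or (ofCode (n / 6).unpair.1) (ofCode (n / 6).unpair.2)
  else if n % 6 = 4 then ex (n / 6).unpair.1 (ofCode (n / 6).unpair.2)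
  else all (n / 6).unpair.1 (ofCode (n / 6).unpair.2)
termination_by n
decreasing_by
  all_goals
    have h1 := Nat.unpair_left_le (n / 6)
    have h2 := Nat.unpair_right_le (n / 6)
    omega

theorem ofCode_code (φ : Formula) : ofCode φ.code = φ := by
  induction φ with
  | atom R vs =>
    rw [code, ofCode, if_pos (by omega), Nat.mul_div_cancel_left _ (by norm_num)]
    simp
  | not φ ih =>
    have h : (6 * φ.code + 1) / 6 = φ.code := by omega
    rw [code, ofCode, if_neg (by omega), if_pos (by omega), h, ih]
  | and φ ψ ih₁ ih₂ =>
    have h : (6 * Nat.pair φ.code ψ.code + 2) / 6 = Nat.pair φ.code ψ.code := by omega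
    rw [code, ofCode, if_neg (by omega), if_neg (by omega), if_pos (by omega), h]
    simp [ih₁, ih₂]
  | or φ ψ ih₁ ih₂ =>
    have h : (6 * Nat.pair φ.code ψ.code + 3) / 6 = Nat.pair φ.code ψ.code := by omega
    rw [code, ofCode, if_neg (by omega), if_neg (by omega), if_neg (by omega),
      if_pos (by omega), h]
    simp [ih₁, ih₂]
  | ex x φ ih =>
    have h : (6 * Nat.pair x φ.code + 4) / 6 = Nat.pair x φ.code := by omega
    rw [code, ofCode, if_neg (by omega), if_neg (by omega), if_neg (by omega),
      if_neg (by omega), if_pos (by omega), h]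
    simp [ih]
  | all x φ ih =>
    have h : (6 * Nat.pair x φ.code + 5) / 6 = Nat.pair x φ.code := by omega
    rw [code, ofCode, if_neg (by omega), if_neg (by omega), if_neg (by omega),
      if_neg (by omega), if_neg (by omega), h]
    simp [ih]

theorem code_ofCode (n : ℕ) : (ofCode n).code = n := by
  induction n using Nat.strong_induction_on with
  | _ n ih =>
    have h1 := Nat.unpair_left_le (n / 6)
    have h2 := Nat.unpair_right_le (n / 6)
    have h3 := Nat.div_add_mod n 6
    rw [ofCode]
    split_ifs with c0 c1 c2 c3 c4
    · simp only [code, Denumerable.encode_ofNat, Nat.pair_unpair]; omega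
    · rw [code, ih _ (by omega)]; omega
    · rw [code, ih _ (by omega), ih _ (by omega), Nat.pair_unpair]; omega
    · rw [code, ih _ (by omega), ih _ (by omega), Nat.pair_unpair]; omega
    · rw [code, ih _ (by omega), Nat.pair_unpair]; omega
    · rw [code, ih _ (by omega), Nat.pair_unpair]; omega

/-- Formulas correspond to natural numbers through their Gödel numbers. -/
def equivNat : Formula ≃ ℕ := ⟨code, ofCode, ofCode_code, code_ofCode⟩

/-- Computability of functions on formulas refers to the Gödel numbering. -/
instance : Primcodable Formula := Primcodable.ofEquiv ℕ equivNat

end Formula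

/-! ### Treewidth -/

/-- The vertex set of a hypergraph that is specified by its edge set. -/
def verts (E : Finset (Finset ℕ)) : Finset ℕ := E.sup id

/-- `T` with the bags `B` is a tree decomposition of (the graph of) the hypergraph with edge
set `E`, that is, of the graph on `verts E` in which two vertices are adjacent if they are distinct
and lie in a common edge. -/
structure IsTreeDecomposition (E : Finset (Finset ℕ)) {m : ℕ} (T : SimpleGraph (Fin m))
    (B : Fin m → Finset ℕ) : Prop where
  isTree : T.IsTree
  cover : Finset.univ.sup B = verts E
  edge : ∀ e ∈ E, ∀ a ∈ e, ∀ b ∈ e, a ≠ b → ∃ i, a ∈ B i ∧ b ∈ B i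
  connected : ∀ a ∈ verts E, (T.induce {i | a ∈ B i}).Connected

/-- The treewidth of the hypergraph with edge set `E`: the least `k` such that there is a tree
decomposition all of whose bags have at most `k + 1` elements (so it is `0` without vertices). -/
noncomputable def tw (E : Finset (Finset ℕ)) : ℕ :=
  sInf {k | ∃ (m : ℕ) (T : SimpleGraph (Fin m)) (B : Fin m → Finset ℕ),
    IsTreeDecomposition E T B ∧ ∀ i, (B i).card ≤ k + 1}

/-- The hypergraph with edge set `E` is `S`-connected: the graph whose vertices are the members of
`E`, with distinct `e`, `f` adjacent if and only if `S ∩ e ∩ f ≠ ∅`, is connected. -/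
def SConnected (S : Finset ℕ) (E : Finset (Finset ℕ)) : Prop :=
  (SimpleGraph.fromRel fun e f : {e // e ∈ E} => (S ∩ e.1 ∩ f.1).Nonempty).Connected

/-! ### Organized and layered formulas, presented by their trees -/

/-- Formulas that are built from literals by quantifier blocks.
`lit true R vs` and `lit false R vs` are the atom and the negated atom;
`block true X [φ₁, …, φₙ]` is `∃ X (φ₁ ∧ ⋯ ∧ φₙ)` and
`block false X [φ₁, …, φₙ]` is `∀ X (φ₁ ∨ ⋯ ∨ φₙ)`. -/
inductive BlockFormula : Type
  | lit (pos : Bool) (R : ℕ) (vs : List ℕ)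
  | block (q : Bool) (X : List ℕ) (cs : List BlockFormula)

namespace BlockFormula

/-- The formula that a block formula stands for. -/
def toFormula : BlockFormula → Formula
  | lit true R vs => .atom R vs
  | lit false R vs => .not (.atom R vs)
  | block true X cs => X.foldr .ex (Formula.conj (cs.map fun c => c.toFormula))
  | block false X cs => X.foldr .all (Formula.disj (cs.map fun c => c.toFormula))

/-- The Gödel number of a block formula. -/
def code : BlockFormula → ℕ
  | lit pos R vs => 2 * Encodable.encode (pos, R, vs)
  | block q X cs => 2 * Encodable.encode (q, X, cs.map fun c => c.code) + 1

theorem code_injective : ∀ s t : BlockFormula, s.code = t.code → s = t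
  | lit pos R vs, lit pos' R' vs', h => by
    rw [code, code] at h
    have h' := Encodable.encode_injective (Nat.eq_of_mul_eq_mul_left (by norm_num) h)
    simp only [Prod.mk.injEq] at h'
    obtain ⟨rfl, rfl, rfl⟩ := h'
    rfl
  | lit _ _ _, block _ _ _, h => by
    rw [code, code] at h
    omega
  | block _ _ _, lit _ _ _, h => by
    rw [code, code] at h
    omega
  | block q X cs, block q' X' cs', h => by
    rw [code, code] at h
    have h' := Encodable.encode_injective
      (Nat.eq_of_mul_eq_mul_left (by norm_num) (Nat.add_right_cancel h))
    simp only [Prod.mk.injEq] at h'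
    obtain ⟨rfl, rfl, h'⟩ := h'
    have hl : cs = cs' := by
      have hlen : cs.length = cs'.length := by simpa using congrArg List.length h'
      refine List.ext_getElem hlen fun i h₁ h₂ => ?_
      have hi := List.getElem_of_eq h' (by simpa using h₁)
      simp only [List.getElem_map] at hi
      have hd : sizeOf cs[i] < sizeOf cs := List.sizeOf_lt_of_mem (List.getElem_mem h₁)
      exact code_injective cs[i] cs'[i] hi
    rw [hl]
termination_by s => sizeOf s
decreasing_by
  simp only [block.sizeOf_spec]
  omega

/-- The free variables. -/
def free : BlockFormula → Finset ℕ
  | lit _ _ vs => vs.toFinset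
  | block _ X cs => (cs.map fun c => c.free).foldr (· ∪ ·) ∅ \ X.toFinset

/-- The list of all occurrences of quantified variables. -/
def bound : BlockFormula → List ℕ
  | lit _ _ _ => []
  | block _ X cs => X ++ (cs.map fun c => c.bound).flatten

/-- No variable is quantified twice, and no variable is both quantified and free. -/
def VariableLoose (t : BlockFormula) : Prop :=
  t.bound.Nodup ∧ ∀ x ∈ t.bound, x ∉ t.free

/-- The hypergraph `{free φ₁, …, free φₙ}` of a list of formulas. -/
def edges (cs : List BlockFormula) : Finset (Finset ℕ) := (cs.map free).toFinset

/-- The inductive construction of `∃`-layered (`q = true`) and `∀`-layered (`q = false`)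
formulas. -/
inductive LayeredShape : Bool → BlockFormula → Prop
  | lit (q pos : Bool) (R : ℕ) (vs : List ℕ) : LayeredShape q (lit pos R vs)
  | block (q : Bool) (X : List ℕ) (cs : List BlockFormula) :
      cs ≠ [] → (∀ c ∈ cs, LayeredShape (!q) c) → X.toFinset ⊆ verts (edges cs) →
      SConnected X.toFinset (edges cs) → LayeredShape q (block q X cs)

/-- Layered formulas: the variable-loose formulas that are `∃`-layered or `∀`-layered. -/
def IsLayered (t : BlockFormula) : Prop :=
  t.VariableLoose ∧ ∃ q, LayeredShape q t

/-- The thickness of a layered formula: the number of variables for a literal; for a block with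
parts `φ₁, …, φₙ`, the maximum of the local thickness
`1 + tw ({free φ₁, …, free φₙ} ∪ {free φ})` and of the thicknesses of `φ₁, …, φₙ`. -/
noncomputable def thickl : BlockFormula → ℕ
  | lit _ _ vs => vs.toFinset.card
  | block q X cs =>
      max (1 + tw (insert (free (block q X cs)) (edges cs)))
        ((cs.map fun c => c.thickl).foldr max 0)

/-! From organized formulas to layered formulas: rename the quantified variables apart, then merge
adjacent blocks with the same quantifier. -/

mutual

/-- `rename f n t` applies `f` to the free variables of `t` and gives the quantified variables the
consecutive names `n, n + 1, …`. -/
def rename (f : ℕ → ℕ) (n : ℕ) : BlockFormula → BlockFormula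
  | lit pos R vs => lit pos R (vs.map f)
  | block q X cs =>
      block q (List.range' n X.length)
        (renameList (fun x => if x ∈ X then n + X.idxOf x else f x) (n + X.length) cs)

/-- `rename` on a list; the names given in distinct members are distinct. -/
def renameList (f : ℕ → ℕ) (n : ℕ) : List BlockFormula → List BlockFormula
  | [] => []
  | c :: cs => rename f n c :: renameList f (n + c.bound.length) cs

end

/-- The variables quantified by the outermost block, if its quantifier is `q`. -/
def topVars (q : Bool) : BlockFormula → List ℕ
  | lit _ _ _ => []
  | block q' X _ => if q' = q then X else []

/-- The parts of the outermost block, if its quantifier is `q`; otherwise the formula itself. -/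
def topParts (q : Bool) : BlockFormula → List BlockFormula
  | lit pos R vs => [lit pos R vs]
  | block q' X cs => if q' = q then cs else [block q' X cs]

/-- Merge adjacent blocks with the same quantifier, from the innermost blocks outwards. -/
def merge : BlockFormula → BlockFormula
  | lit pos R vs => lit pos R vs
  | block q X cs =>
      let ds := cs.map fun c => c.merge
      block q (X ++ ds.flatMap (topVars q)) (ds.flatMap (topParts q))

/-- The layered formula that is computed from an organized formula. -/
def layer (t : BlockFormula) : BlockFormula :=
  (rename id (t.free.sup id + 1) t).merge

end BlockFormula

open BlockFormula

/-! ### Normal forms and thickness of arbitrary formulas -/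

/-- Quantify the variable `x` (existentially if `q`, in a conjunction; universally if not, in a
disjunction) over those members of the list in which it is free; the other members are moved out of
the scope of the quantifier, which is dropped if no member is left in its scope. -/
def quantify (q : Bool) (x : ℕ) (l : List BlockFormula) : List BlockFormula :=
  let inside := l.filter fun c => x ∈ c.free
  let outside := l.filter fun c => x ∉ c.free
  if inside.isEmpty then outside else block q [x] inside :: outside

/-- A CNF and a DNF of organized formulas for a formula that is given by its CNF: the DNF is
obtained by distributivity. -/
def ofCNF (C : List (List BlockFormula)) :
    List (List BlockFormula) × List (List BlockFormula) := (C, C.sections)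

/-- A CNF and a DNF of organized formulas for a formula that is given by its DNF: the CNF is
obtained by distributivity. -/
def ofDNF (D : List (List BlockFormula)) :
    List (List BlockFormula) × List (List BlockFormula) := (D.sections, D)

/-- The pair of a CNF and a DNF of organized formulas, for `φ` if `pos = true` and for `¬ φ`, with
negations pushed to the atoms, if `pos = false`. A CNF is given as a list of disjunctions, a DNF as
a list of conjunctions. -/
def normalForms : Bool → Formula → List (List BlockFormula) × List (List BlockFormula)
  | pos, .atom R vs => ([[lit pos R vs]], [[lit pos R vs]])
  | pos, .not φ => normalForms (!pos) φ
  | true, .and φ ψ => ofCNF ((normalForms true φ).1 ++ (normalForms true ψ).1)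
  | false, .and φ ψ => ofDNF ((normalForms false φ).2 ++ (normalForms false ψ).2)
  | true, .or φ ψ => ofDNF ((normalForms true φ).2 ++ (normalForms true ψ).2)
  | false, .or φ ψ => ofCNF ((normalForms false φ).1 ++ (normalForms false ψ).1)
  | true, .ex x φ => ofDNF ((normalForms true φ).2.map (quantify true x))
  | false, .ex x φ => ofCNF ((normalForms false φ).1.map (quantify false x))
  | true, .all x φ => ofCNF ((normalForms true φ).1.map (quantify false x))
  | false, .all x φ => ofDNF ((normalForms false φ).2.map (quantify true x))

/-- The CNF of organized formulas that is computed for `φ`. -/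
def org (φ : Formula) : List (List BlockFormula) := (normalForms true φ).1

/-- Positive combinations of block formulas: they are built by conjunction and disjunction. -/
inductive PosComb : Type
  | base (t : BlockFormula)
  | and (p q : PosComb)
  | or (p q : PosComb)

namespace PosComb

/-- The formula that a positive combination stands for. -/
def toFormula : PosComb → Formula
  | base t => t.toFormula
  | and p q => .and p.toFormula q.toFormula
  | or p q => .or p.toFormula q.toFormula

/-- The block formulas that are combined. -/
def parts : PosComb → List BlockFormula
  | base t => [t]
  | and p q => p.parts ++ q.parts
  | or p q => p.parts ++ q.parts

/-- The Gödel number of a positive combination. -/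
def code : PosComb → ℕ
  | base t => 3 * t.code
  | and p q => 3 * Nat.pair p.code q.code + 1
  | or p q => 3 * Nat.pair p.code q.code + 2

theorem code_injective : ∀ p q : PosComb, p.code = q.code → p = q := by
  intro p
  induction p with
  | base s =>
    intro q h
    cases q <;> simp only [code] at h <;> first | omega | skip
    exact congrArg base (BlockFormula.code_injective _ _ (Nat.eq_of_mul_eq_mul_left (by norm_num) h))
  | and p₁ p₂ ih₁ ih₂ =>
    intro q h
    cases q <;> simp only [code] at h <;> first | omega | skip
    have h' := Nat.pair_eq_pair.1 (Nat.eq_of_mul_eq_mul_left (by norm_num) (Nat.add_right_cancel h))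
    rw [ih₁ _ h'.1, ih₂ _ h'.2]
  | or p₁ p₂ ih₁ ih₂ =>
    intro q h
    cases q <;> simp only [code] at h <;> first | omega | skip
    have h' := Nat.pair_eq_pair.1 (Nat.eq_of_mul_eq_mul_left (by norm_num) (Nat.add_right_cancel h))
    rw [ih₁ _ h'.1, ih₂ _ h'.2]

/-- The conjunction of a nonempty list (the value at `[]` is irrelevant). -/
def conj : List PosComb → PosComb
  | [] => base (lit true 0 [])
  | p :: l => l.foldl and p

/-- The disjunction of a nonempty list (the value at `[]` is irrelevant). -/
def disj : List PosComb → PosComb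
  | [] => base (lit true 0 [])
  | p :: l => l.foldl or p

end PosComb

/-- The positive combination of layered formulas that is computed for `φ`: the CNF `org φ`, with
every organized formula replaced by its layered formula. -/
def lay (φ : Formula) : PosComb :=
  .conj ((org φ).map fun D => .disj (D.map fun t => .base t.layer))

/-- `L` is an algorithm that, given a formula `φ`, outputs a positive combination of layered
formulas that is logically equivalent to `φ` (over the signature of `φ`, and without introducing
free variables). -/
structure IsLayering (L : Formula → PosComb) : Prop where
  computable : Computable fun φ => (L φ).code
  layered : ∀ φ, ∀ t ∈ (L φ).parts, t.IsLayered
  equivalent : ∀ φ, Formula.Equivalent.{u} (L φ).toFormula φ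
  free_subset : ∀ φ, (L φ).toFormula.free ⊆ φ.free
  symbols_subset : ∀ φ, (L φ).toFormula.symbols ⊆ φ.symbols

/-- The thickness of a formula `φ`, with respect to the normal form `L`: the maximum of the
thicknesses of the layered formulas of which `L φ` is a positive combination. -/
noncomputable def thick (L : Formula → PosComb) (φ : Formula) : ℕ :=
  ((L φ).parts.map thickl).foldr max 0

end Thickness

open Thickness

-- For (1), everything is done at a fixed truth value `q`. An ∃-block over a conjunction being true,
-- and a ∀-block over a disjunction being false, say the same thing: some values of the block
-- variables give all parts the truth value `q` (`holds_block`). So DNFs and CNFs obey one law.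
-- Distributivity exchanges them (`IsNormalForm.sections`), and quantification commutes with the
-- choice of a clause (`IsNormalForm.quantify`). Induction on the formula
-- (`isNormalForm_normalForms`) gives normal forms made of organized formulas, in which a quantified
-- variable is free in every part of its block. Renaming with consecutive new names makes these
-- variable-loose, and then merging captures nothing (`realize_merge`). The merged blocks are
-- connected: the parts coming from one child are linked by the variables pulled out of it, and the
-- variable `x` of the outer block is free in one of these parts, for every child, so `x` links the
-- groups (`Organized.layeredShape_merge`).
--
-- For (2), the intermediate measure is `width`. Let a block quantify `X` and have free variables
-- `F`. Take an optimal tree decomposition of the hypergraph formed by the free variables of the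
-- parts and `F`. Joining all vertices that share a bag gives a chordal graph in which `F` is a
-- clique, so as long as vertices outside of `F` are left, one of them is simplicial: all bags that
-- contain it lie in a single bag (`exists_simplicial`). Quantifying it over just the parts in which
-- it is free creates a formula whose free variables, together with it, lie in that bag. Delete it
-- from the bags and repeat (`exists_elim_order`). In the end all free variables lie in `F`, which
-- fits into a bag (`exists_subset_bag`). Hence some elimination order has width at most the
-- thickness (`width_best_le`). The algorithm never computes a treewidth: it tries all sequences of
-- the right length and keeps a result of least width.
--
-- The outer combination by ∧ and ∨ adds only subformulas with at most |free φ| free variables.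
-- Finally, width `w` means that `w` names suffice: at a quantifier fewer than `w` other variables
-- are free in the scope, so one of `w` names can be reused (`freshVar_spec`, `realize_recolor`).
--
-- All these steps are primitive recursive, by course-of-values recursion on Gödel numbers
-- (`primrec_of_calls`).

namespace Thickness

/-! ### Primitive recursion on syntax trees -/

section Coding

open Primrec Encodable

variable {α σ : Type*} [Primcodable α] [Primcodable σ]

/-- Course-of-values recursion: `f a` is computed from the values of `f` at the members of a list
of arguments of smaller measure. -/
theorem primrec_of_calls {f : α → σ} {m : α → ℕ} {calls : α → List α} {g : α → List σ → σ}
    (hm : Primrec m) (hc : Primrec calls) (hg : Primrec₂ g)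
    (hlt : ∀ a, ∀ b ∈ calls a, m b < m a) (hf : ∀ a, f a = g a ((calls a).map f)) : Primrec f :=
  nat_omega_rec' f hm hc (Primrec₂.option_some_iff.2 hg) hlt fun a => by rw [← hf a]

theorem encode_lt_encode_of_mem {a : α} {l : List α} (h : a ∈ l) : encode a < encode l := by
  induction l with
  | nil => simp at h
  | cons b l ih =>
    rw [encode_list_cons, Nat.succ_eq_add_one, Nat.lt_succ_iff]
    rcases List.mem_cons.1 h with rfl | h
    · exact Nat.left_le_pair _ _
    · exact (ih h).le.trans (Nat.right_le_pair _ _)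

/-- A type with an injective numbering whose range is primitive recursive. -/
noncomputable abbrev primcodableOfInjective {β : Type*} {c : β → ℕ} (hc : Function.Injective c)
    (hr : PrimrecPred fun n => n ∈ Set.range c) : Primcodable β := by
  classical
  letI : Primcodable {n // n ∈ Set.range c} := Primcodable.subtype hr
  exact Primcodable.ofEquiv {n // n ∈ Set.range c} (Equiv.ofInjective c hc)

end Coding

-- Coding of formulas

namespace Formula

open Primrec Encodable

variable {α σ : Type*} [Primcodable α] [Primcodable σ]

theorem primrec_ofCode : Primrec ofCode :=
  (Primrec.of_equiv_symm (e := equivNat)).of_eq fun _ => rfl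

theorem primrec_code : Primrec code := (Primrec.of_equiv (e := equivNat)).of_eq fun _ => rfl

theorem primrec_of_code {f : α → Formula} (h : Primrec fun a => (f a).code) : Primrec f :=
  encode_iff.1 h

theorem primrec_atom : Primrec₂ atom :=
  primrec_of_code (nat_mul.comp (const 6) (Primrec₂.natPair.comp fst (Primrec.encode.comp snd)))

theorem primrec_not : Primrec not :=
  primrec_of_code (nat_add.comp (nat_mul.comp (const 6) primrec_code) (const 1))

theorem primrec_and : Primrec₂ and :=
  primrec_of_code (nat_add.comp (nat_mul.comp (const 6)
    (Primrec₂.natPair.comp (primrec_code.comp fst) (primrec_code.comp snd))) (const 2))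

theorem primrec_or : Primrec₂ or :=
  primrec_of_code (nat_add.comp (nat_mul.comp (const 6)
    (Primrec₂.natPair.comp (primrec_code.comp fst) (primrec_code.comp snd))) (const 3))

theorem primrec_ex : Primrec₂ ex :=
  primrec_of_code (nat_add.comp (nat_mul.comp (const 6)
    (Primrec₂.natPair.comp fst (primrec_code.comp snd))) (const 4))

theorem primrec_all : Primrec₂ all :=
  primrec_of_code (nat_add.comp (nat_mul.comp (const 6)
    (Primrec₂.natPair.comp fst (primrec_code.comp snd))) (const 5))

/-- Case distinction, where conjunction and disjunction are treated alike (`true` stands for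
conjunction), and so are the quantifiers (`true` stands for `∃`). -/
def cases (g₁ : ℕ × List ℕ → σ) (g₂ : Formula → σ) (g₃ : Bool × Formula × Formula → σ)
    (g₄ : Bool × ℕ × Formula → σ) : Formula → σ
  | atom R vs => g₁ (R, vs)
  | not φ => g₂ φ
  | and φ ψ => g₃ (true, φ, ψ)
  | or φ ψ => g₃ (false, φ, ψ)
  | ex x φ => g₄ (true, x, φ)
  | all x φ => g₄ (false, x, φ)

/-- The residue of the code modulo 6 reveals the constructor, and the quotient holds the arguments.
-/
theorem primrec_cases {f : α → Formula} {g₁ : α → ℕ × List ℕ → σ} {g₂ : α → Formula → σ}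
    {g₃ : α → Bool × Formula × Formula → σ} {g₄ : α → Bool × ℕ × Formula → σ} (hf : Primrec f)
    (h₁ : Primrec₂ g₁) (h₂ : Primrec₂ g₂) (h₃ : Primrec₂ g₃) (h₄ : Primrec₂ g₄) :
    Primrec fun a => (f a).cases (g₁ a) (g₂ a) (g₃ a) (g₄ a) := by
  have hc : Primrec fun a => (f a).code := primrec_code.comp hf
  have hm : Primrec fun a => (f a).code % 6 := nat_mod.comp hc (const 6)
  have hd : Primrec fun a => (f a).code / 6 := nat_div.comp hc (const 6)
  have hl : Primrec fun a => ((f a).code / 6).unpair.1 := fst.comp (Primrec.unpair.comp hd)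
  have hr : Primrec fun a => ((f a).code / 6).unpair.2 := snd.comp (Primrec.unpair.comp hd)
  have b₁ : Primrec fun a => g₁ a (((f a).code / 6).unpair.1,
      Denumerable.ofNat (List ℕ) ((f a).code / 6).unpair.2) :=
    h₁.comp .id (pair hl ((Primrec.ofNat (List ℕ)).comp hr))
  have b₂ : Primrec fun a => g₂ a (ofCode ((f a).code / 6)) :=
    h₂.comp .id (primrec_ofCode.comp hd)
  have b₃ (b : Bool) : Primrec fun a => g₃ a (b, ofCode ((f a).code / 6).unpair.1,
      ofCode ((f a).code / 6).unpair.2) :=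
    h₃.comp .id (pair (const b) (pair (primrec_ofCode.comp hl) (primrec_ofCode.comp hr)))
  have b₄ (b : Bool) : Primrec fun a => g₄ a (b, ((f a).code / 6).unpair.1,
      ofCode ((f a).code / 6).unpair.2) :=
    h₄.comp .id (pair (const b) (pair hl (primrec_ofCode.comp hr)))
  have e (k : ℕ) : PrimrecPred fun a => (f a).code % 6 = k := Primrec.eq.comp hm (const k)
  refine (ite (e 0) b₁ (ite (e 1) b₂ (ite (e 2) (b₃ true) (ite (e 3) (b₃ false)
    (ite (e 4) (b₄ true) (b₄ false)))))).of_eq fun a => ?_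
  have hdiv (n k : ℕ) (hk : k < 6) : (6 * n + k) / 6 = n := by omega
  have hmod (n k : ℕ) (hk : k < 6) : (6 * n + k) % 6 = k := by omega
  cases f a <;>
    simp [code, cases, hdiv, hmod, ofCode_code]

theorem code_lt_code_not (φ : Formula) : φ.code < (not φ).code := by rw [code]; omega

theorem code_lt_code_and (φ ψ : Formula) :
    φ.code < (and φ ψ).code ∧ ψ.code < (and φ ψ).code := by
  have h₁ := Nat.left_le_pair φ.code ψ.code
  have h₂ := Nat.right_le_pair φ.code ψ.code
  rw [code]; omega

theorem code_lt_code_or (φ ψ : Formula) :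
    φ.code < (or φ ψ).code ∧ ψ.code < (or φ ψ).code := by
  have h₁ := Nat.left_le_pair φ.code ψ.code
  have h₂ := Nat.right_le_pair φ.code ψ.code
  rw [code]; omega

theorem code_lt_code_ex (x : ℕ) (φ : Formula) : φ.code < (ex x φ).code := by
  have h₂ := Nat.right_le_pair x φ.code
  rw [code]; omega

theorem code_lt_code_all (x : ℕ) (φ : Formula) : φ.code < (all x φ).code := by
  have h₂ := Nat.right_le_pair x φ.code
  rw [code]; omega

end Formula

-- Coding of block formulas

namespace BlockFormula

open Primrec Encodable

variable {α σ : Type*} [Primcodable α] [Primcodable σ]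

theorem induction {P : BlockFormula → Prop} (hlit : ∀ pos R vs, P (lit pos R vs))
    (hblock : ∀ q X cs, (∀ c ∈ cs, P c) → P (block q X cs)) : ∀ t, P t
  | lit pos R vs => hlit pos R vs
  | block q X cs => hblock q X cs fun c hc =>
      have := List.sizeOf_lt_of_mem hc
      induction hlit hblock c
termination_by t => sizeOf t
decreasing_by
  simp only [block.sizeOf_spec]
  omega

/-- Codes of triples that begin with a Boolean do not exhaust ℕ, so `code` is not onto, and its
range must be decided before the type can be `Primcodable`. The numbers `k` on the right are smaller
than `n`, which makes this a course-of-values recursion. `decode₂` accepts only numbers that are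
actually codes. -/
theorem mem_range_code_iff (n : ℕ) : n ∈ Set.range code ↔
    (n % 2 = 0 ∧ n / 2 ∈ Set.range (encode : Bool × ℕ × List ℕ → ℕ)) ∨
    (n % 2 = 1 ∧ ∃ y : Bool × List ℕ × List ℕ, y ∈ decode₂ (Bool × List ℕ × List ℕ) (n / 2) ∧
      ∀ k ∈ y.2.2, k ∈ Set.range code) := by
  constructor
  · rintro ⟨t, rfl⟩
    cases t with
    | lit p R vs =>
      left
      rw [code]
      exact ⟨by omega, ⟨(p, R, vs), by omega⟩⟩
    | block q X cs =>
      right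
      rw [code]
      refine ⟨by omega, (q, X, cs.map code), ?_, fun k hk => ?_⟩
      · rw [mem_decode₂, Nat.mul_add_div (by norm_num)]
        simp
      · obtain ⟨c, -, rfl⟩ := List.mem_map.1 hk
        exact ⟨c, rfl⟩
  · rintro (⟨h, ⟨p, R, vs⟩, hy⟩ | ⟨h, ⟨q, X, ns⟩, hy, hk⟩)
    · exact ⟨lit p R vs, by rw [code, hy]; omega⟩
    · rw [mem_decode₂] at hy
      have hl : ∃ cs : List BlockFormula, cs.map code = ns := by
        have h : ns ∈ Set.range (List.map code) := by rw [Set.range_list_map]; exact hk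
        exact h
      obtain ⟨cs, rfl⟩ := hl
      exact ⟨block q X cs, by rw [code, hy]; omega⟩

theorem primrecPred_range_code : PrimrecPred fun n => n ∈ Set.range code := by
  classical
  apply Primrec.primrecPred
  have h0 : PrimrecPred fun n : ℕ => n % 2 = 0 := Primrec.eq.comp (nat_mod.comp .id (const 2))
    (const 0)
  have hd : Primrec fun n : ℕ => decode₂ (Bool × List ℕ × List ℕ) (n / 2) :=
    Primrec.decode₂.comp (nat_div.comp .id (const 2))
  refine primrec_of_calls (m := id)
    (calls := fun n => if n % 2 = 0 then [] else
      ((decode₂ (Bool × List ℕ × List ℕ) (n / 2)).map fun y => y.2.2).getD [])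
    (g := fun n rs => if n % 2 = 0 then
        decide (n / 2 ∈ Set.range (encode : Bool × ℕ × List ℕ → ℕ))
      else (decode₂ (Bool × List ℕ × List ℕ) (n / 2)).isSome && decide (∀ r ∈ rs, r = true))
    .id ?_ ?_ ?_ ?_
  · exact ite h0 (const _) (option_getD.comp
      (option_map hd (snd.comp (snd.comp snd)).to₂) (const _))
  · refine ite (h0.comp fst) ?_ (Primrec.and.comp (option_isSome.comp (hd.comp fst)) ?_)
    · exact (Primcodable.mem_range_encode.comp
        (nat_div.comp fst (const 2))).decide
    · exact (PrimrecPred.forall_mem_list (Primrec.eq.comp .id (const true))).decide.comp snd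
  · intro n k hk
    split_ifs at hk with h
    · simp at hk
    · cases hy : decode₂ (Bool × List ℕ × List ℕ) (n / 2) with
      | none => simp [hy] at hk
      | some y =>
        obtain ⟨q, X, ns⟩ := y
        simp only [hy, Option.map_some, Option.getD_some] at hk
        have hy' := mem_decode₂.1 (Option.mem_def.2 hy)
        have h₁ := encode_lt_encode_of_mem hk
        have h₂ := Nat.right_le_pair (encode q) (encode (X, ns))
        have h₃ := Nat.right_le_pair (encode X) (encode ns)
        rw [← encode_prod_val] at h₂ h₃
        rw [encode_nat] at h₁
        simp only [id]
        omega
  · intro n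
    by_cases h : n % 2 = 0
    · simp only [h, if_true]
      rw [decide_eq_decide, mem_range_code_iff]
      simp [h]
    · have h' : n % 2 = 1 := by omega
      simp only [h, if_false]
      rw [eq_comm, ← Bool.coe_iff_coe, decide_eq_true_iff, mem_range_code_iff]
      cases hy : decode₂ (Bool × List ℕ × List ℕ) (n / 2) with
      | none => simp [h]
      | some y => simp [h']

noncomputable instance : Primcodable BlockFormula :=
  primcodableOfInjective (c := code) code_injective primrecPred_range_code

theorem encode_eq (t : BlockFormula) : encode t = t.code := rfl

/-- Lets a block be encoded as the triple of its components, with the parts as objects instead of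
numbers; blocks can then be built and taken apart by the generic encodings of products and lists. -/
theorem encode_list_eq (cs : List BlockFormula) : encode cs = encode (cs.map code) := by
  induction cs with
  | nil => rfl
  | cons c cs ih => rw [List.map_cons, encode_list_cons, encode_list_cons, ih]; rfl

theorem primrec_code : Primrec code := Primrec.encode.of_eq encode_eq

theorem primrec_of_code {f : α → BlockFormula} (h : Primrec fun a => (f a).code) : Primrec f :=
  encode_iff.1 h

theorem code_block (q : Bool) (X : List ℕ) (cs : List BlockFormula) :
    (block q X cs).code = 2 * encode (q, X, cs) + 1 := by
  rw [code, encode_prod_val, encode_prod_val, encode_prod_val, encode_prod_val, encode_list_eq]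

theorem primrec_lit : Primrec fun y : Bool × ℕ × List ℕ => lit y.1 y.2.1 y.2.2 :=
  primrec_of_code ((nat_mul.comp (const 2) Primrec.encode).of_eq fun y => by rw [code])

theorem primrec_block :
    Primrec fun y : Bool × List ℕ × List BlockFormula => block y.1 y.2.1 y.2.2 :=
  primrec_of_code ((nat_add.comp (nat_mul.comp (const 2) Primrec.encode) (const 1)).of_eq
    fun y => by rw [code_block])

/-- Case distinction. -/
def cases (g : Bool × ℕ × List ℕ → σ) (h : Bool × List ℕ × List BlockFormula → σ) :
    BlockFormula → σ
  | lit pos R vs => g (pos, R, vs)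
  | block q X cs => h (q, X, cs)

theorem primrec_cases {f : α → BlockFormula} {g : α → Bool × ℕ × List ℕ → σ}
    {h : α → Bool × List ℕ × List BlockFormula → σ} (hf : Primrec f) (hg : Primrec₂ g)
    (hh : Primrec₂ h) : Primrec fun a => (f a).cases (g a) (h a) := by
  have hc : Primrec fun a => (f a).code := primrec_code.comp hf
  have hd : Primrec fun a => (f a).code / 2 := nat_div.comp hc (const 2)
  have b₁ : Primrec fun a =>
      (decode (α := Bool × ℕ × List ℕ) ((f a).code / 2)).map (g a) :=
    option_map (Primrec.decode.comp hd) hg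
  have b₂ : Primrec fun a =>
      (decode (α := Bool × List ℕ × List BlockFormula) ((f a).code / 2)).map (h a) :=
    option_map (Primrec.decode.comp hd) hh
  refine option_some_iff.1 ((ite (Primrec.eq.comp (nat_mod.comp hc (const 2)) (const 0))
    b₁ b₂).of_eq fun a => ?_)
  cases f a with
  | lit p R vs =>
    have e : (lit p R vs).code / 2 = encode (p, R, vs) := by rw [code]; omega
    rw [if_pos (by rw [code]; omega), e, encodek]
    rfl
  | block q X cs =>
    have e : (block q X cs).code / 2 = encode (q, X, cs) := by rw [code_block]; omega
    rw [if_neg (by rw [code_block]; omega), e, encodek]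
    rfl

theorem code_lt_code_block {c : BlockFormula} {cs : List BlockFormula} (h : c ∈ cs) (q : Bool)
    (X : List ℕ) : c.code < (block q X cs).code := by
  have h₁ := encode_lt_encode_of_mem h
  have h₂ := Nat.right_le_pair (encode q) (encode (X, cs))
  have h₃ := Nat.right_le_pair (encode X) (encode cs)
  rw [← encode_prod_val] at h₂ h₃
  rw [encode_eq] at h₁
  rw [code_block]
  omega

/-- Structural recursion. -/
theorem primrec_rec {F : BlockFormula → σ} {g : Bool × ℕ × List ℕ → σ}
    {h : Bool × List ℕ × List BlockFormula → List σ → σ} (hg : Primrec g) (hh : Primrec₂ h)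
    (Hlit : ∀ p R vs, F (lit p R vs) = g (p, R, vs))
    (Hblock : ∀ q X cs, F (block q X cs) = h (q, X, cs) (cs.map F)) : Primrec F := by
  refine primrec_of_calls (m := code) (calls := cases (fun _ => []) fun y => y.2.2)
    (g := fun t rs => t.cases g fun y => h y rs) primrec_code ?_ ?_ ?_ ?_
  · exact primrec_cases .id (Primrec₂.const _) (snd.comp (snd.comp snd)).to₂
  · exact primrec_cases fst (hg.comp snd).to₂ (hh.comp snd (snd.comp fst)).to₂
  · rintro (_ | _) b hb
    · simp [cases] at hb
    · exact code_lt_code_block hb _ _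
  · rintro (_ | _)
    · exact Hlit _ _ _
    · exact Hblock _ _ _

end BlockFormula

-- Coding of positive combinations

namespace PosComb

open Primrec Encodable

variable {α σ : Type*} [Primcodable α] [Primcodable σ]

theorem mem_range_code_iff (n : ℕ) : n ∈ Set.range code ↔
    (n % 3 = 0 ∧ n / 3 ∈ Set.range BlockFormula.code) ∨
    (n % 3 ≠ 0 ∧ (n / 3).unpair.1 ∈ Set.range code ∧ (n / 3).unpair.2 ∈ Set.range code) := by
  constructor
  · rintro ⟨t, rfl⟩
    cases t with
    | base t =>
      left
      rw [code]
      exact ⟨by omega, ⟨t, by omega⟩⟩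
    | and p q =>
      right
      have h : (and p q).code / 3 = Nat.pair p.code q.code := by rw [code]; omega
      rw [h, Nat.unpair_pair]
      exact ⟨by rw [code]; omega, ⟨p, rfl⟩, ⟨q, rfl⟩⟩
    | or p q =>
      right
      have h : (or p q).code / 3 = Nat.pair p.code q.code := by rw [code]; omega
      rw [h, Nat.unpair_pair]
      exact ⟨by rw [code]; omega, ⟨p, rfl⟩, ⟨q, rfl⟩⟩
  · rintro (⟨h, t, ht⟩ | ⟨h, ⟨p, hp⟩, q, hq⟩)
    · exact ⟨base t, by rw [code, ht]; omega⟩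
    · have hpq : Nat.pair p.code q.code = n / 3 := by rw [hp, hq, Nat.pair_unpair]
      rcases (by omega : n % 3 = 1 ∨ n % 3 = 2) with h | h
      · exact ⟨and p q, by rw [code, hpq]; omega⟩
      · exact ⟨or p q, by rw [code, hpq]; omega⟩

theorem primrecPred_range_code : PrimrecPred fun n => n ∈ Set.range code := by
  classical
  apply Primrec.primrecPred
  have h0 : PrimrecPred fun n : ℕ => n % 3 = 0 :=
    Primrec.eq.comp (nat_mod.comp .id (const 3)) (const 0)
  have hd : Primrec fun n : ℕ => n / 3 := nat_div.comp .id (const 3)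
  refine primrec_of_calls (m := id)
    (calls := fun n => if n % 3 = 0 then [] else [(n / 3).unpair.1, (n / 3).unpair.2])
    (g := fun n rs => if n % 3 = 0 then decide (n / 3 ∈ Set.range BlockFormula.code)
      else decide (∀ r ∈ rs, r = true)) .id ?_ ?_ ?_ ?_
  · exact ite h0 (const _) (list_cons.comp (fst.comp (Primrec.unpair.comp hd))
      (list_cons.comp (snd.comp (Primrec.unpair.comp hd)) (const [])))
  · refine ite (h0.comp fst) ?_ ?_
    · exact (BlockFormula.primrecPred_range_code.comp (hd.comp fst)).decide
    · exact (PrimrecPred.forall_mem_list (Primrec.eq.comp .id (const true))).decide.comp snd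
  · intro n k hk
    split_ifs at hk with h
    · simp at hk
    · have h₁ := Nat.unpair_left_le (n / 3)
      have h₂ := Nat.unpair_right_le (n / 3)
      simp only [List.mem_cons, List.not_mem_nil, or_false] at hk
      simp only [id]
      omega
  · intro n
    by_cases h : n % 3 = 0
    · simp only [h, if_true]
      rw [decide_eq_decide, mem_range_code_iff]
      simp [h]
    · simp only [h, if_false]
      rw [decide_eq_decide, mem_range_code_iff]
      simp [h]

noncomputable instance : Primcodable PosComb :=
  primcodableOfInjective (c := code) code_injective primrecPred_range_code

theorem encode_eq (t : PosComb) : encode t = t.code := rfl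

theorem primrec_code : Primrec code := Primrec.encode.of_eq encode_eq

theorem primrec_of_code {f : α → PosComb} (h : Primrec fun a => (f a).code) : Primrec f :=
  encode_iff.1 h

theorem primrec_base : Primrec base :=
  primrec_of_code (nat_mul.comp (const 3) BlockFormula.primrec_code)

theorem primrec_and : Primrec₂ and :=
  primrec_of_code (nat_add.comp (nat_mul.comp (const 3)
    (Primrec₂.natPair.comp (primrec_code.comp fst) (primrec_code.comp snd))) (const 1))

theorem primrec_or : Primrec₂ or :=
  primrec_of_code (nat_add.comp (nat_mul.comp (const 3)
    (Primrec₂.natPair.comp (primrec_code.comp fst) (primrec_code.comp snd))) (const 2))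

/-- Structural recursion. -/
theorem primrec_rec {F : PosComb → σ} {g : BlockFormula → σ} {h : Bool → σ → σ → σ}
    (hg : Primrec g) (hh : ∀ b, Primrec₂ (h b)) (Hbase : ∀ t, F (base t) = g t)
    (Hand : ∀ p q, F (and p q) = h true (F p) (F q))
    (Hor : ∀ p q, F (or p q) = h false (F p) (F q)) : Primrec F := by
  have hm (k : ℕ) : PrimrecPred fun p : PosComb => p.code % 3 = k :=
    Primrec.eq.comp (nat_mod.comp primrec_code (const 3)) (const k)
  have hd : Primrec fun p : PosComb => p.code / 3 := nat_div.comp primrec_code (const 3)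
  -- `σ` may lack a default value for failed decodings and missing list entries, so the recursion
  -- runs in `Option σ`.
  refine option_some_iff.1 (primrec_of_calls (m := code) (f := fun p => some (F p))
    (calls := fun p => if p.code % 3 = 0 then [] else
      ((decode (p.code / 3).unpair.1).toList ++ (decode (p.code / 3).unpair.2).toList))
    (g := fun p rs => if p.code % 3 = 0 then (decode (p.code / 3)).map g else
      (rs[0]?.getD none).bind fun a => (rs[1]?.getD none).map fun b =>
        if p.code % 3 = 1 then h true a b else h false a b) primrec_code ?_ ?_ ?_ ?_)
  · exact ite (hm 0) (const _) (list_append.comp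
      (optionToList.comp (Primrec.decode.comp (fst.comp (Primrec.unpair.comp hd))))
      (optionToList.comp (Primrec.decode.comp (snd.comp (Primrec.unpair.comp hd)))))
  · refine ite ((hm 0).comp fst)
      (option_map (Primrec.decode.comp (hd.comp fst)) (hg.comp snd).to₂) ?_
    refine option_bind (option_getD.comp (list_getElem?.comp snd (const 0)) (const none)) ?_
    refine option_map (f := fun y : (PosComb × List (Option σ)) × σ => y.1.2[1]?.getD none)
      (option_getD.comp (list_getElem?.comp (snd.comp fst) (const 1)) (const none)) ?_
    exact ite ((hm 1).comp (fst.comp (fst.comp fst)))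
      ((hh true).comp (snd.comp fst) snd) ((hh false).comp (snd.comp fst) snd)
  · intro p r hr
    split_ifs at hr with h0
    · simp at hr
    · simp only [List.mem_append, Option.mem_toList] at hr
      cases p with
      | base t => exact absurd (by rw [code]; omega) h0
      | and p q =>
        have e : (and p q).code / 3 = Nat.pair p.code q.code := by rw [code]; omega
        have h₁ := Nat.left_le_pair p.code q.code
        have h₂ := Nat.right_le_pair p.code q.code
        rw [e, Nat.unpair_pair, ← encode_eq, ← encode_eq] at hr
        simp only [encodek, Option.some.injEq] at hr
        rw [code]
        rcases hr with rfl | rfl <;> omega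
      | or p q =>
        have e : (or p q).code / 3 = Nat.pair p.code q.code := by rw [code]; omega
        have h₁ := Nat.left_le_pair p.code q.code
        have h₂ := Nat.right_le_pair p.code q.code
        rw [e, Nat.unpair_pair, ← encode_eq, ← encode_eq] at hr
        simp only [encodek, Option.some.injEq] at hr
        rw [code]
        rcases hr with rfl | rfl <;> omega
  · intro p
    cases p with
    | base t =>
      have e : (base t).code / 3 = encode t := by rw [code, BlockFormula.encode_eq]; omega
      rw [if_pos (by rw [code]; omega), e, encodek, Hbase]
      rfl
    | and p q =>
      have e : (and p q).code / 3 = Nat.pair p.code q.code := by rw [code]; omega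
      have e₁ : (and p q).code % 3 = 1 := by rw [code]; omega
      rw [if_neg (by omega), if_neg (by omega), e, Nat.unpair_pair, ← encode_eq, ← encode_eq]
      simp [encodek, Hand, e₁]
    | or p q =>
      have e : (or p q).code / 3 = Nat.pair p.code q.code := by rw [code]; omega
      have e₁ : (or p q).code % 3 = 2 := by rw [code]; omega
      rw [if_neg (by omega), if_neg (by omega), e, Nat.unpair_pair, ← encode_eq, ← encode_eq]
      simp [encodek, Hor, e₁]

end PosComb

/-! ### Semantics: conjunctions and disjunctions, `∃` and `∀` are treated alike -/

namespace Formula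

variable {A : Type u} {I : ℕ → List A → Prop}

/-- The conjunction (`q = true`) or disjunction (`q = false`) of a list. -/
def bigOp (q : Bool) (l : List Formula) : Formula := if q then conj l else disj l

/-- Quantification: `∃` if `q = true`, and `∀` if `q = false`. -/
def quant (q : Bool) (x : ℕ) (φ : Formula) : Formula := if q then ex x φ else all x φ

/-- `φ` has the truth value `q`. -/
def Holds (I : ℕ → List A → Prop) (q : Bool) (s : ℕ → A) (φ : Formula) : Prop :=
  Realize I s φ ↔ q = true

@[simp] theorem holds_true (s : ℕ → A) (φ : Formula) : Holds I true s φ ↔ Realize I s φ := by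
  simp [Holds]

@[simp] theorem holds_false (s : ℕ → A) (φ : Formula) : Holds I false s φ ↔ ¬ Realize I s φ := by
  simp [Holds]

theorem holds_not_iff (q : Bool) (s : ℕ → A) (φ : Formula) :
    Holds I (!q) s φ ↔ ¬ Holds I q s φ := by
  cases q <;> simp

theorem realize_congr (φ : Formula) {s t : ℕ → A} (h : ∀ x ∈ φ.free, s x = t x) :
    Realize I s φ ↔ Realize I t φ := by
  induction φ generalizing s t with
  | atom R vs =>
    have : vs.map s = vs.map t := List.map_congr_left fun x hx => h x (by simpa [free] using hx)
    simp [Realize, this]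
  | not φ ih => exact not_congr (ih h)
  | and φ ψ ih₁ ih₂ =>
    exact and_congr (ih₁ fun x hx => h x (by simp [free, hx]))
      (ih₂ fun x hx => h x (by simp [free, hx]))
  | or φ ψ ih₁ ih₂ =>
    exact or_congr (ih₁ fun x hx => h x (by simp [free, hx]))
      (ih₂ fun x hx => h x (by simp [free, hx]))
  | ex x φ ih =>
    refine exists_congr fun a => ih fun y hy => ?_
    by_cases hxy : y = x
    · simp [hxy]
    · simpa [hxy] using h y (by simp [free, hy, hxy])
  | all x φ ih =>
    refine forall_congr' fun a => ih fun y hy => ?_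
    by_cases hxy : y = x
    · simp [hxy]
    · simpa [hxy] using h y (by simp [free, hy, hxy])

theorem holds_congr {q : Bool} {φ : Formula} {s t : ℕ → A} (h : ∀ x ∈ φ.free, s x = t x) :
    Holds I q s φ ↔ Holds I q t φ := by
  rw [Holds, Holds, realize_congr φ h]

theorem realize_foldl_and (l : List Formula) (φ : Formula) (s : ℕ → A) :
    Realize I s (l.foldl and φ) ↔ Realize I s φ ∧ ∀ ψ ∈ l, Realize I s ψ := by
  induction l generalizing φ with
  | nil => simp
  | cons ψ l ih => simp [ih, Realize, and_assoc]

theorem realize_foldl_or (l : List Formula) (φ : Formula) (s : ℕ → A) :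
    Realize I s (l.foldl or φ) ↔ Realize I s φ ∨ ∃ ψ ∈ l, Realize I s ψ := by
  induction l generalizing φ with
  | nil => simp
  | cons ψ l ih => simp [ih, Realize, or_assoc]

/-- A disjunction is false if and only if all members are false; so at truth value `q` both
connectives behave like a conjunction. In the same way both quantifiers behave like ∃ in
`holds_quant`. -/
theorem holds_bigOp {q : Bool} {l : List Formula} (hl : l ≠ []) (s : ℕ → A) :
    Holds I q s (bigOp q l) ↔ ∀ φ ∈ l, Holds I q s φ := by
  obtain ⟨φ, l, rfl⟩ := List.exists_cons_of_ne_nil hl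
  cases q
  · simp [bigOp, disj, realize_foldl_or]
  · simp [bigOp, conj, realize_foldl_and]

theorem holds_quant (q : Bool) (x : ℕ) (φ : Formula) (s : ℕ → A) :
    Holds I q s (quant q x φ) ↔ ∃ a, Holds I q (Function.update s x a) φ := by
  cases q <;> simp [quant, Realize]

theorem mem_free_bigOp {q : Bool} {l : List Formula} {x : ℕ} :
    x ∈ (bigOp q l).free ↔ ∃ φ ∈ l, x ∈ φ.free := by
  have h₁ (l : List Formula) (φ : Formula) :
      x ∈ (l.foldl and φ).free ↔ x ∈ φ.free ∨ ∃ ψ ∈ l, x ∈ ψ.free := by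
    induction l generalizing φ with
    | nil => simp
    | cons ψ l ih => simp [ih, free, or_assoc]
  have h₂ (l : List Formula) (φ : Formula) :
      x ∈ (l.foldl or φ).free ↔ x ∈ φ.free ∨ ∃ ψ ∈ l, x ∈ ψ.free := by
    induction l generalizing φ with
    | nil => simp
    | cons ψ l ih => simp [ih, free, or_assoc]
  cases q <;> cases l <;> simp [bigOp, conj, disj, h₁, h₂, free]

theorem mem_symbols_bigOp {q : Bool} {l : List Formula} (hl : l ≠ []) {r : ℕ × ℕ} :
    r ∈ (bigOp q l).symbols ↔ ∃ φ ∈ l, r ∈ φ.symbols := by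
  have h₁ (l : List Formula) (φ : Formula) :
      r ∈ (l.foldl and φ).symbols ↔ r ∈ φ.symbols ∨ ∃ ψ ∈ l, r ∈ ψ.symbols := by
    induction l generalizing φ with
    | nil => simp
    | cons ψ l ih => simp [ih, symbols, or_assoc]
  have h₂ (l : List Formula) (φ : Formula) :
      r ∈ (l.foldl or φ).symbols ↔ r ∈ φ.symbols ∨ ∃ ψ ∈ l, r ∈ ψ.symbols := by
    induction l generalizing φ with
    | nil => simp
    | cons ψ l ih => simp [ih, symbols, or_assoc]
  obtain ⟨φ, l, rfl⟩ := List.exists_cons_of_ne_nil hl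
  cases q <;> simp [bigOp, conj, disj, h₁, h₂]

@[simp] theorem free_quant (q : Bool) (x : ℕ) (φ : Formula) :
    (quant q x φ).free = φ.free.erase x := by
  cases q <;> rfl

@[simp] theorem symbols_quant (q : Bool) (x : ℕ) (φ : Formula) :
    (quant q x φ).symbols = φ.symbols := by
  cases q <;> rfl

/-- The right side depends only on the set of members of `X`: neither the order nor repetitions
matter. -/
theorem holds_foldr_quant (q : Bool) (X : List ℕ) (φ : Formula) (s : ℕ → A) :
    Holds I q s (X.foldr (quant q) φ) ↔ ∃ t : ℕ → A, (∀ x ∉ X, t x = s x) ∧ Holds I q t φ := by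
  induction X generalizing s with
  | nil =>
    constructor
    · exact fun h => ⟨s, fun _ _ => rfl, h⟩
    · rintro ⟨t, ht, h⟩
      rwa [show t = s from funext fun x => ht x List.not_mem_nil] at h
  | cons x X ih =>
    rw [List.foldr_cons, holds_quant]
    constructor
    · rintro ⟨a, ha⟩
      obtain ⟨t, ht, h⟩ := (ih _).1 ha
      refine ⟨t, fun y hy => ?_, h⟩
      rw [List.mem_cons, not_or] at hy
      rw [ht y hy.2, Function.update_of_ne hy.1]
    · rintro ⟨t, ht, h⟩
      refine ⟨t x, (ih _).2 ⟨t, fun y hy => ?_, h⟩⟩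
      by_cases hxy : y = x
      · simp [hxy]
      · rw [Function.update_of_ne hxy, ht y (by simp [hxy, hy])]

@[simp] theorem free_foldr_quant (q : Bool) (X : List ℕ) (φ : Formula) :
    (X.foldr (quant q) φ).free = φ.free \ X.toFinset := by
  induction X with
  | nil => simp
  | cons x X ih =>
    ext y
    simp only [List.foldr_cons, free_quant, ih, Finset.mem_erase, Finset.mem_sdiff,
      List.mem_toFinset, List.mem_cons]
    tauto

@[simp] theorem symbols_foldr_quant (q : Bool) (X : List ℕ) (φ : Formula) :
    (X.foldr (quant q) φ).symbols = φ.symbols := by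
  induction X with
  | nil => rfl
  | cons x X ih => rw [List.foldr_cons, symbols_quant, ih]

theorem equivalent_of_holds {φ ψ : Formula} (q : Bool)
    (h : ∀ (A : Type u) (I : ℕ → List A → Prop) (s : ℕ → A), Holds I q s φ ↔ Holds I q s ψ) :
    Equivalent.{u} φ ψ := by
  intro A I s
  have := h A I s
  cases q
  · simpa [not_iff_not] using this
  · simpa using this

theorem Equivalent.holds_iff {φ ψ : Formula} (h : Equivalent.{u} φ ψ) (q : Bool) (s : ℕ → A) :
    Holds I q s φ ↔ Holds I q s ψ := by
  rw [Holds, Holds, h A I s]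

end Formula

namespace BlockFormula

open Formula

variable {A : Type u} {I : ℕ → List A → Prop}

theorem toFormula_block (q : Bool) (X : List ℕ) (cs : List BlockFormula) :
    (block q X cs).toFormula = X.foldr (quant q) (bigOp q (cs.map toFormula)) := by
  cases q <;> rw [toFormula] <;> rfl

theorem mem_free_block {q : Bool} {X : List ℕ} {cs : List BlockFormula} {x : ℕ} :
    x ∈ (block q X cs).free ↔ (∃ c ∈ cs, x ∈ c.free) ∧ x ∉ X := by
  have h (l : List (Finset ℕ)) : x ∈ l.foldr (· ∪ ·) ∅ ↔ ∃ e ∈ l, x ∈ e := by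
    induction l with
    | nil => simp
    | cons e l ih => simp [ih]
  rw [free]
  simp [h]

theorem free_toFormula (t : BlockFormula) : t.toFormula.free = t.free := by
  induction t using BlockFormula.induction with
  | hlit pos R vs => cases pos <;> simp [toFormula, Formula.free, free]
  | hblock q X cs ih =>
    ext x
    rw [toFormula_block, free_foldr_quant, Finset.mem_sdiff, mem_free_bigOp, mem_free_block,
      List.mem_toFinset]
    refine and_congr_left fun _ => ?_
    simp only [List.mem_map, exists_exists_and_eq_and]
    exact exists_congr fun c => and_congr_right fun hc => by rw [ih c hc]

/-- All blocks have at least one part. -/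
inductive Proper : BlockFormula → Prop
  | lit (pos : Bool) (R : ℕ) (vs : List ℕ) : Proper (lit pos R vs)
  | block (q : Bool) (X : List ℕ) (cs : List BlockFormula) :
      cs ≠ [] → (∀ c ∈ cs, Proper c) → Proper (block q X cs)

theorem LayeredShape.proper {q : Bool} {t : BlockFormula} (h : LayeredShape q t) : t.Proper := by
  induction h with
  | lit => exact .lit _ _ _
  | block q X cs h _ _ _ ih => exact .block _ _ _ h ih

/-- The semantic reading of blocks on which all later equivalences rest. An empty `cs` would denote
the placeholder atom of `conj` and `disj`. -/
theorem holds_block {q : Bool} {X : List ℕ} {cs : List BlockFormula} (hcs : cs ≠ [])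
    (s : ℕ → A) : Holds I q s (block q X cs).toFormula ↔
      ∃ t : ℕ → A, (∀ x ∉ X, t x = s x) ∧ ∀ c ∈ cs, Holds I q t c.toFormula := by
  rw [toFormula_block, holds_foldr_quant]
  refine exists_congr fun t => and_congr_right fun _ => ?_
  rw [holds_bigOp (by simpa using hcs)]
  simp

theorem mem_symbols_block {q : Bool} {X : List ℕ} {cs : List BlockFormula} (hcs : cs ≠ [])
    {r : ℕ × ℕ} :
    r ∈ (block q X cs).toFormula.symbols ↔ ∃ c ∈ cs, r ∈ c.toFormula.symbols := by
  rw [toFormula_block, symbols_foldr_quant, mem_symbols_bigOp (by simpa using hcs)]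
  simp

end BlockFormula

open BlockFormula

/-! ### The normal forms consist of organized formulas -/

/-- Organized formulas: `∃x (⋀ θᵢ)` and `∀x (⋁ θᵢ)` where `x` is free in every `θᵢ`. -/
inductive Organized : BlockFormula → Prop
  | lit (pos : Bool) (R : ℕ) (vs : List ℕ) : Organized (lit pos R vs)
  | block (q : Bool) (x : ℕ) (cs : List BlockFormula) : cs ≠ [] → (∀ c ∈ cs, Organized c) →
      (∀ c ∈ cs, x ∈ c.free) → Organized (block q [x] cs)

theorem Organized.proper {t : BlockFormula} (h : Organized t) : t.Proper := by
  induction h with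
  | lit => exact .lit _ _ _
  | block q x cs h _ _ ih => exact .block _ _ _ h ih

section NormalForms

open Formula

variable {A : Type u} {I : ℕ → List A → Prop}

/-- `L` is a DNF (`q = true`) or CNF (`q = false`) of organized formulas, for `φ` if `pos = true`
and for `¬ φ` if `pos = false`. -/
structure IsNormalForm (q pos : Bool) (φ : Formula) (L : List (List BlockFormula)) : Prop where
  ne_nil : L ≠ []
  clause_ne_nil : ∀ D ∈ L, D ≠ []
  organized : ∀ D ∈ L, ∀ t ∈ D, Organized t
  free : ∀ D ∈ L, ∀ t ∈ D, t.free ⊆ φ.free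
  symbols : ∀ D ∈ L, ∀ t ∈ D, t.toFormula.symbols ⊆ φ.symbols
  -- A DNF is true when some clause is true throughout, and a CNF is false when some clause is false
  -- throughout. Passing from `φ` to `¬ φ` flips the value, hence `q == pos`.
  holds : ∀ (A : Type u) (I : ℕ → List A → Prop) (s : ℕ → A),
    (∃ D ∈ L, ∀ t ∈ D, Holds I q s t.toFormula) ↔ Holds I (q == pos) s φ

/-- The distributive law: a section selects one member from each list. -/
theorem exists_section_forall_iff {β : Type*} (P : β → Prop) (L : List (List β)) :
    (∃ S ∈ L.sections, ∀ t ∈ S, P t) ↔ ∀ D ∈ L, ∃ t ∈ D, P t := by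
  induction L with
  | nil => simp [List.sections]
  | cons D L ih =>
    rw [List.forall_mem_cons, ← ih]
    simp only [List.sections, List.mem_flatMap, List.mem_map]
    constructor
    · rintro ⟨_, ⟨S, hS, t, ht, rfl⟩, h⟩
      rw [List.forall_mem_cons] at h
      exact ⟨⟨t, ht, h.1⟩, S, hS, h.2⟩
    · rintro ⟨⟨t, ht, h⟩, S, hS, hS'⟩
      exact ⟨_, ⟨S, hS, t, ht, rfl⟩, List.forall_mem_cons.2 ⟨h, hS'⟩⟩

theorem exists_mem_of_mem_sections {β : Type*} {L : List (List β)} {S : List β} {t : β}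
    (hS : S ∈ L.sections) (ht : t ∈ S) : ∃ D ∈ L, t ∈ D := by
  induction L generalizing S with
  | nil =>
    rw [List.sections, List.mem_singleton] at hS
    simp [hS] at ht
  | cons D L ih =>
    simp only [List.sections, List.mem_flatMap, List.mem_map] at hS
    obtain ⟨S, hS, t', ht', rfl⟩ := hS
    rcases List.mem_cons.1 ht with rfl | ht
    · exact ⟨D, List.mem_cons_self, ht'⟩
    · obtain ⟨D', hD', h⟩ := ih hS ht
      exact ⟨D', List.mem_cons_of_mem _ hD', h⟩

/-- No clause has value `q` throughout if and only if every clause has a member of value `!q`, that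
is, some section has value `!q` throughout. So negating the invariant at `q` gives the invariant at
`!q`. -/
theorem IsNormalForm.sections {q pos : Bool} {φ : Formula} {L : List (List BlockFormula)}
    (h : IsNormalForm.{u} q pos φ L) : IsNormalForm.{u} (!q) pos φ L.sections where
  ne_nil := by
    obtain ⟨S, hS, -⟩ := (exists_section_forall_iff (fun _ => True) L).2 fun D hD => by
      obtain ⟨t, l, rfl⟩ := List.exists_cons_of_ne_nil (h.clause_ne_nil D hD)
      exact ⟨t, by simp⟩
    exact List.ne_nil_of_mem hS
  clause_ne_nil S hS := by
    rw [← List.length_pos_iff, List.mem_sections_length hS, List.length_pos_iff]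
    exact h.ne_nil
  organized S hS t ht := by
    obtain ⟨D, hD, htD⟩ := exists_mem_of_mem_sections hS ht
    exact h.organized D hD t htD
  free S hS t ht := by
    obtain ⟨D, hD, htD⟩ := exists_mem_of_mem_sections hS ht
    exact h.free D hD t htD
  symbols S hS t ht := by
    obtain ⟨D, hD, htD⟩ := exists_mem_of_mem_sections hS ht
    exact h.symbols D hD t htD
  holds A I s := by
    refine (exists_section_forall_iff (fun t => Holds I (!q) s t.toFormula) L).trans ?_
    have e : ((!q) == pos) = !(q == pos) := by cases q <;> cases pos <;> rfl
    rw [e, holds_not_iff, ← h.holds A I s]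
    simp only [holds_not_iff]
    push Not
    rfl

theorem IsNormalForm.append {q pos : Bool} {φ ψ χ : Formula} {L L' : List (List BlockFormula)}
    (h : IsNormalForm.{u} q pos φ L) (h' : IsNormalForm.{u} q pos ψ L')
    (hf : χ.free = φ.free ∪ ψ.free) (hs : χ.symbols = φ.symbols ∪ ψ.symbols)
    (hh : ∀ (A : Type u) (I : ℕ → List A → Prop) (s : ℕ → A),
      Holds I (q == pos) s χ ↔ Holds I (q == pos) s φ ∨ Holds I (q == pos) s ψ) :
    IsNormalForm.{u} q pos χ (L ++ L') where
  ne_nil := by simp [h.ne_nil]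
  clause_ne_nil D hD := (List.mem_append.1 hD).elim (h.clause_ne_nil D) (h'.clause_ne_nil D)
  organized D hD := (List.mem_append.1 hD).elim (h.organized D) (h'.organized D)
  free D hD t ht := by
    rw [hf]
    exact (List.mem_append.1 hD).elim
      (fun hD => (h.free D hD t ht).trans Finset.subset_union_left)
      (fun hD => (h'.free D hD t ht).trans Finset.subset_union_right)
  symbols D hD t ht := by
    rw [hs]
    exact (List.mem_append.1 hD).elim
      (fun hD => (h.symbols D hD t ht).trans Finset.subset_union_left)
      (fun hD => (h'.symbols D hD t ht).trans Finset.subset_union_right)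
  holds A I s := by
    rw [hh, ← h.holds A I s, ← h'.holds A I s]
    simp only [List.mem_append, or_and_right, exists_or]

theorem mem_quantify {q : Bool} {x : ℕ} {l : List BlockFormula} {t : BlockFormula} :
    t ∈ quantify q x l ↔ (t ∈ l ∧ x ∉ t.free) ∨
      ((∃ c ∈ l, x ∈ c.free) ∧ t = block q [x] (l.filter fun c => x ∈ c.free)) := by
  have hi : (l.filter fun c => decide (x ∈ c.free)).isEmpty = true ↔ ¬ ∃ c ∈ l, x ∈ c.free := by
    simp [List.isEmpty_iff]
  unfold quantify
  simp only
  split_ifs with h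
  · rw [hi] at h
    simp [h]
  · rw [hi, not_not] at h
    simp [h, or_comm]

theorem quantify_ne_nil {q : Bool} {x : ℕ} {l : List BlockFormula} (hl : l ≠ []) :
    quantify q x l ≠ [] := by
  by_cases h : ∃ c ∈ l, x ∈ c.free
  · exact List.ne_nil_of_mem (mem_quantify.2 (Or.inr ⟨h, rfl⟩))
  · push Not at h
    obtain ⟨c, l', rfl⟩ := List.exists_cons_of_ne_nil hl
    exact List.ne_nil_of_mem (mem_quantify.2 (Or.inl ⟨List.mem_cons_self, h c List.mem_cons_self⟩))

theorem filter_ne_nil {x : ℕ} {l : List BlockFormula} (h : ∃ c ∈ l, x ∈ c.free) :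
    (l.filter fun c => decide (x ∈ c.free)) ≠ [] := by
  obtain ⟨c, hc, hx⟩ := h
  exact List.ne_nil_of_mem (List.mem_filter.2 ⟨hc, by simpa using hx⟩)

/-- Members without free `x` do not notice a change of `x`, so they can leave the scope. -/
theorem holds_quantify {q : Bool} {x : ℕ} {l : List BlockFormula} (s : ℕ → A) :
    (∀ t ∈ quantify q x l, Holds I q s t.toFormula) ↔
      ∃ a, ∀ t ∈ l, Holds I q (Function.update s x a) t.toFormula := by
  have hout (t : BlockFormula) (a : A) (ht : x ∉ t.free) :
      Holds I q (Function.update s x a) t.toFormula ↔ Holds I q s t.toFormula :=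
    holds_congr fun y hy => Function.update_of_ne (fun e => ht (by
      rwa [← e, ← free_toFormula])) _ _
  simp only [mem_quantify]
  constructor
  · intro h
    by_cases hx : ∃ c ∈ l, x ∈ c.free
    · have hb := h _ (Or.inr ⟨hx, rfl⟩)
      rw [holds_block (filter_ne_nil hx)] at hb
      obtain ⟨r, hr, hc⟩ := hb
      have hrs : r = Function.update s x (r x) := by
        funext y
        by_cases hy : y = x
        · simp [hy]
        · rw [Function.update_of_ne hy, hr y (by simpa using hy)]
      refine ⟨r x, fun t ht => ?_⟩
      by_cases hxt : x ∈ t.free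
      · rw [← hrs]
        exact hc t (List.mem_filter.2 ⟨ht, by simpa using hxt⟩)
      · exact (hout t _ hxt).2 (h t (Or.inl ⟨ht, hxt⟩))
    · push Not at hx
      -- The quantifier has been dropped and any value will do; `s x` shows that there is one.
      exact ⟨s x, fun t ht => (hout t _ (hx t ht)).2 (h t (Or.inl ⟨ht, hx t ht⟩))⟩
  · rintro ⟨a, ha⟩ t (⟨ht, hxt⟩ | ⟨hx, rfl⟩)
    · exact (hout t a hxt).1 (ha t ht)
    · rw [holds_block (filter_ne_nil hx)]
      exact ⟨Function.update s x a, fun y hy => Function.update_of_ne (by simpa using hy) _ _,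
        fun c hc => ha c (List.mem_filter.1 hc).1⟩

/-- At truth value `q` both the choice of a clause and the quantifier are existential, so they
commute. -/
theorem IsNormalForm.quantify {q pos : Bool} {φ χ : Formula} {L : List (List BlockFormula)} {x : ℕ}
    (h : IsNormalForm.{u} q pos φ L) (hf : χ.free = φ.free.erase x) (hs : χ.symbols = φ.symbols)
    (hh : ∀ (A : Type u) (I : ℕ → List A → Prop) (s : ℕ → A),
      Holds I (q == pos) s χ ↔ ∃ a, Holds I (q == pos) (Function.update s x a) φ) :
    IsNormalForm.{u} q pos χ (L.map (quantify q x)) where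
  ne_nil := by simp [h.ne_nil]
  clause_ne_nil D hD := by
    obtain ⟨D, hDL, rfl⟩ := List.mem_map.1 hD
    exact quantify_ne_nil (h.clause_ne_nil D hDL)
  organized D hD t ht := by
    obtain ⟨D, hDL, rfl⟩ := List.mem_map.1 hD
    rcases mem_quantify.1 ht with ⟨ht, -⟩ | ⟨hx, rfl⟩
    · exact h.organized D hDL t ht
    · exact .block _ _ _ (filter_ne_nil hx)
        (fun c hc => h.organized D hDL c (List.mem_filter.1 hc).1)
        (fun c hc => by simpa using (List.mem_filter.1 hc).2)
  free D hD t ht := by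
    obtain ⟨D, hDL, rfl⟩ := List.mem_map.1 hD
    rw [hf]
    rcases mem_quantify.1 ht with ⟨ht, hx⟩ | ⟨hx, rfl⟩
    · exact fun y hy => Finset.mem_erase.2 ⟨fun e => hx (e ▸ hy), h.free D hDL t ht hy⟩
    · intro y hy
      obtain ⟨⟨c, hc, hyc⟩, hyx⟩ := mem_free_block.1 hy
      exact Finset.mem_erase.2 ⟨by simpa using hyx, h.free D hDL c (List.mem_filter.1 hc).1 hyc⟩
  symbols D hD t ht := by
    obtain ⟨D, hDL, rfl⟩ := List.mem_map.1 hD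
    rw [hs]
    rcases mem_quantify.1 ht with ⟨ht, hx⟩ | ⟨hx, rfl⟩
    · exact h.symbols D hDL t ht
    · intro r hr
      obtain ⟨c, hc, hrc⟩ := (mem_symbols_block (filter_ne_nil hx)).1 hr
      exact h.symbols D hDL c (List.mem_filter.1 hc).1 hrc
  holds A I s := by
    simp only [List.mem_map, exists_exists_and_eq_and, holds_quantify, hh]
    simp only [← h.holds A I]
    constructor
    · rintro ⟨D, hD, a, ha⟩
      exact ⟨a, D, hD, ha⟩
    · rintro ⟨a, D, hD, ha⟩
      exact ⟨D, hD, a, ha⟩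

theorem IsNormalForm.of_not {q pos : Bool} {φ : Formula} {L : List (List BlockFormula)}
    (h : IsNormalForm.{u} q (!pos) φ L) : IsNormalForm.{u} q pos φ.not L where
  __ := h
  holds A I s := by
    rw [h.holds A I s]
    cases q <;> cases pos <;> simp [Realize]

/-- For a connective or quantifier, one of the two normal forms is obtained directly and the other
by taking sections; which one is direct depends on the polarity `pos`. -/
theorem isNormalForm_normalForms (φ : Formula) (pos : Bool) :
    IsNormalForm.{u} false pos φ (normalForms pos φ).1 ∧
      IsNormalForm.{u} true pos φ (normalForms pos φ).2 := by
  have of_cnf {pos φ C} (h : IsNormalForm.{u} false pos φ C) :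
      IsNormalForm.{u} false pos φ (ofCNF C).1 ∧ IsNormalForm.{u} true pos φ (ofCNF C).2 :=
    ⟨h, h.sections⟩
  have of_dnf {pos φ D} (h : IsNormalForm.{u} true pos φ D) :
      IsNormalForm.{u} false pos φ (ofDNF D).1 ∧ IsNormalForm.{u} true pos φ (ofDNF D).2 :=
    ⟨h.sections, h⟩
  induction φ generalizing pos with
  | atom R vs =>
    have h (q : Bool) : IsNormalForm.{u} q pos (.atom R vs) [[lit pos R vs]] :=
      { ne_nil := by simp
        clause_ne_nil := by simp
        organized := by simpa using Organized.lit pos R vs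
        free := by simp [BlockFormula.free, Formula.free]
        symbols := by cases pos <;> simp [toFormula, Formula.symbols]
        holds := fun A I s => by cases q <;> cases pos <;> simp [toFormula, Realize] }
    exact ⟨h false, h true⟩
  | not φ ih =>
    exact ⟨(ih !pos).1.of_not, (ih !pos).2.of_not⟩
  | and φ ψ ih₁ ih₂ =>
    cases pos
    · exact of_dnf ((ih₁ false).2.append (ih₂ false).2 rfl rfl fun A I s => by
        simp [Realize, imp_iff_not_or])
    · exact of_cnf ((ih₁ true).1.append (ih₂ true).1 rfl rfl fun A I s => by
        simp [Realize, imp_iff_not_or])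
  | or φ ψ ih₁ ih₂ =>
    cases pos
    · exact of_cnf ((ih₁ false).1.append (ih₂ false).1 rfl rfl fun A I s => by simp [Realize])
    · exact of_dnf ((ih₁ true).2.append (ih₂ true).2 rfl rfl fun A I s => by simp [Realize])
  | ex x φ ih =>
    cases pos
    · exact of_cnf ((ih false).1.quantify rfl rfl fun A I s => by simp [Realize])
    · exact of_dnf ((ih true).2.quantify rfl rfl fun A I s => by simp [Realize])
  | all x φ ih =>
    cases pos
    · exact of_dnf ((ih false).2.quantify rfl rfl fun A I s => by simp [Realize])
    · exact of_cnf ((ih true).1.quantify rfl rfl fun A I s => by simp [Realize])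

end NormalForms

/-! ### Renaming quantified variables apart -/

namespace BlockFormula

open Formula

variable {A : Type u} {I : ℕ → List A → Prop}

/-- The renaming that is applied in the scope of a block that quantifies `X`, if its quantified
variables are named `n, n + 1, …`. -/
def extendRenaming (f : ℕ → ℕ) (n : ℕ) (X : List ℕ) : ℕ → ℕ :=
  fun x => if x ∈ X then n + X.idxOf x else f x

theorem rename_block (f : ℕ → ℕ) (n : ℕ) (q : Bool) (X : List ℕ) (cs : List BlockFormula) :
    rename f n (block q X cs) = block q (List.range' n X.length)
      (renameList (extendRenaming f n X) (n + X.length) cs) := by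
  rw [rename]
  rfl

/-- For free variables and truth, only the lower bound `n ≤ m` on the first new name of a part
matters. The exact values are needed only for distinctness, in `bound_rename`. -/
theorem forall₂_renameList (f : ℕ → ℕ) (n : ℕ) (cs : List BlockFormula) :
    List.Forall₂ (fun c d => ∃ m, n ≤ m ∧ rename f m c = d) cs (renameList f n cs) := by
  induction cs generalizing n with
  | nil => rw [renameList]; exact .nil
  | cons c cs ih =>
    rw [renameList]
    refine .cons ⟨n, le_rfl, rfl⟩ ((ih _).imp ?_)
    rintro c d ⟨m, hm, rfl⟩
    exact ⟨m, by omega, rfl⟩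

theorem exists_of_mem_renameList {f : ℕ → ℕ} {n : ℕ} {cs : List BlockFormula} {d : BlockFormula}
    (h : d ∈ renameList f n cs) : ∃ c ∈ cs, ∃ m, n ≤ m ∧ rename f m c = d := by
  obtain ⟨i, hi, rfl⟩ := List.getElem_of_mem h
  have hl := (forall₂_renameList f n cs).length_eq
  exact ⟨cs[i], List.getElem_mem _,
    (forall₂_renameList f n cs).get (by simpa [hl] using hi) hi⟩

theorem exists_mem_renameList (f : ℕ → ℕ) (n : ℕ) {cs : List BlockFormula} {c : BlockFormula}
    (h : c ∈ cs) : ∃ m, n ≤ m ∧ rename f m c ∈ renameList f n cs := by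
  obtain ⟨i, hi, rfl⟩ := List.getElem_of_mem h
  have hl := (forall₂_renameList f n cs).length_eq
  obtain ⟨m, hm, e⟩ := (forall₂_renameList f n cs).get hi (by simpa [← hl] using hi)
  exact ⟨m, hm, by simp only [List.get_eq_getElem] at e; rw [e]; exact List.getElem_mem _⟩

theorem renameList_ne_nil {f : ℕ → ℕ} {n : ℕ} {cs : List BlockFormula} (h : cs ≠ []) :
    renameList f n cs ≠ [] := by
  obtain ⟨c, l, rfl⟩ := List.exists_cons_of_ne_nil h
  rw [renameList]
  simp

theorem bound_rename (t : BlockFormula) (f : ℕ → ℕ) (n : ℕ) :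
    (rename f n t).bound = List.range' n t.bound.length := by
  induction t using BlockFormula.induction generalizing f n with
  | hlit pos R vs => simp [rename, bound]
  | hblock q X cs ih =>
    have key (f : ℕ → ℕ) (n : ℕ) : ((renameList f n cs).map bound).flatten =
        List.range' n (cs.map bound).flatten.length := by
      induction cs generalizing n with
      | nil => simp [renameList]
      | cons c cs ih' =>
        rw [renameList, List.map_cons, List.flatten_cons, List.map_cons, List.flatten_cons,
          ih' (fun c hc => ih c (List.mem_cons_of_mem _ hc)), ih c List.mem_cons_self,
          List.length_append, List.range'_append_1]
    rw [rename_block, bound, bound, key, List.length_append, List.range'_append_1]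

/-- The invariant that prevents capture: in every scope the new names of the free variables lie
below all names that are still to be given. -/
theorem extendRenaming_lt {f : ℕ → ℕ} {n : ℕ} {q : Bool} {X : List ℕ} {cs : List BlockFormula}
    (h : ∀ y ∈ (block q X cs).free, f y < n) {m : ℕ} (hm : n + X.length ≤ m) :
    ∀ c ∈ cs, ∀ y ∈ c.free, extendRenaming f n X y < m := by
  intro c hc y hy
  unfold extendRenaming
  split_ifs with hX
  · have := List.idxOf_lt_length_of_mem hX
    omega
  · have := h y (mem_free_block.2 ⟨⟨c, hc, hy⟩, hX⟩)
    omega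

theorem free_rename (t : BlockFormula) (f : ℕ → ℕ) (n : ℕ) (h : ∀ y ∈ t.free, f y < n) :
    (rename f n t).free = t.free.image f := by
  induction t using BlockFormula.induction generalizing f n with
  | hlit pos R vs => ext; simp [rename, free]
  | hblock q X cs ih =>
    ext z
    rw [rename_block, mem_free_block, Finset.mem_image]
    constructor
    · rintro ⟨⟨d, hd, hz⟩, hzX⟩
      obtain ⟨c, hc, m, hm, rfl⟩ := exists_of_mem_renameList hd
      rw [ih c hc _ _ (extendRenaming_lt h hm c hc), Finset.mem_image] at hz
      obtain ⟨y, hy, rfl⟩ := hz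
      by_cases hyX : y ∈ X
      · have := List.idxOf_lt_length_of_mem hyX
        exact absurd (by simp [extendRenaming, hyX, this]) hzX
      · exact ⟨y, mem_free_block.2 ⟨⟨c, hc, hy⟩, hyX⟩, by simp [extendRenaming, hyX]⟩
    · rintro ⟨y, hy, rfl⟩
      have hlt := h y hy
      obtain ⟨⟨c, hc, hyc⟩, hyX⟩ := mem_free_block.1 hy
      obtain ⟨m, hm, hd⟩ := exists_mem_renameList (extendRenaming f n X) (n + X.length) hc
      refine ⟨⟨_, hd, ?_⟩, by simp; omega⟩
      rw [ih c hc _ _ (extendRenaming_lt h hm c hc)]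
      exact Finset.mem_image.2 ⟨y, hyc, by simp [extendRenaming, hyX]⟩

theorem Proper.rename {t : BlockFormula} (ht : t.Proper) (f : ℕ → ℕ) (n : ℕ) :
    (rename f n t).Proper := by
  induction ht generalizing f n with
  | lit => rw [BlockFormula.rename]; exact .lit _ _ _
  | block q X cs hcs _ ih =>
    rw [rename_block]
    refine .block _ _ _ (renameList_ne_nil hcs) fun d hd => ?_
    obtain ⟨c, hc, m, -, rfl⟩ := exists_of_mem_renameList hd
    exact ih c hc _ _

theorem symbols_rename {t : BlockFormula} (ht : t.Proper) (f : ℕ → ℕ) (n : ℕ) :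
    (rename f n t).toFormula.symbols = t.toFormula.symbols := by
  induction ht generalizing f n with
  | lit pos => rw [BlockFormula.rename]; cases pos <;> simp [toFormula, symbols]
  | block q X cs hcs _ ih =>
    ext r
    rw [rename_block, mem_symbols_block (renameList_ne_nil hcs), mem_symbols_block hcs]
    constructor
    · rintro ⟨d, hd, hr⟩
      obtain ⟨c, hc, m, -, rfl⟩ := exists_of_mem_renameList hd
      rw [ih c hc] at hr
      exact ⟨c, hc, hr⟩
    · rintro ⟨c, hc, hr⟩
      obtain ⟨m, -, hd⟩ := exists_mem_renameList (extendRenaming f n X) (n + X.length) hc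
      exact ⟨_, hd, by rwa [ih c hc]⟩

theorem realize_rename {t : BlockFormula} (ht : t.Proper) (f : ℕ → ℕ) (n : ℕ)
    (h : ∀ y ∈ t.free, f y < n) (s : ℕ → A) :
    Realize I s (rename f n t).toFormula ↔ Realize I (s ∘ f) t.toFormula := by
  suffices ∀ q, Holds I q s (rename f n t).toFormula ↔ Holds I q (s ∘ f) t.toFormula by
    simpa using this true
  induction ht generalizing f n s with
  | lit pos R vs =>
    intro q
    rw [BlockFormula.rename, Holds, Holds]
    cases pos <;> simp [toFormula, Realize]
  | block q X cs hcs _ ih =>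
    -- A `q`-block is understood at truth value `q`; the other value follows by negation.
    suffices hq : Holds I q s (rename f n (.block q X cs)).toFormula ↔
        Holds I q (s ∘ f) (BlockFormula.block q X cs).toFormula by
      intro q'
      rcases Bool.eq_or_eq_not q' q with rfl | rfl
      · exact hq
      · rw [holds_not_iff, holds_not_iff, hq]
    rw [rename_block, holds_block (renameList_ne_nil hcs), holds_block hcs]
    have hchild (c) (hc : c ∈ cs) (m) (hm : n + X.length ≤ m) (r : ℕ → A) :=
      ih c hc _ _ (extendRenaming_lt h hm c hc) r q
    constructor
    · rintro ⟨r, hr, hd⟩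
      refine ⟨fun x => if x ∈ X then r (extendRenaming f n X x) else s (f x),
        fun x hx => by simp [hx], fun c hc => ?_⟩
      obtain ⟨m, hm, hmem⟩ := exists_mem_renameList (extendRenaming f n X) (n + X.length) hc
      refine (holds_congr fun y hy => ?_).1 ((hchild c hc m hm r).1 (hd _ hmem))
      rw [free_toFormula] at hy
      by_cases hyX : y ∈ X
      · simp [hyX]
      · have := h y (mem_free_block.2 ⟨⟨c, hc, hy⟩, hyX⟩)
        simp only [Function.comp, extendRenaming, hyX, if_false]
        exact hr _ (by simp; omega)
    · rintro ⟨r, hr, hc⟩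
      -- The name `n + i` receives the value of `X[i]`, and every other name keeps its value.
      refine ⟨fun z => if hz : n ≤ z ∧ z - n < X.length then r X[z - n] else s z,
        fun z hz => ?_, fun d hd => ?_⟩
      · simp only [List.mem_range'_1] at hz
        exact dif_neg (by omega)
      · obtain ⟨c, hcc, m, hm, rfl⟩ := exists_of_mem_renameList hd
        refine (hchild c hcc m hm _).2 ((holds_congr fun y hy => ?_).1 (hc c hcc))
        rw [free_toFormula] at hy
        by_cases hyX : y ∈ X
        · have := List.idxOf_lt_length_of_mem hyX
          simp [extendRenaming, hyX, this]
        · have := h y (mem_free_block.2 ⟨⟨c, hcc, hy⟩, hyX⟩)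
          simp only [Function.comp, extendRenaming, hyX, if_false]
          rw [dif_neg (by omega)]
          exact hr y hyX

end BlockFormula

theorem Organized.rename {t : BlockFormula} (ht : Organized t) (f : ℕ → ℕ) (n : ℕ)
    (h : ∀ y ∈ t.free, f y < n) : Organized (rename f n t) := by
  induction ht generalizing f n with
  | lit => rw [BlockFormula.rename]; exact .lit _ _ _
  | block q x cs hcs _ hx ih =>
    rw [rename_block]
    refine .block q n _ (renameList_ne_nil hcs) (fun d hd => ?_) (fun d hd => ?_)
    · obtain ⟨c, hc, m, hm, rfl⟩ := exists_of_mem_renameList hd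
      exact ih c hc _ _ (extendRenaming_lt h hm c hc)
    · obtain ⟨c, hc, m, hm, rfl⟩ := exists_of_mem_renameList hd
      rw [free_rename c _ _ (extendRenaming_lt h hm c hc)]
      exact Finset.mem_image.2 ⟨x, hx c hc, by simp [extendRenaming]⟩

/-! ### Merging adjacent blocks -/

namespace BlockFormula

open Formula

variable {A : Type u} {I : ℕ → List A → Prop}

theorem merge_block (q : Bool) (X : List ℕ) (cs : List BlockFormula) :
    merge (block q X cs) = block q (X ++ (cs.map merge).flatMap (topVars q))
      ((cs.map merge).flatMap (topParts q)) := by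
  rw [merge]

/-- Any formula can be read as a `q`-block that quantifies `topVars q t` over `topParts q t`, with
an empty prefix and a single part if its top is not a `q`-block. This lemma, `mem_free_iff_top`,
`holds_iff_top` and `mem_symbols_iff_top` justify this reading, which spares case distinctions about
`merge`. -/
theorem bound_eq_top (q : Bool) (t : BlockFormula) :
    t.bound = topVars q t ++ (topParts q t).flatMap bound := by
  cases t with
  | lit => simp [bound, topVars, topParts]
  | block q' X cs =>
    by_cases h : q' = q
    · simp [bound, topVars, topParts, h, List.flatMap_def]
    · simp [topVars, topParts, h]

theorem mem_free_iff_top {q : Bool} {t : BlockFormula} {y : ℕ} :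
    y ∈ t.free ↔ (∃ p ∈ topParts q t, y ∈ p.free) ∧ y ∉ topVars q t := by
  cases t with
  | lit => simp [topVars, topParts]
  | block q' X cs =>
    by_cases h : q' = q
    · simp [topVars, topParts, h, mem_free_block]
    · simp [topVars, topParts, h]

theorem Proper.topParts_ne_nil {t : BlockFormula} (ht : t.Proper) (q : Bool) :
    topParts q t ≠ [] := by
  cases ht with
  | lit => simp [topParts]
  | block q' X cs h =>
    by_cases e : q' = q
    · simpa [topParts, e] using h
    · simp [topParts, e]

theorem Proper.topParts {t : BlockFormula} (ht : t.Proper) (q : Bool) :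
    ∀ p ∈ topParts q t, p.Proper := by
  cases ht with
  | lit => simpa [BlockFormula.topParts] using Proper.lit _ _ _
  | block q' X cs h hc =>
    by_cases e : q' = q
    · simpa [BlockFormula.topParts, e] using hc
    · simpa [BlockFormula.topParts, e] using Proper.block q' X cs h hc

theorem holds_iff_top {t : BlockFormula} (ht : t.Proper) (q : Bool) (s : ℕ → A) :
    Holds I q s t.toFormula ↔ ∃ r : ℕ → A, (∀ x ∉ topVars q t, r x = s x) ∧
      ∀ p ∈ topParts q t, Holds I q r p.toFormula := by
  have triv (t : BlockFormula) : Holds I q s t.toFormula ↔ ∃ r : ℕ → A,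
      (∀ x ∉ ([] : List ℕ), r x = s x) ∧ ∀ p ∈ [t], Holds I q r p.toFormula := by
    constructor
    · exact fun h => ⟨s, by simp, by simpa using h⟩
    · rintro ⟨r, hr, h⟩
      rw [show r = s from funext fun x => hr x List.not_mem_nil] at h
      simpa using h
  cases ht with
  | lit pos R vs =>
    rw [topVars, BlockFormula.topParts]
    exact triv _
  | block q' X cs hcs =>
    by_cases e : q' = q
    · subst e
      simpa [topVars, BlockFormula.topParts] using holds_block hcs s
    · simp only [topVars, BlockFormula.topParts, if_neg e]
      exact triv _

theorem mem_symbols_iff_top {t : BlockFormula} (ht : t.Proper) (q : Bool) {r : ℕ × ℕ} :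
    r ∈ t.toFormula.symbols ↔ ∃ p ∈ topParts q t, r ∈ p.toFormula.symbols := by
  cases ht with
  | lit => simp [BlockFormula.topParts]
  | block q' X cs hcs =>
    by_cases e : q' = q
    · simp [BlockFormula.topParts, e, mem_symbols_block hcs]
    · simp [BlockFormula.topParts, e]

theorem Proper.merge {t : BlockFormula} (ht : t.Proper) : t.merge.Proper := by
  induction ht with
  | lit => rw [BlockFormula.merge]; exact .lit _ _ _
  | block q X cs hcs _ ih =>
    rw [merge_block]
    refine .block _ _ _ ?_ ?_
    · obtain ⟨c, l, rfl⟩ := List.exists_cons_of_ne_nil hcs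
      simp [(ih c List.mem_cons_self).topParts_ne_nil q]
    · intro p hp
      simp only [List.mem_flatMap, List.mem_map, exists_exists_and_eq_and] at hp
      obtain ⟨c, hc, hp⟩ := hp
      exact (ih c hc).topParts q p hp

theorem merge_parts_ne_nil {q : Bool} {X : List ℕ} {cs : List BlockFormula}
    (ht : (block q X cs).Proper) : (cs.map BlockFormula.merge).flatMap (topParts q) ≠ [] := by
  have := ht.merge
  rw [merge_block] at this
  cases this
  assumption

theorem symbols_merge {t : BlockFormula} (ht : t.Proper) :
    t.merge.toFormula.symbols = t.toFormula.symbols := by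
  induction ht with
  | lit => rw [BlockFormula.merge]
  | block q X cs hcs hp ih =>
    ext r
    rw [merge_block, mem_symbols_block (merge_parts_ne_nil (.block q X cs hcs hp)),
      mem_symbols_block hcs]
    simp only [List.mem_flatMap, List.mem_map, exists_exists_and_eq_and]
    constructor
    · rintro ⟨p, ⟨c, hc, hpc⟩, hr⟩
      exact ⟨c, hc, by rw [← ih c hc, mem_symbols_iff_top (hp c hc).merge q]; exact ⟨p, hpc, hr⟩⟩
    · rintro ⟨c, hc, hr⟩
      rw [← ih c hc, mem_symbols_iff_top (hp c hc).merge q] at hr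
      obtain ⟨p, hpc, hr⟩ := hr
      exact ⟨p, ⟨c, hc, hpc⟩, hr⟩

/-- Merging moves quantified variables but neither creates nor loses any, which is why
variable-looseness survives. -/
theorem bound_merge_perm (t : BlockFormula) : t.merge.bound.Perm t.bound := by
  induction t using BlockFormula.induction with
  | hlit => rw [merge]
  | hblock q X cs ih =>
    rw [merge_block, bound, bound, List.append_assoc, ← List.flatMap_def, List.flatMap_assoc]
    refine List.Perm.append_left X ((List.flatMap_append_perm _ _ _).trans ?_)
    have e : ((cs.map merge).flatMap fun d => topVars q d ++ (topParts q d).flatMap bound) =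
        (cs.map merge).flatMap bound := by simp only [← bound_eq_top]
    rw [e, List.flatMap_map, ← List.flatMap_def]
    exact List.Perm.flatMap_left cs fun c hc => ih c hc

/-- A variable that is both quantified and free in a part would be free in the block, unless it lies
in `X`; but then it is quantified twice. -/
theorem VariableLoose.child {q : Bool} {X : List ℕ} {cs : List BlockFormula}
    (h : (block q X cs).VariableLoose) {c : BlockFormula} (hc : c ∈ cs) : c.VariableLoose := by
  obtain ⟨hn, hf⟩ := h
  rw [bound] at hn hf
  have hsub : ∀ x ∈ c.bound, x ∈ (cs.map fun c => c.bound).flatten := fun x hx =>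
    List.mem_flatten.2 ⟨_, List.mem_map.2 ⟨c, hc, rfl⟩, hx⟩
  refine ⟨(List.nodup_flatten.1 (List.nodup_append.1 hn).2.1).1 _ (List.mem_map.2 ⟨c, hc, rfl⟩),
    fun x hx hxf => hf x (List.mem_append_right _ (hsub x hx)) (mem_free_block.2
      ⟨⟨c, hc, hxf⟩, fun hX => ?_⟩)⟩
  exact (List.nodup_append.1 hn).2.2 x hX x (hsub x hx) rfl

/-- The variables quantified on top of merged parts of a variable-loose formula are distinct, and
they are distinct from the free variables of the parts. -/
theorem VariableLoose.top {q : Bool} {X : List ℕ} {cs : List BlockFormula}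
    (h : (block q X cs).VariableLoose) :
    (X ++ (cs.map BlockFormula.merge).flatMap (topVars q)).Nodup ∧
      ∀ c ∈ cs, ∀ c' ∈ cs, ∀ y ∈ c.free, y ∉ topVars q c'.merge := by
  have hp := bound_merge_perm (block q X cs)
  rw [merge_block, bound] at hp
  have hn := hp.nodup_iff.2 h.1
  refine ⟨(List.nodup_append.1 hn).1, fun c hc c' hc' y hy hyc' => ?_⟩
  have hyA : y ∈ (cs.map BlockFormula.merge).flatMap (topVars q) :=
    List.mem_flatMap.2 ⟨_, List.mem_map.2 ⟨c', hc', rfl⟩, hyc'⟩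
  have hyb : y ∈ (block q X cs).bound :=
    hp.mem_iff.1 (List.mem_append_left _ (List.mem_append_right _ hyA))
  -- Otherwise `y` would be both free and quantified in the block. Being in `X` and also on top of a
  -- merged part contradicts distinctness.
  have hyX : y ∈ X := by
    by_contra hX
    exact h.2 y hyb (mem_free_block.2 ⟨⟨c, hc, hy⟩, hX⟩)
  exact (List.nodup_append.1 (List.nodup_append.1 hn).1).2.2 y hyX y hyA rfl

/-- A variable pulled out of one part could capture a free variable of another part;
`VariableLoose.top` excludes this. -/
theorem free_merge (t : BlockFormula) (ht : t.VariableLoose) : t.merge.free = t.free := by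
  induction t using BlockFormula.induction with
  | hlit => rw [merge]
  | hblock q X cs ih =>
    have ih' (c) (hc : c ∈ cs) := ih c hc (ht.child hc)
    ext y
    rw [merge_block, mem_free_block, mem_free_block]
    simp only [List.mem_flatMap, List.mem_map, exists_exists_and_eq_and, List.mem_append, not_or]
    constructor
    · rintro ⟨⟨p, ⟨c, hc, hp⟩, hy⟩, hyX, hyA⟩
      push Not at hyA
      exact ⟨⟨c, hc, by rw [← ih' c hc]; exact mem_free_iff_top.2 ⟨⟨p, hp, hy⟩, hyA c hc⟩⟩, hyX⟩
    · rintro ⟨⟨c, hc, hy⟩, hyX⟩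
      have hy' := hy
      rw [← ih' c hc] at hy'
      obtain ⟨⟨p, hp, hyp⟩, -⟩ := (mem_free_iff_top (q := q)).1 hy'
      refine ⟨⟨p, ⟨c, hc, hp⟩, hyp⟩, hyX, ?_⟩
      rintro ⟨c', hc', hyc'⟩
      exact ht.top.2 c hc c' hc' y hy hyc'

theorem VariableLoose.merge {t : BlockFormula} (ht : t.VariableLoose) : t.merge.VariableLoose := by
  refine ⟨(bound_merge_perm t).nodup_iff.2 ht.1, fun x hx => ?_⟩
  rw [free_merge t ht]
  exact ht.2 x ((bound_merge_perm t).mem_iff.1 hx)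

theorem realize_merge {t : BlockFormula} (hp : t.Proper) (ht : t.VariableLoose) (s : ℕ → A) :
    Realize I s t.merge.toFormula ↔ Realize I s t.toFormula := by
  induction hp generalizing s with
  | lit => rw [BlockFormula.merge]
  | block q X cs hcs hproper ih =>
    have ih' (c) (hc : c ∈ cs) (s : ℕ → A) :
        Holds I q s c.merge.toFormula ↔ Holds I q s c.toFormula := by
      rw [Holds, Holds, ih c hc (ht.child hc)]
    suffices Holds I q s (BlockFormula.block q X cs).merge.toFormula ↔
        Holds I q s (BlockFormula.block q X cs).toFormula by
      cases q
      · simpa [not_iff_not] using this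
      · simpa using this
    obtain ⟨hnodup, hfree⟩ := ht.top
    rw [merge_block, holds_block (merge_parts_ne_nil (.block q X cs hcs hproper)),
      holds_block hcs]
    simp only [List.mem_append, not_or]
    have hA (y : ℕ) : y ∈ (cs.map BlockFormula.merge).flatMap (topVars q) ↔
        ∃ c ∈ cs, y ∈ topVars q c.merge := by simp
    constructor
    · rintro ⟨r, hr, hparts⟩
      -- The outer quantifiers take the values of `r` on `X` only; the variables pulled out of a
      -- part get theirs inside that part.
      refine ⟨fun y => if y ∈ X then r y else s y, fun y hy => by simp [hy], fun c hc => ?_⟩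
      rw [← ih' c hc, holds_iff_top (hproper c hc).merge]
      refine ⟨fun y => if y ∈ topVars q c.merge then r y else if y ∈ X then r y else s y,
        fun y hy => by simp [hy], fun p hpc => ?_⟩
      refine (holds_congr fun y hy => ?_).1
        (hparts p (List.mem_flatMap.2 ⟨_, List.mem_map.2 ⟨c, hc, rfl⟩, hpc⟩))
      rw [free_toFormula] at hy
      by_cases h₁ : y ∈ topVars q c.merge
      · simp [h₁]
      by_cases h₂ : y ∈ X
      · simp [h₂]
      have hyc : y ∈ c.free := by
        rw [← free_merge c (ht.child hc)]
        exact mem_free_iff_top.2 ⟨⟨p, hpc, hy⟩, h₁⟩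
      simp only [h₁, h₂, if_false]
      refine hr y ⟨h₂, ?_⟩
      rw [hA]
      rintro ⟨c', hc', h⟩
      exact hfree c hc c' hc' y hyc h
    · rintro ⟨r, hr, hparts⟩
      have hex (c : BlockFormula) (hc : c ∈ cs) :
          ∃ v : ℕ → A, (∀ x ∉ topVars q c.merge, v x = r x) ∧
            ∀ p ∈ topParts q c.merge, Holds I q v p.toFormula := by
        rw [← holds_iff_top (hproper c hc).merge, ih' c hc]
        exact hparts c hc
      have : Nonempty A := ⟨s 0⟩
      choose! v hv₁ hv₂ using hex
      classical
      -- The separate witnesses `v c` are glued. This is consistent because the top variables of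
      -- different parts are disjoint, and harmless because those of one part are not free in the
      -- others.
      let w : ℕ → A := fun y =>
        if h : ∃ c ∈ cs, y ∈ topVars q c.merge then v h.choose y else r y
      have hw (c : BlockFormula) (hc : c ∈ cs) (y : ℕ) (hy : y ∈ topVars q c.merge) :
          w y = v c y := by
        have h : ∃ c ∈ cs, y ∈ topVars q c.merge := ⟨c, hc, hy⟩
        have hw' : w y = v h.choose y := dif_pos h
        rw [hw']
        congr 1
        by_contra hne
        have hd := (List.nodup_flatMap.1 (List.nodup_append.1 hnodup).2.1).2
        rw [List.pairwise_map] at hd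
        have hsymm : Std.Symm fun a b => Function.onFun List.Disjoint (topVars q) (merge a) (merge b) :=
          ⟨fun a b hab => List.Disjoint.symm hab⟩
        exact (hd.forall h.choose_spec.1 hc hne) h.choose_spec.2 hy
      refine ⟨w, fun y hy => ?_, fun p hp => ?_⟩
      · rw [hA] at hy
        rw [← hr y hy.1]
        exact dif_neg hy.2
      · obtain ⟨d, hd, hpd⟩ := List.mem_flatMap.1 hp
        obtain ⟨c, hc, rfl⟩ := List.mem_map.1 hd
        refine (holds_congr fun y hy => ?_).1 (hv₂ c hc p hpd)
        rw [free_toFormula] at hy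
        by_cases h₁ : y ∈ topVars q c.merge
        · rw [hw c hc y h₁]
        · have hyc : y ∈ c.free := by
            rw [← free_merge c (ht.child hc)]
            exact mem_free_iff_top.2 ⟨⟨p, hpd, hy⟩, h₁⟩
          rw [hv₁ c hc y h₁]
          have h₂ : ¬ ∃ c' ∈ cs, y ∈ topVars q c'.merge := by
            rintro ⟨c', hc', h⟩
            exact hfree c hc c' hc' y hyc h
          exact (dif_neg h₂ : w y = r y).symm

theorem mem_edges {cs : List BlockFormula} {e : Finset ℕ} :
    e ∈ edges cs ↔ ∃ c ∈ cs, c.free = e := by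
  simp [edges]

theorem mem_verts_edges {cs : List BlockFormula} {x : ℕ} :
    x ∈ verts (edges cs) ↔ ∃ c ∈ cs, x ∈ c.free := by
  simp [verts, Finset.mem_sup, mem_edges]

end BlockFormula

-- Connectivity of merged blocks

/-- Chains of sets in `E` replace walks in a graph on a subtype, so that connectivity can be
compared between different edge sets. Repetitions `a = b` in a chain are harmless. -/
theorem sconnected_iff {S : Finset ℕ} {E : Finset (Finset ℕ)} :
    SConnected S E ↔ E.Nonempty ∧ ∀ e ∈ E, ∀ f ∈ E,
      Relation.ReflTransGen (fun a b => b ∈ E ∧ (S ∩ a ∩ b).Nonempty) e f := by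
  rw [SConnected, SimpleGraph.connected_iff, and_comm, Finset.nonempty_coe_sort]
  refine and_congr_right fun _ => ⟨fun h e he f hf => ?_, fun h => ?_⟩
  · have := (SimpleGraph.reachable_iff_reflTransGen _ _).1 (h ⟨e, he⟩ ⟨f, hf⟩)
    refine Relation.ReflTransGen.lift Subtype.val (fun a b hab => ?_) _ _ this
    rcases hab.2 with h | h
    · exact ⟨b.2, h⟩
    · refine ⟨b.2, ?_⟩
      rwa [Finset.inter_assoc, Finset.inter_comm a.1, ← Finset.inter_assoc]
  · rintro ⟨e, he⟩ ⟨f, hf⟩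
    have := h e he f hf
    induction this with
    | refl => exact .refl _
    | @tail b c hab hbc ih =>
      have hb : b ∈ E := by
        cases hab with
        | refl => exact he
        | tail _ h => exact h.1
      refine (ih hb).trans ?_
      by_cases hne : (⟨b, hb⟩ : {e // e ∈ E}) = ⟨c, hf⟩
      · rw [hne]
      · exact SimpleGraph.Adj.reachable ⟨hne, Or.inl hbc.2⟩

theorem BlockFormula.LayeredShape.of_block {q q' : Bool} {X : List ℕ} {cs : List BlockFormula}
    (h : LayeredShape q' (BlockFormula.block q X cs)) : q' = q ∧ (∀ c ∈ cs, LayeredShape (!q) c) ∧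
      X.toFinset ⊆ verts (edges cs) ∧ SConnected X.toFinset (edges cs) := by
  cases h with
  | block _ _ _ _ h₁ h₂ h₃ => exact ⟨rfl, h₁, h₂, h₃⟩

/-- Each merged part `c` contributes a group of edges that is connected through `topVars q c.merge`,
and `x`, being free in `c`, lies in one edge of each group. Hence `x` together with all pulled-out
variables connects everything. Literals are kept apart because they fit below either quantifier,
whereas a block fixes its own. -/
theorem Organized.layeredShape_merge {t : BlockFormula} (ht : Organized t)
    (hl : t.VariableLoose) :
    (∃ pos R vs, t.merge = BlockFormula.lit pos R vs) ∨
      ∃ q X cs, t.merge = BlockFormula.block q X cs ∧ LayeredShape q t.merge := by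
  induction ht with
  | lit pos R vs => exact Or.inl ⟨pos, R, vs, by rw [merge]⟩
  | block q x cs hcs horg hx ih =>
    refine Or.inr ⟨_, _, _, merge_block _ _ _, ?_⟩
    have hproper := (Organized.block q x cs hcs horg hx).proper
    have hloose := hl
    have htop : ∀ c ∈ cs, (∀ p ∈ topParts q c.merge, LayeredShape (!q) p) ∧
        (topVars q c.merge).toFinset ⊆ verts (edges (topParts q c.merge)) ∧
        SConnected (topVars q c.merge).toFinset (edges (topParts q c.merge)) := by
      intro c hc
      -- A part that is not dissolved forms a group with one edge, which needs no linking variables.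
      have single (t : BlockFormula) : SConnected (([] : List ℕ)).toFinset (edges [t]) := by
        rw [sconnected_iff]
        simp [edges, Relation.ReflTransGen.refl]
      rcases ih c hc (hl.child hc) with ⟨pos, R, vs, e⟩ | ⟨q', X, ds, e, h⟩
      · rw [e]
        exact ⟨by simpa [topParts] using LayeredShape.lit _ _ _ _, by simp [topVars],
          by rw [topVars, topParts]; exact single _⟩
      · rw [e] at h ⊢
        by_cases hq : q' = q
        · subst hq
          simpa [topVars, topParts] using h.of_block.2
        · have hq' : q' = !q := by cases q <;> cases q' <;> simp_all
          simp only [topVars, topParts, if_neg hq]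
          exact ⟨by simpa [← hq'] using h, by simp, single _⟩
    rw [merge_block]
    set A := (cs.map merge).flatMap (topVars q) with hA
    set ps := (cs.map merge).flatMap (topParts q) with hps
    have hmemA (y : ℕ) : y ∈ A ↔ ∃ c ∈ cs, y ∈ topVars q c.merge := by simp [hA]
    have hmemps (p : BlockFormula) : p ∈ ps ↔ ∃ c ∈ cs, p ∈ topParts q c.merge := by simp [hps]
    have hxpart (c) (hc : c ∈ cs) : ∃ p ∈ topParts q c.merge, x ∈ p.free := by
      have := hx c hc
      rw [← free_merge c (hl.child hc)] at this
      exact (mem_free_iff_top.1 this).1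
    refine .block q _ _ (merge_parts_ne_nil hproper) ?_ ?_ ?_
    · intro p hp
      obtain ⟨c, hc, hpc⟩ := (hmemps p).1 hp
      exact (htop c hc).1 p hpc
    · intro y hy
      rw [mem_verts_edges]
      simp only [List.mem_toFinset, List.mem_append, List.mem_singleton] at hy
      rcases hy with rfl | hy
      · obtain ⟨c, l, e⟩ := List.exists_cons_of_ne_nil hcs
        have hc : c ∈ cs := by simp [e]
        obtain ⟨p, hp, hyp⟩ := hxpart c hc
        exact ⟨p, (hmemps p).2 ⟨c, hc, hp⟩, hyp⟩
      · obtain ⟨c, hc, hyc⟩ := (hmemA y).1 hy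
        obtain ⟨p, hp, hyp⟩ := mem_verts_edges.1 ((htop c hc).2.1 (List.mem_toFinset.2 hyc))
        exact ⟨p, (hmemps p).2 ⟨c, hc, hp⟩, hyp⟩
    · rw [sconnected_iff]
      have hsub (c) (hc : c ∈ cs) : edges (topParts q c.merge) ⊆ edges ps := by
        intro e he
        obtain ⟨p, hp, rfl⟩ := mem_edges.1 he
        exact mem_edges.2 ⟨p, (hmemps p).2 ⟨c, hc, hp⟩, rfl⟩
      have hgroup (c) (hc : c ∈ cs) (e) (he : e ∈ edges (topParts q c.merge)) (f)
          (hf : f ∈ edges (topParts q c.merge)) : Relation.ReflTransGen (fun a b =>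
            b ∈ edges ps ∧ (([x] ++ A).toFinset ∩ a ∩ b).Nonempty) e f := by
        refine Relation.ReflTransGen.mono (fun a b hab => ⟨hsub c hc hab.1, hab.2.mono ?_⟩)
          _ _ ((sconnected_iff.1 (htop c hc).2.2).2 e he f hf)
        refine Finset.inter_subset_inter_right (Finset.inter_subset_inter_right fun y hy => ?_)
        simp only [List.mem_toFinset, List.mem_append] at hy ⊢
        exact Or.inr ((hmemA y).2 ⟨c, hc, hy⟩)
      constructor
      · obtain ⟨p, l, e⟩ := List.exists_cons_of_ne_nil (merge_parts_ne_nil hproper)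
        exact ⟨p.free, mem_edges.2 ⟨p, by rw [hps, e]; simp, rfl⟩⟩
      · intro e he f hf
        obtain ⟨p, hp, rfl⟩ := mem_edges.1 he
        obtain ⟨p', hp', rfl⟩ := mem_edges.1 hf
        obtain ⟨c, hc, hpc⟩ := (hmemps p).1 hp
        obtain ⟨c', hc', hpc'⟩ := (hmemps p').1 hp'
        obtain ⟨r, hr, hxr⟩ := hxpart c hc
        obtain ⟨r', hr', hxr'⟩ := hxpart c' hc'
        have h₁ := hgroup c hc _ (mem_edges.2 ⟨p, hpc, rfl⟩) _ (mem_edges.2 ⟨r, hr, rfl⟩)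
        have h₂ := hgroup c' hc' _ (mem_edges.2 ⟨r', hr', rfl⟩) _ (mem_edges.2 ⟨p', hpc', rfl⟩)
        -- Go within the first group to an edge containing `x`, cross over to such an edge of the
        -- second group, and continue there.
        refine (h₁.tail ⟨mem_edges.2 ⟨r', (hmemps r').2 ⟨c', hc', hr'⟩, rfl⟩, x, ?_⟩).trans h₂
        simp [hxr, hxr']

/-! ### The layered formulas computed from organized formulas -/

section Layer

open Formula

variable {t : BlockFormula}

theorem lt_of_mem_free {y : ℕ} (hy : y ∈ t.free) : id y < t.free.sup id + 1 :=
  Nat.lt_succ_of_le (Finset.le_sup (f := id) hy)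

/-- The new names are consecutive numbers above all free variables. -/
theorem variableLoose_rename (t : BlockFormula) :
    (rename id (t.free.sup id + 1) t).VariableLoose := by
  refine ⟨?_, fun x hx hxf => ?_⟩
  · rw [bound_rename]
    exact List.nodup_range'
  · rw [free_rename t id _ fun y hy => lt_of_mem_free hy, Finset.image_id] at hxf
    have := lt_of_mem_free hxf
    rw [bound_rename, List.mem_range'_1] at hx
    simp only [id] at this
    omega

theorem Organized.isLayered_layer (ht : Organized t) : t.layer.IsLayered := by
  refine ⟨(variableLoose_rename t).merge, ?_⟩
  rcases (ht.rename id _ fun y hy => lt_of_mem_free hy).layeredShape_merge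
    (variableLoose_rename t) with ⟨pos, R, vs, e⟩ | ⟨q, X, cs, -, h⟩
  · exact ⟨true, by rw [layer, e]; exact .lit _ _ _ _⟩
  · exact ⟨q, h⟩

theorem free_layer (t : BlockFormula) : t.layer.free = t.free := by
  rw [layer, free_merge _ (variableLoose_rename t),
    free_rename t id _ fun y hy => lt_of_mem_free hy, Finset.image_id]

theorem Organized.symbols_layer (ht : Organized t) :
    t.layer.toFormula.symbols = t.toFormula.symbols := by
  rw [layer, symbols_merge (ht.proper.rename _ _), symbols_rename ht.proper]

theorem Organized.realize_layer {A : Type u} {I : ℕ → List A → Prop} (ht : Organized t)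
    (s : ℕ → A) : Realize I s t.layer.toFormula ↔ Realize I s t.toFormula := by
  rw [layer, realize_merge (ht.proper.rename _ _) (variableLoose_rename t),
    realize_rename ht.proper _ _ fun y hy => lt_of_mem_free hy]
  rfl

end Layer

/-! ### Combinations of layered formulas -/

namespace PosComb

/-- The conjunction (`q = true`) or disjunction (`q = false`) of a list. -/
def bigOp (q : Bool) (l : List PosComb) : PosComb := if q then conj l else disj l

theorem toFormula_bigOp (q : Bool) {l : List PosComb} (hl : l ≠ []) :
    (bigOp q l).toFormula = Formula.bigOp q (l.map toFormula) := by
  have h₁ (l : List PosComb) (p : PosComb) :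
      (l.foldl and p).toFormula = (l.map toFormula).foldl Formula.and p.toFormula := by
    induction l generalizing p with
    | nil => rfl
    | cons r l ih => simp [ih, toFormula]
  have h₂ (l : List PosComb) (p : PosComb) :
      (l.foldl or p).toFormula = (l.map toFormula).foldl Formula.or p.toFormula := by
    induction l generalizing p with
    | nil => rfl
    | cons r l ih => simp [ih, toFormula]
  obtain ⟨p, l, rfl⟩ := List.exists_cons_of_ne_nil hl
  cases q <;> simp [bigOp, conj, disj, Formula.bigOp, Formula.conj, Formula.disj, h₁, h₂]

theorem mem_parts_bigOp {q : Bool} {l : List PosComb} (hl : l ≠ []) {t : BlockFormula} :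
    t ∈ (bigOp q l).parts ↔ ∃ p ∈ l, t ∈ p.parts := by
  have h₁ (l : List PosComb) (p : PosComb) :
      t ∈ (l.foldl and p).parts ↔ t ∈ p.parts ∨ ∃ r ∈ l, t ∈ r.parts := by
    induction l generalizing p with
    | nil => simp
    | cons r l ih => simp [ih, parts, or_assoc]
  have h₂ (l : List PosComb) (p : PosComb) :
      t ∈ (l.foldl or p).parts ↔ t ∈ p.parts ∨ ∃ r ∈ l, t ∈ r.parts := by
    induction l generalizing p with
    | nil => simp
    | cons r l ih => simp [ih, parts, or_assoc]
  obtain ⟨p, l, rfl⟩ := List.exists_cons_of_ne_nil hl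
  cases q <;> simp [bigOp, conj, disj, h₁, h₂]

theorem mem_free_toFormula {p : PosComb} {x : ℕ} :
    x ∈ p.toFormula.free ↔ ∃ t ∈ p.parts, x ∈ t.free := by
  induction p with
  | base t => simp [toFormula, parts, free_toFormula]
  | and p q ih₁ ih₂ => simp [toFormula, Formula.free, parts, ih₁, ih₂, or_and_right, exists_or]
  | or p q ih₁ ih₂ => simp [toFormula, Formula.free, parts, ih₁, ih₂, or_and_right, exists_or]

theorem mem_symbols_toFormula {p : PosComb} {r : ℕ × ℕ} :
    r ∈ p.toFormula.symbols ↔ ∃ t ∈ p.parts, r ∈ t.toFormula.symbols := by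
  induction p with
  | base t => simp [toFormula, parts]
  | and p q ih₁ ih₂ => simp [toFormula, Formula.symbols, parts, ih₁, ih₂, or_and_right, exists_or]
  | or p q ih₁ ih₂ => simp [toFormula, Formula.symbols, parts, ih₁, ih₂, or_and_right, exists_or]

end PosComb

section Lay

open Formula

theorem isNormalForm_org (φ : Formula) : IsNormalForm.{u} false true φ (org φ) :=
  (isNormalForm_normalForms φ true).1

theorem lay_eq (φ : Formula) : lay φ = PosComb.bigOp true
    ((org φ).map fun D => PosComb.bigOp false (D.map fun t => .base t.layer)) := rfl

theorem exists_of_mem_parts_lay {φ : Formula} {t : BlockFormula} (h : t ∈ (lay φ).parts) :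
    ∃ D ∈ org φ, ∃ r ∈ D, r.layer = t := by
  have hC := isNormalForm_org.{0} φ
  rw [lay_eq, PosComb.mem_parts_bigOp (by simpa using hC.ne_nil)] at h
  obtain ⟨p, hp, ht⟩ := h
  obtain ⟨D, hD, rfl⟩ := List.mem_map.1 hp
  rw [PosComb.mem_parts_bigOp (by simpa using hC.clause_ne_nil D hD)] at ht
  obtain ⟨p, hp, ht⟩ := ht
  obtain ⟨r, hr, rfl⟩ := List.mem_map.1 hp
  exact ⟨D, hD, r, hr, by simpa [PosComb.parts, eq_comm] using ht⟩

theorem isLayered_of_mem_parts_lay {φ : Formula} {t : BlockFormula} (h : t ∈ (lay φ).parts) :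
    t.IsLayered := by
  obtain ⟨D, hD, r, hr, rfl⟩ := exists_of_mem_parts_lay h
  exact ((isNormalForm_org.{0} φ).organized D hD r hr).isLayered_layer

theorem free_lay_subset (φ : Formula) : (lay φ).toFormula.free ⊆ φ.free := by
  intro x hx
  obtain ⟨t, ht, hx⟩ := PosComb.mem_free_toFormula.1 hx
  obtain ⟨D, hD, r, hr, rfl⟩ := exists_of_mem_parts_lay ht
  rw [free_layer] at hx
  exact (isNormalForm_org.{0} φ).free D hD r hr hx

theorem symbols_lay_subset (φ : Formula) : (lay φ).toFormula.symbols ⊆ φ.symbols := by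
  intro x hx
  obtain ⟨t, ht, hx⟩ := PosComb.mem_symbols_toFormula.1 hx
  obtain ⟨D, hD, r, hr, rfl⟩ := exists_of_mem_parts_lay ht
  rw [((isNormalForm_org.{0} φ).organized D hD r hr).symbols_layer] at hx
  exact (isNormalForm_org.{0} φ).symbols D hD r hr hx

theorem equivalent_lay (φ : Formula) : Equivalent.{u} (lay φ).toFormula φ := by
  have hC := isNormalForm_org.{u} φ
  intro A I s
  have h : Realize I s φ ↔ ∀ D ∈ org φ, ∃ t ∈ D, Realize I s t.toFormula := by
    have := hC.holds A I s
    -- The invariant of a CNF describes falsity.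
    rw [← not_iff_not]
    simpa using this.symm
  rw [h, lay_eq, PosComb.toFormula_bigOp _ (by simpa using hC.ne_nil), ← holds_true,
    holds_bigOp (by simpa using hC.ne_nil)]
  simp only [List.map_map, List.mem_map, Function.comp, forall_exists_index, and_imp,
    forall_apply_eq_imp_iff₂]
  refine forall₂_congr fun D hD => ?_
  have hD' := hC.clause_ne_nil D hD
  rw [PosComb.toFormula_bigOp _ (by simpa using hD'), holds_true, ← not_iff_not, ← holds_false,
    holds_bigOp (by simpa using hD')]
  simp only [List.map_map, List.mem_map, Function.comp, forall_exists_index, and_imp,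
    forall_apply_eq_imp_iff₂, PosComb.toFormula, holds_false, not_exists, not_and]
  exact forall₂_congr fun t ht => not_congr ((hC.organized D hD t ht).realize_layer s)

end Lay

/-! ### The layering algorithm is primitive recursive -/

-- Primitive recursive list operations

section Lists

open Primrec

variable {α β σ : Type*} [Primcodable α] [Primcodable β] [Primcodable σ]

theorem primrecRel_mem {α : Type*} [Primcodable α] : PrimrecRel fun (x : α) (l : List α) => x ∈ l :=
  ((Primrec.eq (α := α)).exists_mem_list.comp snd fst).of_eq fun p => by simp

theorem primrec_filter {f : α → List β} {p : α → β → Prop} [∀ a, DecidablePred (p a)]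
    (hf : Primrec f) (hp : PrimrecRel p) : Primrec fun a => (f a).filter fun b => p a b := by
  have h : Primrec fun a => (f a).flatMap fun b => if p a b then [b] else [] :=
    list_flatMap hf (ite (hp.comp fst snd) (list_cons.comp snd (const [])) (const []))
  refine h.of_eq fun a => ?_
  induction f a with
  | nil => rfl
  | cons b l ih =>
    rw [List.flatMap_cons, ih, List.filter_cons]
    by_cases h : p a b <;> simp [h]

theorem primrec_sections : Primrec (List.sections : List (List α) → List (List α)) := by
  have hmap : Primrec₂ fun (y : List (List α) × (List α × List (List α))) (s : List α) =>
      y.2.1.map fun a => a :: s :=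
    list_map (fst.comp (snd.comp fst)) (list_cons.comp snd (snd.comp fst))
  have hstep : Primrec₂ fun (_ : List (List α)) (z : List α × List (List α)) =>
      z.2.flatMap fun s => z.1.map fun a => a :: s :=
    list_flatMap (snd.comp snd) hmap
  have h : Primrec fun L : List (List α) =>
      L.foldr (fun l S => S.flatMap fun s => l.map fun a => a :: s) [[]] :=
    list_foldr .id (const [[]]) hstep
  refine h.of_eq fun L => ?_
  induction L with
  | nil => rfl
  | cons l L ih => rw [List.foldr_cons, ih]; rfl

theorem primrec_range' : Primrec₂ (List.range' · · 1) :=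
  (list_map (f := fun y : ℕ × ℕ => List.range y.2) (g := fun y i => y.1 + i)
    (list_range.comp snd) (nat_add.comp (fst.comp fst) snd)).of_eq fun y => by
      simp [List.range'_eq_map_range]

/-- Iterated application of a binary operation to a list, with a default value for `[]`. -/
theorem primrec_foldlOne {op : α → α → α} (hop : Primrec₂ op) (d : α) :
    Primrec fun l : List α => (List.casesOn l d fun a l => l.foldl op a : α) :=
  list_casesOn .id (const d) (list_foldl (snd.comp snd) (fst.comp snd)
    (hop.comp (fst.comp snd) (snd.comp snd)).to₂).to₂

end Lists

namespace Formula

open Primrec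

theorem primrec_conj : Primrec conj :=
  (primrec_foldlOne primrec_and (atom 0 [])).of_eq fun l => by cases l <;> rfl

theorem primrec_disj : Primrec disj :=
  (primrec_foldlOne primrec_or (atom 0 [])).of_eq fun l => by cases l <;> rfl

end Formula

namespace PosComb

open Primrec

theorem primrec_conj : Primrec conj :=
  (primrec_foldlOne primrec_and (base (lit true 0 []))).of_eq fun l => by cases l <;> rfl

theorem primrec_disj : Primrec disj :=
  (primrec_foldlOne primrec_or (base (lit true 0 []))).of_eq fun l => by cases l <;> rfl

end PosComb

-- Renaming and merging are primitive recursive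

namespace BlockFormula

open Primrec

/-- A list of the free variables. -/
def freeList : BlockFormula → List ℕ
  | lit _ _ vs => vs
  | block _ X cs => (cs.map fun c => c.freeList).flatten.filter fun x => x ∉ X

theorem mem_freeList {t : BlockFormula} {x : ℕ} : x ∈ t.freeList ↔ x ∈ t.free := by
  induction t using BlockFormula.induction with
  | hlit => simp [freeList, free]
  | hblock q X cs ih =>
    rw [mem_free_block, freeList]
    simp only [List.mem_filter, List.mem_flatten, List.mem_map, exists_exists_and_eq_and,
      decide_eq_true_eq]
    exact and_congr_left fun _ => exists_congr fun c => and_congr_right fun hc => ih c hc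

theorem primrec_freeList : Primrec freeList :=
  primrec_rec (g := fun y => y.2.2) (h := fun y rs => rs.flatten.filter fun x => x ∉ y.2.1)
    (snd.comp snd)
    (primrec_filter (list_flatten.comp snd)
      (primrecRel_mem.comp snd (fst.comp (snd.comp (fst.comp fst)))).not)
    (fun p R vs => by rw [freeList]) (fun q X cs => by rw [freeList])

theorem primrec_bound : Primrec bound :=
  primrec_rec (g := fun _ => []) (h := fun y rs => y.2.1 ++ rs.flatten) (const _)
    (list_append.comp (fst.comp (snd.comp fst)) (list_flatten.comp snd))
    (fun p R vs => by rw [bound]) (fun q X cs => by rw [bound])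

theorem primrecRel_mem_free : PrimrecRel fun (x : ℕ) (t : BlockFormula) => x ∈ t.free :=
  (primrecRel_mem.comp fst (primrec_freeList.comp snd)).of_eq fun _ => mem_freeList

theorem primrec_succ_sup_free : Primrec fun t : BlockFormula => t.free.sup id + 1 := by
  have h : Primrec fun t : BlockFormula => t.freeList.foldr max 0 :=
    list_foldr primrec_freeList (const 0)
      (nat_max.comp (fst.comp snd) (snd.comp snd)).to₂
  refine (succ.comp h).of_eq fun t => ?_
  have e : t.free = t.freeList.toFinset := by ext; simp [mem_freeList]
  rw [e, ← List.foldr_sup_eq_sup_toFinset]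
  rfl

theorem primrec_topVars : Primrec₂ topVars := by
  have h : Primrec fun y : Bool × BlockFormula =>
      y.2.cases (fun _ => []) (fun z => if z.1 = y.1 then z.2.1 else []) :=
    primrec_cases snd (Primrec₂.const _)
      (ite (Primrec.eq.comp (fst.comp snd) (fst.comp fst)) (fst.comp (snd.comp snd)) (const _))
  refine h.of_eq ?_
  rintro ⟨q, _ | _⟩ <;> rfl

theorem primrec_topParts : Primrec₂ topParts := by
  have h : Primrec fun y : Bool × BlockFormula =>
      y.2.cases (fun _ => [y.2]) (fun z => if z.1 = y.1 then z.2.2 else [y.2]) :=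
    primrec_cases snd (list_cons.comp (snd.comp fst) (const []))
      (ite (Primrec.eq.comp (fst.comp snd) (fst.comp fst)) (snd.comp (snd.comp snd))
        (list_cons.comp (snd.comp fst) (const [])))
  refine h.of_eq ?_
  rintro ⟨q, _ | _⟩
  · rfl
  · simp only [cases, topParts]

theorem primrec_merge : Primrec merge := by
  have hV : Primrec₂ fun (a : (Bool × List ℕ × List BlockFormula) × List BlockFormula)
      (d : BlockFormula) => topVars a.1.1 d := primrec_topVars.comp (fst.comp (fst.comp fst)) snd
  have hP : Primrec₂ fun (a : (Bool × List ℕ × List BlockFormula) × List BlockFormula)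
      (d : BlockFormula) => topParts a.1.1 d := primrec_topParts.comp (fst.comp (fst.comp fst)) snd
  exact primrec_rec (g := fun y => lit y.1 y.2.1 y.2.2)
    (h := fun y ds => block y.1 (y.2.1 ++ ds.flatMap (topVars y.1)) (ds.flatMap (topParts y.1)))
    primrec_lit
    (primrec_block.comp (pair (fst.comp fst) (pair
      (list_append.comp (fst.comp (snd.comp fst))
        (list_flatMap snd hV)) (list_flatMap snd hP))))
    (fun p R vs => by rw [merge]) (fun q X cs => by rw [merge])

/-- The renaming that is described by a list of nested blocks, the innermost first: a pair `(X, n)`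
means that the members of `X` get the names `n, n + 1, …`. -/
def envRenaming (env : List (List ℕ × ℕ)) (x : ℕ) : ℕ :=
  env.foldr (fun e y => if x ∈ e.1 then e.2 + e.1.idxOf x else y) x

theorem primrec_envRenaming : Primrec₂ envRenaming :=
  list_foldr fst snd (ite (primrecRel_mem.comp (snd.comp fst) (fst.comp (fst.comp snd)))
    (nat_add.comp (snd.comp (fst.comp snd))
      (list_idxOf.comp (snd.comp fst) (fst.comp (fst.comp snd))))
    (snd.comp snd)).to₂

/-- The recursive calls of `rename` for the members of a list. -/
def renameCalls (env : List (List ℕ × ℕ)) :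
    ℕ → List BlockFormula → List (List (List ℕ × ℕ) × ℕ × BlockFormula)
  | _, [] => []
  | n, c :: cs => (env, n, c) :: renameCalls env (n + c.bound.length) cs

/-- A function `f` cannot be an argument of a primitive recursive function, but every renaming
reached from the identity is described by a finite environment. This turns the recursion of `rename`
into one on codable data. -/
theorem renameList_eq_map (env : List (List ℕ × ℕ)) (n : ℕ) (cs : List BlockFormula) :
    renameList (envRenaming env) n cs =
      (renameCalls env n cs).map fun y => rename (envRenaming y.1) y.2.1 y.2.2 := by
  induction cs generalizing n with
  | nil => rw [renameList]; rfl
  | cons c cs ih => rw [renameList, renameCalls, List.map_cons, ih]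

theorem mem_of_mem_renameCalls {env : List (List ℕ × ℕ)} {n : ℕ} {cs : List BlockFormula}
    {y : List (List ℕ × ℕ) × ℕ × BlockFormula} (h : y ∈ renameCalls env n cs) : y.2.2 ∈ cs := by
  induction cs generalizing n with
  | nil => simp [renameCalls] at h
  | cons c cs ih =>
    rcases List.mem_cons.1 h with rfl | h
    · exact List.mem_cons_self
    · exact List.mem_cons_of_mem _ (ih h)

theorem primrec_renameCalls :
    Primrec fun y : List (List ℕ × ℕ) × ℕ × List BlockFormula => renameCalls y.1 y.2.1 y.2.2 := by
  have h : Primrec fun y : List (List ℕ × ℕ) × ℕ × List BlockFormula =>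
      (y.2.2.foldl (fun (r : ℕ × List (List (List ℕ × ℕ) × ℕ × BlockFormula)) c =>
        (r.1 + c.bound.length, r.2 ++ [(y.1, r.1, c)])) (y.2.1, [])).2 := by
    have hstep : Primrec₂ fun (a : List (List ℕ × ℕ) × ℕ × List BlockFormula)
        (z : (ℕ × List (List (List ℕ × ℕ) × ℕ × BlockFormula)) × BlockFormula) =>
        (z.1.1 + z.2.bound.length, z.1.2 ++ [(a.1, z.1.1, z.2)]) :=
      pair (nat_add.comp (fst.comp (fst.comp snd))
          (list_length.comp (primrec_bound.comp (snd.comp snd))))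
        (list_append.comp (snd.comp (fst.comp snd)) (list_cons.comp
          (pair (fst.comp fst) (pair (fst.comp (fst.comp snd)) (snd.comp snd))) (const [])))
    exact snd.comp (list_foldl (snd.comp snd) (pair (fst.comp snd) (const [])) hstep)
  refine h.of_eq ?_
  rintro ⟨env, n, cs⟩
  have key (acc : List (List (List ℕ × ℕ) × ℕ × BlockFormula)) :
      (cs.foldl (fun (r : ℕ × List (List (List ℕ × ℕ) × ℕ × BlockFormula)) c =>
        (r.1 + c.bound.length, r.2 ++ [(env, r.1, c)])) (n, acc)).2 =
      acc ++ renameCalls env n cs := by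
    induction cs generalizing n acc with
    | nil => simp [renameCalls]
    | cons c cs ih => simp [renameCalls, ih]
  exact key []

theorem primrec_rename : Primrec fun y : List (List ℕ × ℕ) × ℕ × BlockFormula =>
    rename (envRenaming y.1) y.2.1 y.2.2 := by
  refine primrec_of_calls (m := fun y => y.2.2.code)
    (calls := fun y => y.2.2.cases (fun _ => []) fun z =>
      renameCalls ((z.2.1, y.2.1) :: y.1) (y.2.1 + z.2.1.length) z.2.2)
    (g := fun y rs => y.2.2.cases (fun z => lit z.1 z.2.1 (z.2.2.map (envRenaming y.1)))
      fun z => block z.1 (List.range' y.2.1 z.2.1.length) rs)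
    (primrec_code.comp (snd.comp snd)) ?_ ?_ ?_ ?_
  · have hX : Primrec fun y : (List (List ℕ × ℕ) × ℕ × BlockFormula) ×
        (Bool × List ℕ × List BlockFormula) => y.2.2.1 := fst.comp (snd.comp snd)
    have hn : Primrec fun y : (List (List ℕ × ℕ) × ℕ × BlockFormula) ×
        (Bool × List ℕ × List BlockFormula) => y.1.2.1 := fst.comp (snd.comp fst)
    have h := primrec_renameCalls.comp (pair (list_cons.comp (pair hX hn) (fst.comp fst))
      (pair (nat_add.comp hn (list_length.comp hX)) (snd.comp (snd.comp snd))))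
    exact primrec_cases (snd.comp snd) (Primrec₂.const _) h
  · have hmap : Primrec fun y : ((List (List ℕ × ℕ) × ℕ × BlockFormula) × List BlockFormula) ×
        (Bool × ℕ × List ℕ) => y.2.2.2.map (envRenaming y.1.1.1) :=
      list_map (snd.comp (snd.comp snd))
        (primrec_envRenaming.comp (fst.comp (fst.comp (fst.comp fst))) snd)
    have hrange : Primrec fun y : ((List (List ℕ × ℕ) × ℕ × BlockFormula) ×
        List BlockFormula) × (Bool × List ℕ × List BlockFormula) =>
        List.range' y.1.1.2.1 y.2.2.1.length :=
      primrec_range'.comp (fst.comp (snd.comp (fst.comp fst)))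
        (list_length.comp (fst.comp (snd.comp snd)))
    have hlit := primrec_lit.comp (pair (fst.comp snd) (pair (fst.comp (snd.comp snd)) hmap))
    have hblock := primrec_block.comp (pair (fst.comp snd) (pair hrange (snd.comp fst)))
    exact primrec_cases (snd.comp (snd.comp fst)) hlit hblock
  · rintro ⟨env, n, _ | ⟨q, X, cs⟩⟩ y hy
    · simp [cases] at hy
    · exact code_lt_code_block (mem_of_mem_renameCalls hy) _ _
  · rintro ⟨env, n, _ | ⟨q, X, cs⟩⟩
    · simp only [cases]
      rw [rename]
    · simp only [cases]
      -- The renaming of the environment extended by `(X, n)` is `extendRenaming` by definition.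
      rw [rename_block, ← renameList_eq_map]
      rfl

theorem primrec_layer : Primrec layer := by
  have h : Primrec fun t : BlockFormula =>
      (rename (envRenaming []) (t.free.sup id + 1) t).merge :=
    primrec_merge.comp (primrec_rename.comp (pair (const [])
      (pair primrec_succ_sup_free .id)))
  exact h.of_eq fun t => rfl

end BlockFormula

-- The normal forms are primitive recursive

section NormalForms

open Primrec

theorem primrec_quantify :
    Primrec fun y : Bool × ℕ × List BlockFormula => quantify y.1 y.2.1 y.2.2 := by
  have hx : Primrec fun z : (Bool × ℕ × List BlockFormula) × BlockFormula => z.1.2.1 :=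
    fst.comp (snd.comp fst)
  have hi : Primrec fun y : Bool × ℕ × List BlockFormula =>
      y.2.2.filter fun c => y.2.1 ∈ c.free :=
    primrec_filter (snd.comp snd) (primrecRel_mem_free.comp hx snd)
  have ho : Primrec fun y : Bool × ℕ × List BlockFormula =>
      y.2.2.filter fun c => y.2.1 ∉ c.free :=
    primrec_filter (snd.comp snd) (primrecRel_mem_free.comp hx snd).not
  refine (ite (Primrec.eq.comp hi (const [])) ho (list_cons.comp (primrec_block.comp
    (pair fst (pair (list_cons.comp (fst.comp snd) (const [])) hi))) ho)).of_eq fun y => ?_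
  unfold quantify
  simp only [List.isEmpty_iff]

theorem primrec_normalForms :
    Primrec fun y : Bool × Formula => normalForms y.1 y.2 := by
  let NF := List (List BlockFormula) × List (List BlockFormula)
  have hcnf : Primrec ofCNF := pair .id primrec_sections
  have hdnf : Primrec ofDNF := pair primrec_sections .id
  let g (y : Bool × Formula) (rs : List NF) : NF :=
    y.2.cases (fun z => ([[lit y.1 z.1 z.2]], [[lit y.1 z.1 z.2]])) (fun _ => rs.getD 0 ([], []))
      -- Equality of the flag of the constructor and the polarity means that, with negations pushed
      -- inwards, the connective acts as a conjunction, or the quantifier as ∃.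
      (fun z => if z.1 = y.1 then ofCNF ((rs.getD 0 ([], [])).1 ++ (rs.getD 1 ([], [])).1)
        else ofDNF ((rs.getD 0 ([], [])).2 ++ (rs.getD 1 ([], [])).2))
      (fun z => if z.1 = y.1 then ofDNF ((rs.getD 0 ([], [])).2.map fun l => quantify true z.2.1 l)
        else ofCNF ((rs.getD 0 ([], [])).1.map fun l => quantify false z.2.1 l))
  refine primrec_of_calls (m := fun y => y.2.code)
    (calls := fun y => y.2.cases (fun _ => []) (fun φ => [(!y.1, φ)])
      (fun z => [(y.1, z.2.1), (y.1, z.2.2)]) (fun z => [(y.1, z.2.2)])) (g := g)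
    (Formula.primrec_code.comp snd) ?_ ?_ ?_ ?_
  · have hy {β : Type} [Primcodable β] : Primrec fun a : (Bool × Formula) × β => a.1.1 :=
      fst.comp fst
    exact Formula.primrec_cases snd (Primrec₂.const _)
      (list_cons.comp (pair (Primrec.not.comp hy) snd) (const []))
      (list_cons.comp (pair hy (fst.comp (snd.comp snd))) (list_cons.comp
        (pair hy (snd.comp (snd.comp snd))) (const [])))
      (list_cons.comp (pair hy (snd.comp (snd.comp snd))) (const []))
  · have hr {β : Type} [Primcodable β] (i : ℕ) : Primrec fun a :
        ((Bool × Formula) × List NF) × β => a.1.2.getD i ([], []) :=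
      (list_getD _).comp (snd.comp fst) (const i)
    have hb {β : Type} [Primcodable β] : PrimrecPred fun a :
        ((Bool × Formula) × List NF) × (Bool × β) => a.2.1 = a.1.1.1 :=
      Primrec.eq.comp (fst.comp snd) (fst.comp (fst.comp fst))
    have h : Primrec fun a : ((Bool × Formula) × List NF) × (ℕ × List ℕ) =>
        [[lit a.1.1.1 a.2.1 a.2.2]] :=
      list_cons.comp (list_cons.comp (primrec_lit.comp (pair (fst.comp (fst.comp fst))
        (pair (fst.comp snd) (snd.comp snd)))) (const [])) (const [])
    have hq (q : Bool) : Primrec fun a : (((Bool × Formula) × List NF) × (Bool × ℕ × Formula)) ×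
        List BlockFormula => quantify q a.1.2.2.1 a.2 :=
      primrec_quantify.comp (pair (const q) (pair (fst.comp (snd.comp (snd.comp fst))) snd))
    have h₁ : Primrec₂ fun (a : (Bool × Formula) × List NF) (z : ℕ × List ℕ) =>
        (([[lit a.1.1 z.1 z.2]], [[lit a.1.1 z.1 z.2]]) : NF) := pair h h
    have h₂ : Primrec₂ fun (a : (Bool × Formula) × List NF) (_ : Formula) =>
        a.2.getD 0 ([], []) := hr 0
    have h₃ : Primrec₂ fun (a : (Bool × Formula) × List NF) (z : Bool × Formula × Formula) =>
        if z.1 = a.1.1 then ofCNF ((a.2.getD 0 ([], [])).1 ++ (a.2.getD 1 ([], [])).1)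
          else ofDNF ((a.2.getD 0 ([], [])).2 ++ (a.2.getD 1 ([], [])).2) :=
      ite hb (hcnf.comp (list_append.comp (fst.comp (hr 0)) (fst.comp (hr 1))))
        (hdnf.comp (list_append.comp (snd.comp (hr 0)) (snd.comp (hr 1))))
    have h₄ : Primrec₂ fun (a : (Bool × Formula) × List NF) (z : Bool × ℕ × Formula) =>
        if z.1 = a.1.1 then ofDNF ((a.2.getD 0 ([], [])).2.map fun l => quantify true z.2.1 l)
          else ofCNF ((a.2.getD 0 ([], [])).1.map fun l => quantify false z.2.1 l) :=
      ite hb (hdnf.comp (list_map (snd.comp (hr 0)) (hq true)))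
        (hcnf.comp (list_map (fst.comp (hr 0)) (hq false)))
    exact Formula.primrec_cases (snd.comp fst) h₁ h₂ h₃ h₄
  · rintro ⟨pos, φ⟩ b hb
    cases φ with
    | atom => simp [Formula.cases] at hb
    | not φ =>
      simp only [Formula.cases, List.mem_singleton] at hb
      rw [hb]
      exact Formula.code_lt_code_not φ
    | and φ ψ =>
      have := Formula.code_lt_code_and φ ψ
      simp only [Formula.cases, List.mem_cons, List.not_mem_nil, or_false] at hb
      rcases hb with rfl | rfl
      exacts [this.1, this.2]
    | or φ ψ =>
      have := Formula.code_lt_code_or φ ψ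
      simp only [Formula.cases, List.mem_cons, List.not_mem_nil, or_false] at hb
      rcases hb with rfl | rfl
      exacts [this.1, this.2]
    | ex x φ =>
      simp only [Formula.cases, List.mem_singleton] at hb
      rw [hb]
      exact Formula.code_lt_code_ex x φ
    | all x φ =>
      simp only [Formula.cases, List.mem_singleton] at hb
      rw [hb]
      exact Formula.code_lt_code_all x φ
  · rintro ⟨pos, φ⟩
    cases φ <;> cases pos <;> rw [normalForms] <;> rfl

theorem primrec_lay : Primrec lay := by
  have horg : Primrec org := fst.comp (primrec_normalForms.comp (pair (const true) .id))
  exact PosComb.primrec_conj.comp (list_map horg (PosComb.primrec_disj.comp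
    (list_map snd (PosComb.primrec_base.comp (primrec_layer.comp snd)).to₂)).to₂)

theorem isLayering_lay : IsLayering.{u} lay where
  computable := (PosComb.primrec_code.comp primrec_lay).to_comp
  layered _ _ := isLayered_of_mem_parts_lay
  equivalent := equivalent_lay
  free_subset := free_lay_subset
  symbols_subset := symbols_lay_subset

end NormalForms

/-! ### Tree decompositions and elimination orders -/

section Trees

variable {V : Type}

/-- The bags that contain a given vertex are closed under taking paths of `T`. -/
def PathConvex (T : SimpleGraph V) (B : V → Finset ℕ) : Prop :=
  ∀ a i j, a ∈ B i → a ∈ B j → ∀ p : T.Walk i j, p.IsPath → ∀ k ∈ p.support, a ∈ B k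

/-- Used to restrict the bags to a clique and to delete an eliminated variable. -/
theorem PathConvex.inter {T : SimpleGraph V} {B : V → Finset ℕ} (h : PathConvex T B)
    (p : ℕ → Prop) [DecidablePred p] : PathConvex T fun i => (B i).filter p := by
  intro a i j hi hj w hw k hk
  rw [Finset.mem_filter] at hi hj ⊢
  exact ⟨h a i j hi.1 hj.1 w hw k hk, hi.2⟩

theorem exists_isPath_of_induce {T : SimpleGraph V} {S : Set V} {i j : S}
    {p : (T.induce S).Walk i j} (hp : p.IsPath) :
    ∃ p' : T.Walk i.1 j.1, p'.IsPath ∧ p'.support = p.support.map Subtype.val :=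
  ⟨p.map (SimpleGraph.Embedding.induce S).toHom, hp.map Subtype.val_injective,
    SimpleGraph.Walk.support_map _ _⟩

/-- The only path of the forest between two such bags is the one inside the induced subgraph. Path
convexity, unlike connectedness, also holds for vertices in no bag and passes directly to subtrees.
-/
theorem pathConvex_of_preconnected {T : SimpleGraph V} (hT : T.IsAcyclic) {B : V → Finset ℕ}
    (h : ∀ a, (T.induce {i | a ∈ B i}).Preconnected) : PathConvex T B := by
  classical
  intro a i j hi hj p hp k hk
  obtain ⟨w⟩ := h a ⟨i, hi⟩ ⟨j, hj⟩
  obtain ⟨w', hw', hs⟩ := exists_isPath_of_induce w.toPath.2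
  have e : p = w' := congrArg Subtype.val
    ((hT.subsingleton_path i j).elim ⟨p, hp⟩ ⟨w', hw'⟩)
  rw [e, hs] at hk
  obtain ⟨⟨k, hk'⟩, -, rfl⟩ := List.mem_map.1 hk
  exact hk'

theorem PathConvex.induce {T : SimpleGraph V} {B : V → Finset ℕ} (h : PathConvex T B)
    (S : Set V) : PathConvex (T.induce S) fun i => B i.1 := by
  intro a i j hi hj p hp k hk
  obtain ⟨p', hp', hs⟩ := exists_isPath_of_induce hp
  refine h a i j hi hj p' hp' k ?_
  rw [hs]
  exact List.mem_map.2 ⟨k, hk, rfl⟩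

/-- Every path that leaves the leaf `l` goes through its neighbour `p`. -/
theorem PathConvex.eq_leaf {T : SimpleGraph V} (hT : T.Connected) {B : V → Finset ℕ}
    (h : PathConvex T B) {l p : V} (hlp : ∀ y, T.Adj l y → y = p) {a : ℕ} (hl : a ∈ B l)
    (hp : a ∉ B p) {j : V} (hj : a ∈ B j) : j = l := by
  by_contra hne
  obtain ⟨w, hw⟩ := hT.exists_isPath l j
  have hnil : ¬ w.Nil := SimpleGraph.Walk.not_nil_of_ne (Ne.symm hne)
  have hs := h a l j hl hj w hw w.snd (w.getVert_mem_support 1)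
  rw [hlp _ (w.adj_snd hnil)] at hs
  exact hp hs

/-- Unless all vertices lie in the clique `F`, some vertex outside of `F` is simplicial. -/
theorem exists_simplicial [Fintype V] {T : SimpleGraph V} (hT : T.IsTree) {B : V → Finset ℕ}
    (hB : PathConvex T B) {F : Finset ℕ} (hF : ∀ a ∈ F, ∀ b ∈ F, ∃ i, a ∈ B i ∧ b ∈ B i)
    {x₀ : ℕ} {i₀ : V} (hx₀ : x₀ ∈ B i₀) (hx₀F : x₀ ∉ F) :
    ∃ x ∉ F, ∃ i, x ∈ B i ∧ ∀ j, x ∈ B j → B j ⊆ B i := by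
  classical
  induction hn : Fintype.card V using Nat.strong_induction_on generalizing V with
  | _ n ih =>
  rcases subsingleton_or_nontrivial V with hV | hV
  · exact ⟨x₀, hx₀F, i₀, hx₀, fun j _ => by rw [Subsingleton.elim j i₀]⟩
  -- A leaf either settles the claim, or its bag contains the whole of `F` and some member of `F`
  -- occurs in no other bag.
  have leaf (l : V) (hl : T.degree l = 1) :
      (∃ x ∉ F, ∃ i, x ∈ B i ∧ ∀ j, x ∈ B j → B j ⊆ B i) ∨
        (F ⊆ B l ∧ ∃ w ∈ F, ∀ j, w ∈ B j → j = l) := by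
    obtain ⟨p, hadj, hp⟩ := SimpleGraph.degree_eq_one_iff_existsUnique_adj.1 hl
    -- A leaf whose bag lies in that of its neighbour is redundant: delete it and use induction.
    -- Otherwise some `w` is found in this bag only. It is simplicial, and if it belongs to `F`, all
    -- of `F` must meet it in this bag.
    by_cases hsub : B l ⊆ B p
    · left
      have hpl : p ∈ ({l}ᶜ : Set V) := by simpa using hadj.ne'
      have hmove (i : V) : ∃ i' : ({l}ᶜ : Set V), B i ⊆ B i' := by
        by_cases hi : i = l
        · exact ⟨⟨p, hpl⟩, hi ▸ hsub⟩
        · exact ⟨⟨i, hi⟩, subset_rfl⟩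
      have hcard : Fintype.card ({l}ᶜ : Set V) < n := by
        rw [← hn]
        exact Fintype.card_subtype_lt (x := l) (by simp)
      obtain ⟨i₁, hi₁⟩ := hmove i₀
      obtain ⟨x, hx, i, hxi, hi⟩ := ih _ hcard
        (T := T.induce {l}ᶜ) ⟨hT.connected.induce_compl_singleton_of_degree_eq_one hl,
          hT.isAcyclic.induce _⟩ (hB.induce _) (fun a ha b hb => by
            obtain ⟨i, hai, hbi⟩ := hF a ha b hb
            obtain ⟨i', hi'⟩ := hmove i
            exact ⟨i', hi' hai, hi' hbi⟩) (hi₁ hx₀) rfl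
      refine ⟨x, hx, i, hxi, fun j hj => ?_⟩
      by_cases hjl : j = l
      · subst hjl
        exact hsub.trans (hi ⟨p, hpl⟩ (hsub hj))
      · exact hi ⟨j, hjl⟩ hj
    · obtain ⟨w, hwl, hwp⟩ := Finset.not_subset.1 hsub
      have hw (j : V) (hj : w ∈ B j) : j = l := hB.eq_leaf hT.connected hp hwl hwp hj
      by_cases hwF : w ∈ F
      · refine Or.inr ⟨fun b hb => ?_, w, hwF, hw⟩
        obtain ⟨i, hwi, hbi⟩ := hF w hwF b hb
        rwa [hw i hwi] at hbi
      · exact Or.inl ⟨w, hwF, l, hwl, fun j hj => by rw [hw j hj]⟩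
  -- Two leaves cannot both be of the second kind: `F` would lie in the bag of `u`, although a
  -- member of `F` occurs only in that of `v`.
  obtain ⟨u, v, huv, hu, hv⟩ := hT.exists_ne_and_degree_eq_one
  rcases leaf u hu with h | ⟨hFu, -⟩
  · exact h
  rcases leaf v hv with h | ⟨-, w, hwF, hw⟩
  · exact h
  exact absurd (hw u (hFu hwF)) huv

/-- A clique is contained in a bag. -/
theorem exists_subset_bag [Fintype V] {T : SimpleGraph V} (hT : T.IsTree) {B : V → Finset ℕ}
    (hB : PathConvex T B) {F : Finset ℕ} (hF : ∀ a ∈ F, ∀ b ∈ F, ∃ i, a ∈ B i ∧ b ∈ B i) :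
    ∃ i, F ⊆ B i := by
  rcases F.eq_empty_or_nonempty with rfl | ⟨x₀, hx₀⟩
  · obtain ⟨i⟩ := hT.connected.nonempty
    exact ⟨i, by simp⟩
  obtain ⟨i₀, hi₀, -⟩ := hF x₀ hx₀ x₀ hx₀
  -- After restriction of the bags to `F`, a simplicial vertex shares a bag with every member of
  -- `F`, and all these bags lie in one.
  obtain ⟨x, -, i, hx, hi⟩ := exists_simplicial hT (hB.inter (· ∈ F)) (F := ∅) (by simp)
    (Finset.mem_filter.2 ⟨hi₀, hx₀⟩) (by simp)
  refine ⟨i, fun y hy => ?_⟩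
  obtain ⟨j, hxj, hyj⟩ := hF x (Finset.mem_filter.1 hx).2 y hy
  exact (Finset.mem_filter.1 (hi j (Finset.mem_filter.2 ⟨hxj, (Finset.mem_filter.1 hx).2⟩)
    (Finset.mem_filter.2 ⟨hyj, hy⟩))).1

/-- The treewidth is attained by a tree decomposition. -/
theorem exists_isTreeDecomposition (E : Finset (Finset ℕ)) :
    ∃ (m : ℕ) (T : SimpleGraph (Fin m)) (B : Fin m → Finset ℕ),
      IsTreeDecomposition E T B ∧ ∀ i, (B i).card ≤ tw E + 1 := by
  refine Nat.sInf_mem (s := {k | ∃ (m : ℕ) (T : SimpleGraph (Fin m)) (B : Fin m → Finset ℕ),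
    IsTreeDecomposition E T B ∧ ∀ i, (B i).card ≤ k + 1}) ?_
  -- The decomposition with a single bag shows that the infimum is over a nonempty set.
  refine ⟨(verts E).card, 1, ⊥, fun _ => verts E, ⟨.of_subsingleton, ?_, ?_, ?_⟩, fun _ => Nat.le_succ _⟩
  · ext; simp
  · intro e he a ha b hb _
    have hsub : e ⊆ verts E := Finset.le_sup (f := id) he
    exact ⟨0, hsub ha, hsub hb⟩
  · intro a ha
    have : Nonempty {i : Fin 1 | a ∈ verts E} := ⟨⟨0, ha⟩⟩
    exact SimpleGraph.IsTree.of_subsingleton.connected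

end Trees

/-! ### Eliminating quantified variables -/

namespace Formula

variable {A : Type u} {I : ℕ → List A → Prop}

/-- The maximal number of free variables of a subformula, where the variable of a quantifier is
counted in its scope. -/
def width : Formula → ℕ
  | atom _ vs => vs.toFinset.card
  | not φ => φ.width
  | and φ ψ => max (φ.free ∪ ψ.free).card (max φ.width ψ.width)
  | or φ ψ => max (φ.free ∪ ψ.free).card (max φ.width ψ.width)
  | ex x φ => max (insert x φ.free).card φ.width
  | all x φ => max (insert x φ.free).card φ.width

theorem width_quant (q : Bool) (x : ℕ) (φ : Formula) :
    (quant q x φ).width = max (insert x φ.free).card φ.width := by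
  cases q <;> rfl

/-- The free variables of a partial conjunction are free in the whole one, so only the latter has to
be bounded. -/
theorem width_bigOp_le {q : Bool} {l : List Formula} {w : ℕ} (hl : ∀ φ ∈ l, φ.width ≤ w)
    (hw : (bigOp q l).free.card ≤ w) : (bigOp q l).width ≤ w := by
  have h₁ (l : List Formula) (φ : Formula) (hφ : φ.width ≤ w) (hl : ∀ ψ ∈ l, ψ.width ≤ w)
      (hw : (l.foldl and φ).free.card ≤ w) :
      φ.free ⊆ (l.foldl and φ).free ∧ (l.foldl and φ).width ≤ w := by
    induction l generalizing φ with
    | nil => exact ⟨subset_rfl, hφ⟩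
    | cons ψ l ih =>
      have hsub (l : List Formula) (φ : Formula) : φ.free ⊆ (l.foldl and φ).free := by
        induction l generalizing φ with
        | nil => exact subset_rfl
        | cons ψ l ih => exact Finset.subset_union_left.trans (ih (and φ ψ))
      refine ⟨hsub _ _, (ih (and φ ψ) ?_ (fun χ hχ => hl χ (List.mem_cons_of_mem _ hχ)) hw).2⟩
      exact max_le ((Finset.card_le_card (hsub l (and φ ψ))).trans hw)
        (max_le hφ (hl ψ List.mem_cons_self))
  have h₂ (l : List Formula) (φ : Formula) (hφ : φ.width ≤ w) (hl : ∀ ψ ∈ l, ψ.width ≤ w)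
      (hw : (l.foldl or φ).free.card ≤ w) :
      φ.free ⊆ (l.foldl or φ).free ∧ (l.foldl or φ).width ≤ w := by
    induction l generalizing φ with
    | nil => exact ⟨subset_rfl, hφ⟩
    | cons ψ l ih =>
      have hsub (l : List Formula) (φ : Formula) : φ.free ⊆ (l.foldl or φ).free := by
        induction l generalizing φ with
        | nil => exact subset_rfl
        | cons ψ l ih => exact Finset.subset_union_left.trans (ih (or φ ψ))
      refine ⟨hsub _ _, (ih (or φ ψ) ?_ (fun χ hχ => hl χ (List.mem_cons_of_mem _ hχ)) hw).2⟩
      exact max_le ((Finset.card_le_card (hsub l (or φ ψ))).trans hw)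
        (max_le hφ (hl ψ List.mem_cons_self))
  cases l with
  | nil => cases q <;> simp [bigOp, conj, disj, width]
  | cons φ l =>
    have hφ := hl φ List.mem_cons_self
    have hl' : ∀ ψ ∈ l, ψ.width ≤ w := fun ψ hψ => hl ψ (List.mem_cons_of_mem _ hψ)
    cases q
    · exact (h₂ l φ hφ hl' hw).2
    · exact (h₁ l φ hφ hl' hw).2

/-- Quantify `x` over those members of the list in which it is free. -/
def elimVar (q : Bool) (l : List Formula) (x : ℕ) : List Formula :=
  if l.filter (fun φ => x ∈ φ.free) = [] then l
  else quant q x (bigOp q (l.filter fun φ => x ∈ φ.free)) :: l.filter fun φ => x ∉ φ.free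

/-- Quantify the members of `π` one after the other. -/
def elim (q : Bool) (π : List ℕ) (l : List Formula) : List Formula := π.foldl (elimVar q) l

theorem mem_elimVar {q : Bool} {l : List Formula} {x : ℕ} {φ : Formula} :
    φ ∈ elimVar q l x ↔ (φ ∈ l ∧ x ∉ φ.free) ∨ ((∃ ψ ∈ l, x ∈ ψ.free) ∧
      φ = quant q x (bigOp q (l.filter fun φ => x ∈ φ.free))) := by
  unfold elimVar
  split_ifs with h
  · have h' : ∀ ψ ∈ l, x ∉ ψ.free := by simpa using h
    constructor
    · exact fun hφ => Or.inl ⟨hφ, h' φ hφ⟩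
    · rintro (hφ | ⟨⟨ψ, hψ, hx⟩, -⟩)
      · exact hφ.1
      · exact absurd hx (h' ψ hψ)
  · have h' : ∃ ψ ∈ l, x ∈ ψ.free := by simpa using h
    simp [h', or_comm]

theorem mem_free_of_mem_elimVar {q : Bool} {l : List Formula} {x y : ℕ} {φ : Formula}
    (h : φ ∈ elimVar q l x) (hy : y ∈ φ.free) : (∃ ψ ∈ l, y ∈ ψ.free) ∧ y ≠ x := by
  rcases mem_elimVar.1 h with ⟨h, hx⟩ | ⟨-, rfl⟩
  · exact ⟨⟨φ, h, hy⟩, fun e => hx (e ▸ hy)⟩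
  · rw [free_quant, Finset.mem_erase, mem_free_bigOp] at hy
    obtain ⟨hyx, ψ, hψ, hy⟩ := hy
    exact ⟨⟨ψ, (List.mem_filter.1 hψ).1, hy⟩, hyx⟩

theorem mem_symbols_of_mem_elimVar {q : Bool} {l : List Formula} {x : ℕ} {r : ℕ × ℕ}
    {φ : Formula} (h : φ ∈ elimVar q l x) (hr : r ∈ φ.symbols) : ∃ ψ ∈ l, r ∈ ψ.symbols := by
  rcases mem_elimVar.1 h with ⟨h, -⟩ | ⟨⟨ψ, hψ, hx⟩, rfl⟩
  · exact ⟨φ, h, hr⟩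
  · rw [symbols_quant, mem_symbols_bigOp
      (List.ne_nil_of_mem (List.mem_filter.2 ⟨hψ, by simpa using hx⟩))] at hr
    obtain ⟨ψ, hψ, hr⟩ := hr
    exact ⟨ψ, (List.mem_filter.1 hψ).1, hr⟩

theorem elimVar_ne_nil {q : Bool} {l : List Formula} {x : ℕ} (hl : l ≠ []) :
    elimVar q l x ≠ [] := by
  unfold elimVar
  split_ifs
  · exact hl
  · simp

theorem holds_elimVar {q : Bool} {l : List Formula} {x : ℕ} (s : ℕ → A) :
    (∀ φ ∈ elimVar q l x, Holds I q s φ) ↔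
      ∃ a, ∀ φ ∈ l, Holds I q (Function.update s x a) φ := by
  have hout (φ : Formula) (a : A) (h : x ∉ φ.free) :
      Holds I q (Function.update s x a) φ ↔ Holds I q s φ :=
    holds_congr fun y hy => Function.update_of_ne (fun e : y = x => h (e ▸ hy)) _ _
  have hne (h : ∃ ψ ∈ l, x ∈ ψ.free) : l.filter (fun φ => decide (x ∈ φ.free)) ≠ [] := by
    simpa using h
  simp only [mem_elimVar]
  constructor
  · intro h
    by_cases hx : ∃ ψ ∈ l, x ∈ ψ.free
    · have hb := h _ (Or.inr ⟨hx, rfl⟩)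
      rw [holds_quant] at hb
      obtain ⟨a, ha⟩ := hb
      rw [holds_bigOp (hne hx)] at ha
      refine ⟨a, fun φ hφ => ?_⟩
      by_cases hxφ : x ∈ φ.free
      · exact ha φ (List.mem_filter.2 ⟨hφ, by simpa using hxφ⟩)
      · exact (hout φ a hxφ).2 (h φ (Or.inl ⟨hφ, hxφ⟩))
    · push Not at hx
      exact ⟨s x, fun φ hφ => (hout φ _ (hx φ hφ)).2 (h φ (Or.inl ⟨hφ, hx φ hφ⟩))⟩
  · rintro ⟨a, ha⟩ φ (⟨hφ, hx⟩ | ⟨hx, rfl⟩)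
    · exact (hout φ a hx).1 (ha φ hφ)
    · rw [holds_quant]
      refine ⟨a, ?_⟩
      rw [holds_bigOp (hne hx)]
      exact fun φ hφ => ha φ (List.mem_filter.1 hφ).1

theorem elim_ne_nil {q : Bool} {π : List ℕ} {l : List Formula} (hl : l ≠ []) :
    elim q π l ≠ [] := by
  induction π generalizing l with
  | nil => exact hl
  | cons x π ih => exact ih (elimVar_ne_nil hl)

theorem mem_free_of_mem_elim {q : Bool} {π : List ℕ} {l : List Formula} {y : ℕ} {φ : Formula}
    (h : φ ∈ elim q π l) (hy : y ∈ φ.free) : (∃ ψ ∈ l, y ∈ ψ.free) ∧ y ∉ π := by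
  induction π generalizing l with
  | nil => exact ⟨⟨φ, h, hy⟩, List.not_mem_nil⟩
  | cons x π ih =>
    obtain ⟨⟨ψ, hψ, hyψ⟩, hyπ⟩ := ih h
    obtain ⟨h₁, h₂⟩ := mem_free_of_mem_elimVar hψ hyψ
    exact ⟨h₁, by simp [h₂, hyπ]⟩

theorem mem_symbols_of_mem_elim {q : Bool} {π : List ℕ} {l : List Formula} {r : ℕ × ℕ}
    {φ : Formula} (h : φ ∈ elim q π l) (hr : r ∈ φ.symbols) : ∃ ψ ∈ l, r ∈ ψ.symbols := by
  induction π generalizing l with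
  | nil => exact ⟨φ, h, hr⟩
  | cons x π ih =>
    obtain ⟨ψ, hψ, hrψ⟩ := ih h
    exact mem_symbols_of_mem_elimVar hψ hrψ

/-- The meaning depends only on the set of eliminated variables, so their order may be chosen to
suit the width. -/
theorem holds_elim {q : Bool} {π : List ℕ} {l : List Formula} (s : ℕ → A) :
    (∀ φ ∈ elim q π l, Holds I q s φ) ↔
      ∃ t : ℕ → A, (∀ x ∉ π, t x = s x) ∧ ∀ φ ∈ l, Holds I q t φ := by
  induction π generalizing l with
  | nil =>
    constructor
    · exact fun h => ⟨s, fun _ _ => rfl, h⟩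
    · rintro ⟨t, ht, h⟩
      rwa [show t = s from funext fun x => ht x List.not_mem_nil] at h
  | cons x π ih =>
    refine (ih (l := elimVar q l x)).trans ?_
    simp only [holds_elimVar]
    constructor
    · rintro ⟨t, ht, a, ha⟩
      refine ⟨_, fun y hy => ?_, ha⟩
      rw [List.mem_cons, not_or] at hy
      rw [Function.update_of_ne hy.1, ht y hy.2]
    · rintro ⟨t, ht, h⟩
      -- The assignment for `π` must agree with `s` off `π`, possibly also at `x`; the value `t x`
      -- is then restored by the quantifier of `x`.
      refine ⟨Function.update t x (s x), fun y hy => ?_, t x, ?_⟩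
      · by_cases hyx : y = x
        · simp [hyx]
        · rw [Function.update_of_ne hyx, ht y (by simp [hy, hyx])]
      · simpa using h

theorem elim_append (q : Bool) (π π' : List ℕ) (l : List Formula) :
    elim q (π ++ π') l = elim q π' (elim q π l) := List.foldl_append

/-- Shows that the extra copy of `X` appended in `elimBest` is harmless after a complete
elimination. -/
theorem elim_eq_self {q : Bool} {π : List ℕ} {l : List Formula}
    (h : ∀ φ ∈ l, ∀ x ∈ π, x ∉ φ.free) : elim q π l = l := by
  induction π with
  | nil => rfl
  | cons x π ih =>
    have hx : elimVar q l x = l := if_pos (by simpa using fun φ hφ => h φ hφ x List.mem_cons_self)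
    rw [elim, List.foldl_cons, hx]
    exact ih fun φ hφ y hy => h φ hφ y (List.mem_cons_of_mem _ hy)

/-- If the free variables of every member of `l` form a clique of a hypergraph with a tree
decomposition into bags of at most `w` elements, then there is an order in which the variables
outside of the clique `F` can be quantified such that the width is at most `w`. -/
theorem exists_elim_order {V : Type} [Fintype V] {T : SimpleGraph V} (hT : T.IsTree) {w : ℕ}
    (q : Bool) {F : Finset ℕ} (X : Finset ℕ) {B : V → Finset ℕ} (hB : PathConvex T B)
    (hw : ∀ i, (B i).card ≤ w) (hBX : ∀ i, B i ⊆ X ∪ F) (hXF : Disjoint X F)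
    (hF : ∀ a ∈ F, ∀ b ∈ F, ∃ i, a ∈ B i ∧ b ∈ B i) {l : List Formula}
    (hl : ∀ φ ∈ l, φ.width ≤ w)
    (hc : ∀ φ ∈ l, ∀ a ∈ φ.free, ∀ b ∈ φ.free, ∃ i, a ∈ B i ∧ b ∈ B i) :
    ∃ π : List ℕ, (∀ x ∈ π, x ∈ X) ∧ π.length = X.card ∧
      ∀ φ ∈ elim q π l, φ.width ≤ w ∧ φ.free ⊆ F := by
  induction hn : X.card generalizing X B l with
  | zero =>
    rw [Finset.card_eq_zero] at hn
    subst hn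
    refine ⟨[], by simp, rfl, fun φ hφ => ⟨hl φ hφ, fun a ha => ?_⟩⟩
    obtain ⟨i, hi, -⟩ := hc φ hφ a ha a ha
    simpa using hBX i hi
  | succ n ih =>
    -- Eliminating a simplicial `x` creates a formula whose free variables lie in `B i` without `x`.
    -- So the bags without `x` again cover the free variables of each formula pairwise, and
    -- induction applies.
    have step (x : ℕ) (hx : x ∈ X) (i : V) (hi : ∀ j, x ∈ B j → B j ⊆ B i)
        (hxi : (∃ φ ∈ l, x ∈ φ.free) → x ∈ B i) : ∃ π : List ℕ, (∀ x ∈ π, x ∈ X) ∧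
          π.length = n + 1 ∧ ∀ φ ∈ elim q π l, φ.width ≤ w ∧ φ.free ⊆ F := by
      have hxF : x ∉ F := Finset.disjoint_left.1 hXF hx
      have hin (φ) (hφ : φ ∈ l) (hxφ : x ∈ φ.free) : φ.free ⊆ B i := fun y hy => by
        obtain ⟨j, hxj, hyj⟩ := hc φ hφ x hxφ y hy
        exact hi j hxj hyj
      have hsub : (bigOp q (l.filter fun φ => x ∈ φ.free)).free ⊆ B i := fun y hy => by
        obtain ⟨φ, hφ, hy⟩ := mem_free_bigOp.1 hy
        rw [List.mem_filter, decide_eq_true_eq] at hφ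
        exact hin φ hφ.1 hφ.2 hy
      obtain ⟨π, hπ, hlen, h⟩ := ih (X.erase x) (B := fun j => (B j).filter (· ≠ x))
        (hB.inter _) (fun j => (Finset.card_filter_le _ _).trans (hw j))
        (fun j y hy => by
          rw [Finset.mem_filter] at hy
          have := hBX j hy.1
          simp only [Finset.mem_union, Finset.mem_erase] at this ⊢
          exact this.imp_left fun h => ⟨hy.2, h⟩)
        (hXF.mono_left (Finset.erase_subset _ _))
        (fun a ha b hb => by
          obtain ⟨j, haj, hbj⟩ := hF a ha b hb
          exact ⟨j, Finset.mem_filter.2 ⟨haj, fun e => hxF (e ▸ ha)⟩,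
            Finset.mem_filter.2 ⟨hbj, fun e => hxF (e ▸ hb)⟩⟩)
        (l := elimVar q l x)
        (fun φ hφ => by
          rcases mem_elimVar.1 hφ with ⟨hφ, -⟩ | ⟨hx', rfl⟩
          · exact hl φ hφ
          · rw [width_quant]
            refine max_le ((Finset.card_le_card ?_).trans (hw i)) (width_bigOp_le
              (fun φ hφ => hl φ (List.mem_filter.1 hφ).1)
              ((Finset.card_le_card hsub).trans (hw i)))
            exact Finset.insert_subset (hxi hx') hsub)
        (fun φ hφ a ha b hb => by
          have hax := (mem_free_of_mem_elimVar hφ ha).2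
          have hbx := (mem_free_of_mem_elimVar hφ hb).2
          rcases mem_elimVar.1 hφ with ⟨hφ, -⟩ | ⟨-, rfl⟩
          · obtain ⟨j, haj, hbj⟩ := hc φ hφ a ha b hb
            exact ⟨j, Finset.mem_filter.2 ⟨haj, hax⟩, Finset.mem_filter.2 ⟨hbj, hbx⟩⟩
          · rw [free_quant, Finset.mem_erase] at ha hb
            exact ⟨i, Finset.mem_filter.2 ⟨hsub ha.2, hax⟩,
              Finset.mem_filter.2 ⟨hsub hb.2, hbx⟩⟩)
        (by rw [Finset.card_erase_of_mem hx, hn]; rfl)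
      refine ⟨x :: π, ?_, by rw [List.length_cons, hlen], h⟩
      rw [List.forall_mem_cons]
      exact ⟨hx, fun y hy => Finset.mem_of_mem_erase (hπ y hy)⟩
    -- A variable in no bag is free in no formula of the list, and its elimination changes nothing.
    by_cases hall : ∃ x ∈ X, ∀ i, x ∉ B i
    · obtain ⟨x, hx, hxB⟩ := hall
      obtain ⟨i⟩ := hT.connected.nonempty
      refine step x hx i (fun j hj => absurd hj (hxB j)) ?_
      rintro ⟨φ, hφ, hxφ⟩
      obtain ⟨j, hj, -⟩ := hc φ hφ x hxφ x hxφ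
      exact absurd hj (hxB j)
    · push Not at hall
      obtain ⟨x₀, hx₀⟩ : X.Nonempty := Finset.card_pos.1 (by omega)
      obtain ⟨i₀, hi₀⟩ := hall x₀ hx₀
      obtain ⟨x, hxF, i, hxi, hi⟩ := exists_simplicial hT hB hF hi₀
        (Finset.disjoint_left.1 hXF hx₀)
      have hx : x ∈ X := (Finset.mem_union.1 (hBX i hxi)).resolve_right hxF
      exact step x hx i hi fun _ => hxi

/-- A formula of minimal width among `φ` and the members of a list. -/
def minWidth (φ : Formula) (l : List Formula) : Formula :=
  l.foldl (fun φ ψ => if ψ.width < φ.width then ψ else φ) φ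

theorem minWidth_mem (φ : Formula) (l : List Formula) : minWidth φ l ∈ φ :: l := by
  induction l generalizing φ with
  | nil => simp [minWidth]
  | cons ψ l ih =>
    have h := ih (if ψ.width < φ.width then ψ else φ)
    rw [minWidth, List.foldl_cons]
    rw [minWidth] at h
    split_ifs at h ⊢ with hlt <;> simp only [List.mem_cons] at h ⊢ <;> tauto

theorem width_minWidth_le (φ : Formula) (l : List Formula) :
    (minWidth φ l).width ≤ φ.width ∧ ∀ ψ ∈ l, (minWidth φ l).width ≤ ψ.width := by
  induction l generalizing φ with
  | nil => simp [minWidth]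
  | cons ψ l ih =>
    have h := ih (if ψ.width < φ.width then ψ else φ)
    rw [minWidth, List.foldl_cons]
    rw [minWidth] at h
    rw [List.forall_mem_cons]
    split_ifs at h ⊢ with hlt
    · exact ⟨h.1.trans hlt.le, h.1, h.2⟩
    · exact ⟨h.1, h.1.trans (not_lt.1 hlt), h.2⟩

/-- Quantify the variables in `X` in an order such that the width is minimal. -/
def elimBest (q : Bool) (X : List ℕ) (l : List Formula) : Formula :=
  minWidth (bigOp q (elim q X l))
    ((X.map fun _ => X).sections.map fun π => bigOp q (elim q (π ++ X) l))

/-- The candidates are all words of length `X.length` over `X`, not only permutations. The appended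
`X` quantifies what a word has missed, so every candidate has the right meaning and only the width
depends on the choice. -/
theorem exists_elimBest_eq (q : Bool) (X : List ℕ) (l : List Formula) :
    ∃ π : List ℕ, (∀ x ∈ π, x ∈ X) ∧ elimBest q X l = bigOp q (elim q (π ++ X) l) := by
  rcases List.mem_cons.1 (minWidth_mem (bigOp q (elim q X l))
    ((X.map fun _ => X).sections.map fun π => bigOp q (elim q (π ++ X) l))) with h | h
  · exact ⟨[], by simp, h⟩
  · obtain ⟨π, hπ, e⟩ := List.mem_map.1 h
    refine ⟨π, fun x hx => ?_, e.symm⟩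
    obtain ⟨D, hD, hxD⟩ := exists_mem_of_mem_sections hπ hx
    obtain ⟨y, -, rfl⟩ := List.mem_map.1 hD
    exact hxD

theorem width_elimBest_le {q : Bool} {X : List ℕ} {l : List Formula} {π : List ℕ}
    (hπ : ∀ x ∈ π, x ∈ X) (hlen : π.length = X.length) :
    (elimBest q X l).width ≤ (bigOp q (elim q (π ++ X) l)).width := by
  refine (width_minWidth_le _ _).2 _ (List.mem_map.2 ⟨π, ?_, rfl⟩)
  rw [List.mem_sections, List.forall₂_iff_get]
  refine ⟨by simpa using hlen, fun i h₁ h₂ => ?_⟩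
  simpa using hπ _ (List.getElem_mem h₁)

end Formula

-- From thickness to width

namespace BlockFormula

open Formula

/-- A formula that is equivalent to `t` and whose width is at most the thickness of `t`. -/
def best : BlockFormula → Formula
  | lit pos R vs => (lit pos R vs).toFormula
  | block q X cs => elimBest q X (cs.map fun c => c.best)

theorem free_best_subset (t : BlockFormula) : t.best.free ⊆ t.free := by
  induction t using BlockFormula.induction with
  | hlit => rw [best, free_toFormula]
  | hblock q X cs ih =>
    intro y hy
    obtain ⟨π, hπ, e⟩ := exists_elimBest_eq q X (cs.map fun c => c.best)
    rw [best, e, mem_free_bigOp] at hy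
    obtain ⟨φ, hφ, hy⟩ := hy
    obtain ⟨⟨ψ, hψ, hyψ⟩, hyX⟩ := mem_free_of_mem_elim hφ hy
    obtain ⟨c, hc, rfl⟩ := List.mem_map.1 hψ
    exact mem_free_block.2 ⟨⟨c, hc, ih c hc hyψ⟩, fun h => hyX (List.mem_append_right _ h)⟩

theorem Proper.symbols_best_subset {t : BlockFormula} (ht : t.Proper) :
    t.best.symbols ⊆ t.toFormula.symbols := by
  induction ht with
  | lit => rw [best]
  | block q X cs hcs _ ih =>
    intro r hr
    obtain ⟨π, hπ, e⟩ := exists_elimBest_eq q X (cs.map fun c => c.best)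
    rw [best, e, mem_symbols_bigOp (elim_ne_nil (by simpa using hcs))] at hr
    obtain ⟨φ, hφ, hr⟩ := hr
    obtain ⟨ψ, hψ, hrψ⟩ := mem_symbols_of_mem_elim hφ hr
    obtain ⟨c, hc, rfl⟩ := List.mem_map.1 hψ
    exact (mem_symbols_block hcs).2 ⟨c, hc, ih c hc hrψ⟩

theorem Proper.equivalent_best {t : BlockFormula} (ht : t.Proper) :
    Equivalent.{u} t.best t.toFormula := by
  induction ht with
  | lit => rw [best]; exact fun _ _ _ => Iff.rfl
  | block q X cs hcs _ ih =>
    refine equivalent_of_holds q fun A I s => ?_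
    obtain ⟨π, hπ, e⟩ := exists_elimBest_eq q X (cs.map fun c => c.best)
    rw [best, e, holds_bigOp (elim_ne_nil (by simpa using hcs)), holds_elim, holds_block hcs]
    refine exists_congr fun t => and_congr ?_ ?_
    · refine forall_congr' fun x => imp_congr_left ?_
      rw [List.mem_append, not_or]
      exact ⟨fun h => h.2, fun h => ⟨fun hx => h (hπ x hx), h⟩⟩
    · rw [List.forall_mem_map]
      exact forall₂_congr fun c hc => (ih c hc).holds_iff q t

theorem le_foldr_max {l : List ℕ} {a : ℕ} (ha : a ∈ l) : a ≤ l.foldr max 0 := by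
  induction l with
  | nil => simp at ha
  | cons b l ih =>
    rcases List.mem_cons.1 ha with rfl | ha
    · exact le_max_left _ _
    · exact (ih ha).trans (le_max_right _ _)

theorem le_thickl_of_mem {q : Bool} {X : List ℕ} {cs : List BlockFormula} {c : BlockFormula}
    (hc : c ∈ cs) : c.thickl ≤ (block q X cs).thickl := by
  rw [thickl]
  exact (le_foldr_max (List.mem_map.2 ⟨c, hc, rfl⟩)).trans (le_max_right _ _)

/-- An optimal tree decomposition provides a good elimination order, and the search in `elimBest`
does at least as well. That the free variables of the block form a hyperedge is needed twice: they
must not obstruct the elimination, and the final conjunction must fit into a bag. -/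
theorem width_best_le (t : BlockFormula) (ht : t.VariableLoose) : t.best.width ≤ t.thickl := by
  induction t using BlockFormula.induction with
  | hlit pos R vs => cases pos <;> simp [best, toFormula, width, thickl]
  | hblock q X cs ih =>
    set E := insert (free (block q X cs)) (edges cs) with hE
    set w := (block q X cs).thickl with hwdef
    obtain ⟨m, T, B, hTB, hcard⟩ := exists_isTreeDecomposition E
    have hw (i) : (B i).card ≤ w := by
      refine (hcard i).trans ?_
      rw [hwdef, thickl, add_comm]
      exact le_max_left _ _
    have hconv : PathConvex T B := pathConvex_of_preconnected hTB.isTree.isAcyclic fun a => by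
      by_cases ha : a ∈ verts E
      · exact (hTB.connected a ha).preconnected
      -- Bags contain only vertices of the hypergraph, so for other numbers there is nothing to
      -- connect.
      · rintro ⟨i, hi⟩
        refine absurd ?_ ha
        rw [← hTB.cover]
        exact Finset.mem_sup.2 ⟨i, Finset.mem_univ i, hi⟩
    have hclique (e) (he : e ∈ E) (a) (ha : a ∈ e) (b) (hb : b ∈ e) :
        ∃ i, a ∈ B i ∧ b ∈ B i := by
      by_cases hab : a = b
      · subst hab
        have : a ∈ verts E := Finset.mem_sup.2 ⟨e, he, ha⟩
        rw [← hTB.cover, Finset.mem_sup] at this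
        obtain ⟨i, -, hi⟩ := this
        exact ⟨i, hi, hi⟩
      · exact hTB.edge e he a ha b hb hab
    have hFE : free (block q X cs) ∈ E := Finset.mem_insert_self _ _
    have hcE (c) (hc : c ∈ cs) : c.free ∈ E :=
      Finset.mem_insert_of_mem (mem_edges.2 ⟨c, hc, rfl⟩)
    obtain ⟨i, hi⟩ := exists_subset_bag hTB.isTree hconv (hclique _ hFE)
    have hXnodup : X.Nodup := by
      have := ht.1
      rw [bound] at this
      exact (List.nodup_append.1 this).1
    obtain ⟨π, hπ, hlen, h⟩ := exists_elim_order hTB.isTree (w := w) q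
      (F := free (block q X cs)) X.toFinset hconv hw
      (fun i a ha => by
        have hav : a ∈ verts E := by
          rw [← hTB.cover]
          exact Finset.mem_sup.2 ⟨i, Finset.mem_univ i, ha⟩
        obtain ⟨e, he, hae⟩ := Finset.mem_sup.1 hav
        rw [Finset.mem_union, List.mem_toFinset]
        rcases Finset.mem_insert.1 he with rfl | he
        · exact Or.inr hae
        · obtain ⟨c, hc, rfl⟩ := mem_edges.1 he
          by_cases haX : a ∈ X
          · exact Or.inl haX
          · exact Or.inr (mem_free_block.2 ⟨⟨c, hc, hae⟩, haX⟩))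
      (Finset.disjoint_left.2 fun a ha ha' => (mem_free_block.1 ha').2 (List.mem_toFinset.1 ha))
      (hclique _ hFE) (l := cs.map fun c => c.best)
      (fun φ hφ => by
        obtain ⟨c, hc, rfl⟩ := List.mem_map.1 hφ
        exact (ih c hc (ht.child hc)).trans (le_thickl_of_mem hc))
      (fun φ hφ a ha b hb => by
        obtain ⟨c, hc, rfl⟩ := List.mem_map.1 hφ
        exact hclique _ (hcE c hc) a (free_best_subset c ha) b (free_best_subset c hb))
    -- Along `π` all of `X` has been eliminated, so the appended `X` has no effect.
    have hself : elim q (π ++ X) (cs.map fun c => c.best) =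
        elim q π (cs.map fun c => c.best) := by
      rw [elim_append]
      exact elim_eq_self fun φ hφ x hx hxφ => (mem_free_block.1 ((h φ hφ).2 hxφ)).2 hx
    rw [best]
    refine (width_elimBest_le (fun x hx => List.mem_toFinset.1 (hπ x hx))
      (by rw [hlen, List.toFinset_card_of_nodup hXnodup])).trans ?_
    rw [hself]
    refine width_bigOp_le (fun φ hφ => (h φ hφ).1) ((Finset.card_le_card fun y hy => ?_).trans
      ((Finset.card_le_card hi).trans (hw i)))
    obtain ⟨φ, hφ, hy⟩ := mem_free_bigOp.1 hy
    exact (h φ hφ).2 hy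

end BlockFormula

/-! ### Renaming into a given set of variables -/

namespace Formula

variable {A : Type u} {I : ℕ → List A → Prop}

/-- A list of the free variables. -/
def freeList : Formula → List ℕ
  | atom _ vs => vs
  | not φ => φ.freeList
  | and φ ψ => φ.freeList ++ ψ.freeList
  | or φ ψ => φ.freeList ++ ψ.freeList
  | ex x φ => φ.freeList.filter (· ≠ x)
  | all x φ => φ.freeList.filter (· ≠ x)

theorem mem_freeList {φ : Formula} {x : ℕ} : x ∈ φ.freeList ↔ x ∈ φ.free := by
  induction φ <;> simp_all [freeList, free, and_comm]

/-- The value of a renaming that is given by a list of pairs. -/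
def look (env : List (ℕ × ℕ)) (x : ℕ) : ℕ := (env.lookup x).getD x

theorem look_cons (env : List (ℕ × ℕ)) (x v y : ℕ) :
    look ((x, v) :: env) y = if y = x then v else look env y := by
  unfold look
  rw [List.lookup_cons]
  by_cases h : y = x
  · simp [h]
  · rw [if_neg h, beq_false_of_ne h]

/-- A member of the list `V` that is not the new name of a variable in `l` other than `x`. -/
def freshVar (V : List ℕ) (env : List (ℕ × ℕ)) (x : ℕ) (l : List ℕ) : ℕ :=
  (V.filter fun v => v ∉ (l.filter (· ≠ x)).map (look env)).headI

/-- Pigeonhole: since `width` counts `x` in its scope, the other free variables occupy fewer names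
than `V` offers. -/
theorem freshVar_spec {V : List ℕ} {env : List (ℕ × ℕ)} {x : ℕ} {φ : Formula}
    (h : (insert x φ.free).card ≤ V.toFinset.card) :
    freshVar V env x φ.freeList ∈ V ∧
      ∀ y ∈ φ.free, y ≠ x → look env y ≠ freshVar V env x φ.freeList := by
  have hlt : ((φ.free.erase x).image (look env)).card < V.toFinset.card := by
    refine Finset.card_image_le.trans_lt (lt_of_lt_of_le ?_ h)
    exact Finset.card_lt_card (Finset.ssubset_iff_of_subset ((Finset.erase_subset _ _).trans
      (Finset.subset_insert _ _)) |>.2 ⟨x, by simp, by simp⟩)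
  obtain ⟨v, hv, hv'⟩ := Finset.exists_mem_notMem_of_card_lt_card hlt
  have hne : (V.filter fun v => v ∉ (φ.freeList.filter (· ≠ x)).map (look env)) ≠ [] := by
    refine List.ne_nil_of_mem (a := v) (List.mem_filter.2 ⟨List.mem_toFinset.1 hv, ?_⟩)
    rw [decide_eq_true_eq]
    intro hm
    obtain ⟨y, hy, rfl⟩ := List.mem_map.1 hm
    rw [List.mem_filter, mem_freeList, decide_eq_true_eq] at hy
    exact hv' (Finset.mem_image_of_mem _ (Finset.mem_erase.2 ⟨hy.2, hy.1⟩))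
  have hmem : freshVar V env x φ.freeList ∈
      V.filter fun v => v ∉ (φ.freeList.filter (· ≠ x)).map (look env) := by
    obtain ⟨a, l, e⟩ := List.exists_cons_of_ne_nil hne
    rw [freshVar, e]
    exact List.mem_cons_self
  rw [List.mem_filter, decide_eq_true_eq] at hmem
  refine ⟨hmem.1, fun y hy hyx e => hmem.2 (List.mem_map.2 ⟨y, List.mem_filter.2
    ⟨mem_freeList.2 hy, by simpa using hyx⟩, e⟩)⟩

/-- Rename all variables into members of the list `V`, and the free ones according to `env`. -/
def recolor (V : List ℕ) : List (ℕ × ℕ) → Formula → Formula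
  | env, atom R vs => atom R (vs.map (look env))
  | env, not φ => not (recolor V env φ)
  | env, and φ ψ => and (recolor V env φ) (recolor V env ψ)
  | env, or φ ψ => or (recolor V env φ) (recolor V env ψ)
  | env, ex x φ => ex (freshVar V env x φ.freeList)
      (recolor V ((x, freshVar V env x φ.freeList) :: env) φ)
  | env, all x φ => all (freshVar V env x φ.freeList)
      (recolor V ((x, freshVar V env x φ.freeList) :: env) φ)

theorem symbols_recolor (V : List ℕ) (env : List (ℕ × ℕ)) (φ : Formula) :
    (recolor V env φ).symbols = φ.symbols := by
  induction φ generalizing env <;> simp_all [recolor, symbols]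

theorem free_recolor_subset (V : List ℕ) (env : List (ℕ × ℕ)) (φ : Formula) :
    (recolor V env φ).free ⊆ φ.free.image (look env) := by
  have hq (env : List (ℕ × ℕ)) (x v : ℕ) (S S' : Finset ℕ)
      (h : S' ⊆ S.image (look ((x, v) :: env))) : S'.erase v ⊆ (S.erase x).image (look env) := by
    intro z hz
    rw [Finset.mem_erase] at hz
    obtain ⟨y, hy, rfl⟩ := Finset.mem_image.1 (h hz.2)
    rw [look_cons] at hz ⊢
    split_ifs at hz ⊢ with hyx
    · exact absurd rfl hz.1
    · exact Finset.mem_image_of_mem _ (Finset.mem_erase.2 ⟨hyx, hy⟩)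
  induction φ generalizing env with
  | atom R vs => intro z; simp [recolor, free]
  | not φ ih => exact ih env
  | and φ ψ ih₁ ih₂ =>
    rw [free, Finset.image_union]
    exact Finset.union_subset_union (ih₁ env) (ih₂ env)
  | or φ ψ ih₁ ih₂ =>
    rw [free, Finset.image_union]
    exact Finset.union_subset_union (ih₁ env) (ih₂ env)
  | ex x φ ih => exact hq _ _ _ _ _ (ih _)
  | all x φ ih => exact hq _ _ _ _ _ (ih _)

theorem vars_recolor_subset (V : List ℕ) (env : List (ℕ × ℕ)) (φ : Formula)
    (hw : φ.width ≤ V.toFinset.card) (h : ∀ y ∈ φ.free, look env y ∈ V) :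
    (recolor V env φ).vars ⊆ V.toFinset := by
  have hq (env : List (ℕ × ℕ)) (x : ℕ) (φ : Formula)
      (hw : (insert x φ.free).card ≤ V.toFinset.card)
      (h : ∀ y ∈ φ.free.erase x, look env y ∈ V) :
      ∀ y ∈ φ.free, look ((x, freshVar V env x φ.freeList) :: env) y ∈ V := by
    intro y hy
    rw [look_cons]
    split_ifs with hyx
    · exact (freshVar_spec hw).1
    · exact h y (Finset.mem_erase.2 ⟨hyx, hy⟩)
  induction φ generalizing env with
  | atom R vs =>
    intro z hz
    obtain ⟨y, hy, rfl⟩ := List.mem_map.1 (List.mem_toFinset.1 hz)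
    exact List.mem_toFinset.2 (h y (List.mem_toFinset.2 hy))
  | not φ ih => exact ih env hw h
  | and φ ψ ih₁ ih₂ =>
    rw [width, max_le_iff, max_le_iff] at hw
    exact Finset.union_subset (ih₁ env hw.2.1 fun y hy => h y (Finset.mem_union_left _ hy))
      (ih₂ env hw.2.2 fun y hy => h y (Finset.mem_union_right _ hy))
  | or φ ψ ih₁ ih₂ =>
    rw [width, max_le_iff, max_le_iff] at hw
    exact Finset.union_subset (ih₁ env hw.2.1 fun y hy => h y (Finset.mem_union_left _ hy))
      (ih₂ env hw.2.2 fun y hy => h y (Finset.mem_union_right _ hy))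
  | ex x φ ih =>
    rw [width, max_le_iff] at hw
    exact Finset.insert_subset (List.mem_toFinset.2 (freshVar_spec hw.1).1)
      (ih _ hw.2 (hq env x φ hw.1 h))
  | all x φ ih =>
    rw [width, max_le_iff] at hw
    exact Finset.insert_subset (List.mem_toFinset.2 (freshVar_spec hw.1).1)
      (ih _ hw.2 (hq env x φ hw.1 h))

/-- The environment need not be injective. It is enough that the name chosen at a quantifier differs
from the current names of the other variables free in its scope. -/
theorem realize_recolor (V : List ℕ) (env : List (ℕ × ℕ)) (φ : Formula)
    (hw : φ.width ≤ V.toFinset.card) (s : ℕ → A) :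
    Realize I s (recolor V env φ) ↔ Realize I (s ∘ look env) φ := by
  have hq (env : List (ℕ × ℕ)) (x : ℕ) (φ : Formula)
      (hw : (insert x φ.free).card ≤ V.toFinset.card) (s : ℕ → A) (a : A) :
      Realize I (Function.update s (freshVar V env x φ.freeList) a ∘
        look ((x, freshVar V env x φ.freeList) :: env)) φ ↔
      Realize I (Function.update (s ∘ look env) x a) φ := by
    refine realize_congr φ fun y hy => ?_
    by_cases hyx : y = x
    · simp [look_cons, hyx]
    · simp [look_cons, hyx, (freshVar_spec hw).2 y hy hyx]
  induction φ generalizing env s with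
  | atom R vs => simp [recolor, Realize]
  | not φ ih => exact not_congr (ih env hw s)
  | and φ ψ ih₁ ih₂ =>
    rw [width, max_le_iff, max_le_iff] at hw
    exact and_congr (ih₁ env hw.2.1 s) (ih₂ env hw.2.2 s)
  | or φ ψ ih₁ ih₂ =>
    rw [width, max_le_iff, max_le_iff] at hw
    exact or_congr (ih₁ env hw.2.1 s) (ih₂ env hw.2.2 s)
  | ex x φ ih =>
    rw [width, max_le_iff] at hw
    exact exists_congr fun a => (ih _ hw.2 _).trans (hq env x φ hw.1 s a)
  | all x φ ih =>
    rw [width, max_le_iff] at hw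
    exact forall_congr' fun a => (ih _ hw.2 _).trans (hq env x φ hw.1 s a)

/-- Remove repetitions from a list. -/
def nub (l : List ℕ) : List ℕ := l.foldr (fun a r => if a ∈ r then r else a :: r) []

theorem nub_spec (l : List ℕ) : (nub l).Nodup ∧ (nub l).toFinset = l.toFinset := by
  induction l with
  | nil => simp [nub]
  | cons a l ih =>
    rw [nub, List.foldr_cons]
    rw [nub] at ih
    split_ifs with h
    · refine ⟨ih.1, ?_⟩
      rw [ih.2, List.toFinset_cons, Finset.insert_eq_of_mem]
      rwa [← ih.2, List.mem_toFinset]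
    · exact ⟨List.nodup_cons.2 ⟨h, ih.1⟩, by rw [List.toFinset_cons, List.toFinset_cons, ih.2]⟩

theorem length_nub (l : List ℕ) : (nub l).length = l.toFinset.card := by
  rw [← (nub_spec l).2, List.toFinset_card_of_nodup (nub_spec l).1]

/-- A list that contains the members of `l` and has at least `w` members. -/
def palette (l : List ℕ) (w : ℕ) : List ℕ :=
  nub l ++ List.range' (l.foldr max 0 + 1) (w - (nub l).length)

theorem subset_palette (l : List ℕ) (w : ℕ) : ∀ x ∈ l, x ∈ palette l w := by
  intro x hx
  refine List.mem_append_left _ ?_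
  rwa [← List.mem_toFinset, (nub_spec l).2, List.mem_toFinset]

theorem card_palette (l : List ℕ) (w : ℕ) :
    (palette l w).toFinset.card = max w l.toFinset.card := by
  have hn : (palette l w).Nodup := by
    refine List.nodup_append.2 ⟨(nub_spec l).1, List.nodup_range', fun a ha b hb e => ?_⟩
    rw [← List.mem_toFinset, (nub_spec l).2, List.mem_toFinset] at ha
    have := le_foldr_max ha
    rw [List.mem_range'_1] at hb
    omega
  rw [List.toFinset_card_of_nodup hn, palette, List.length_append, List.length_range', length_nub]
  omega

theorem toFinset_freeList (φ : Formula) : φ.freeList.toFinset = φ.free := by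
  ext; simp [mem_freeList]

/-- Rename the quantified variables of `ψ` such that at most `max ψ.width φ.free.card` variables
occur, if all free variables of `ψ` are free in `φ`. -/
def compress (φ ψ : Formula) : Formula := recolor (palette φ.freeList ψ.width) [] ψ

theorem look_nil : look [] = id := rfl

theorem width_le_card_palette (φ ψ : Formula) :
    ψ.width ≤ (palette φ.freeList ψ.width).toFinset.card := by
  rw [card_palette]
  exact le_max_left _ _

/-- With the empty environment the free variables keep their names. -/
theorem compress_equivalent (φ ψ : Formula) : Equivalent.{u} (compress φ ψ) ψ :=
  fun _ _ s => realize_recolor _ _ _ (width_le_card_palette φ ψ) s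

theorem free_compress_subset (φ ψ : Formula) : (compress φ ψ).free ⊆ ψ.free := by
  simpa [compress, look_nil] using free_recolor_subset (palette φ.freeList ψ.width) [] ψ

theorem symbols_compress (φ ψ : Formula) : (compress φ ψ).symbols = ψ.symbols :=
  symbols_recolor _ _ _

theorem card_vars_compress_le {φ ψ : Formula} (h : ψ.free ⊆ φ.free) :
    (compress φ ψ).vars.card ≤ max ψ.width φ.free.card := by
  rw [← toFinset_freeList φ, ← card_palette]
  exact Finset.card_le_card (vars_recolor_subset _ _ _ (width_le_card_palette φ ψ)
    fun y hy => subset_palette _ _ _ (mem_freeList.2 (h hy)))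

end Formula

/-! ### Assembling the formula -/

namespace PosComb

open Formula

/-- Replace the layered formulas that are combined by equivalent formulas of small width. -/
def assemble : PosComb → Formula
  | base t => t.best
  | and p q => .and p.assemble q.assemble
  | or p q => .or p.assemble q.assemble

theorem assemble_equivalent {p : PosComb} (h : ∀ t ∈ p.parts, t.Proper) :
    Equivalent.{u} p.assemble p.toFormula := by
  induction p with
  | base t => exact (h t (by simp [parts])).equivalent_best
  | and p q ih₁ ih₂ =>
    exact fun A I s => and_congr (ih₁ (fun t ht => h t (List.mem_append_left _ ht)) A I s)
      (ih₂ (fun t ht => h t (List.mem_append_right _ ht)) A I s)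
  | or p q ih₁ ih₂ =>
    exact fun A I s => or_congr (ih₁ (fun t ht => h t (List.mem_append_left _ ht)) A I s)
      (ih₂ (fun t ht => h t (List.mem_append_right _ ht)) A I s)

theorem symbols_assemble_subset {p : PosComb} (h : ∀ t ∈ p.parts, t.Proper) :
    p.assemble.symbols ⊆ p.toFormula.symbols := by
  induction p with
  | base t => exact (h t (by simp [parts])).symbols_best_subset
  | and p q ih₁ ih₂ =>
    exact Finset.union_subset_union (ih₁ fun t ht => h t (List.mem_append_left _ ht))
      (ih₂ fun t ht => h t (List.mem_append_right _ ht))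
  | or p q ih₁ ih₂ =>
    exact Finset.union_subset_union (ih₁ fun t ht => h t (List.mem_append_left _ ht))
      (ih₂ fun t ht => h t (List.mem_append_right _ ht))

theorem free_assemble_subset (p : PosComb) : p.assemble.free ⊆ p.toFormula.free := by
  induction p with
  | base t =>
    rw [toFormula, free_toFormula]
    exact free_best_subset t
  | and p q ih₁ ih₂ => exact Finset.union_subset_union ih₁ ih₂
  | or p q ih₁ ih₂ => exact Finset.union_subset_union ih₁ ih₂

/-- Above the layered parts there are no quantifiers, so all free variables there are free in the
whole combination. This is where the number of free variables enters the bound of (2). -/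
theorem width_assemble_le {p : PosComb} {w : ℕ} (h : ∀ t ∈ p.parts, t.best.width ≤ w)
    (hw : p.toFormula.free.card ≤ w) : p.assemble.width ≤ w := by
  have hand (p q : PosComb) (hw : (p.toFormula.free ∪ q.toFormula.free).card ≤ w) :
      p.toFormula.free.card ≤ w ∧ q.toFormula.free.card ≤ w ∧
        (p.assemble.free ∪ q.assemble.free).card ≤ w :=
    ⟨(Finset.card_le_card Finset.subset_union_left).trans hw,
      (Finset.card_le_card Finset.subset_union_right).trans hw,
      (Finset.card_le_card (Finset.union_subset_union (free_assemble_subset p)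
        (free_assemble_subset q))).trans hw⟩
  induction p with
  | base t => exact h t (by simp [parts])
  | and p q ih₁ ih₂ =>
    obtain ⟨h₁, h₂, h₃⟩ := hand p q hw
    exact max_le h₃ (max_le (ih₁ (fun t ht => h t (List.mem_append_left _ ht)) h₁)
      (ih₂ (fun t ht => h t (List.mem_append_right _ ht)) h₂))
  | or p q ih₁ ih₂ =>
    obtain ⟨h₁, h₂, h₃⟩ := hand p q hw
    exact max_le h₃ (max_le (ih₁ (fun t ht => h t (List.mem_append_left _ ht)) h₁)
      (ih₂ (fun t ht => h t (List.mem_append_right _ ht)) h₂))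

end PosComb

theorem thickl_le_thick {L : Formula → PosComb} {φ : Formula} {t : BlockFormula}
    (ht : t ∈ (L φ).parts) : t.thickl ≤ thick L φ :=
  le_foldr_max (List.mem_map.2 ⟨t, ht, rfl⟩)

/-! ### Computability -/

-- Recolouring and elimination are primitive recursive

namespace Formula

open Primrec

theorem primrec_freeList : Primrec freeList := by
  let g (φ : Formula) (rs : List (List ℕ)) : List ℕ :=
    φ.cases (fun z => z.2) (fun _ => rs.getD 0 []) (fun _ => rs.getD 0 [] ++ rs.getD 1 [])
      (fun z => (rs.getD 0 []).filter fun y => y ≠ z.2.1)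
  refine primrec_of_calls (m := code) (calls := cases (fun _ => []) (fun φ => [φ])
      (fun z => [z.2.1, z.2.2]) (fun z => [z.2.2])) (g := g) primrec_code ?_ ?_ ?_ ?_
  · exact primrec_cases .id (Primrec₂.const _) (list_cons.comp snd (const []))
      (list_cons.comp (fst.comp (snd.comp snd)) (list_cons.comp (snd.comp (snd.comp snd))
        (const []))) (list_cons.comp (snd.comp (snd.comp snd)) (const []))
  · have hr {β : Type} [Primcodable β] (i : ℕ) : Primrec fun a :
        (Formula × List (List ℕ)) × β => a.1.2.getD i [] :=
      (list_getD _).comp (snd.comp fst) (const i)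
    have h₁ : Primrec₂ fun (_ : Formula × List (List ℕ)) (z : ℕ × List ℕ) => z.2 :=
      snd.comp snd
    have h₂ : Primrec₂ fun (a : Formula × List (List ℕ)) (_ : Formula) => a.2.getD 0 [] := hr 0
    have h₃ : Primrec₂ fun (a : Formula × List (List ℕ)) (_ : Bool × Formula × Formula) =>
        a.2.getD 0 [] ++ a.2.getD 1 [] := list_append.comp (hr 0) (hr 1)
    have h₄ : Primrec₂ fun (a : Formula × List (List ℕ)) (z : Bool × ℕ × Formula) =>
        (a.2.getD 0 []).filter fun y => y ≠ z.2.1 :=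
      primrec_filter (hr 0)
        (Primrec.eq.comp snd (fst.comp (snd.comp (snd.comp fst)))).not
    exact primrec_cases fst h₁ h₂ h₃ h₄
  · intro φ b hb
    cases φ <;> simp only [cases, List.mem_cons, List.not_mem_nil, or_false] at hb
    · rw [hb]; exact code_lt_code_not _
    · rcases hb with rfl | rfl
      exacts [(code_lt_code_and _ _).1, (code_lt_code_and _ _).2]
    · rcases hb with rfl | rfl
      exacts [(code_lt_code_or _ _).1, (code_lt_code_or _ _).2]
    · rw [hb]; exact code_lt_code_ex _ _
    · rw [hb]; exact code_lt_code_all _ _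
  · intro φ
    cases φ <;> rw [freeList] <;> rfl

theorem primrecRel_mem_free : PrimrecRel fun (x : ℕ) (φ : Formula) => x ∈ φ.free :=
  (primrecRel_mem.comp fst (primrec_freeList.comp snd)).of_eq fun _ => mem_freeList

theorem primrec_nub : Primrec nub :=
  list_foldr .id (const []) (ite (primrecRel_mem.comp (fst.comp snd) (snd.comp snd))
    (snd.comp snd) (list_cons.comp (fst.comp snd) (snd.comp snd))).to₂

theorem primrec_card_toFinset : Primrec fun l : List ℕ => l.toFinset.card :=
  (list_length.comp primrec_nub).of_eq length_nub

theorem primrec_width : Primrec width := by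
  let g (φ : Formula) (rs : List ℕ) : ℕ :=
    φ.cases (fun z => z.2.toFinset.card) (fun _ => rs.getD 0 0)
      (fun z => max (z.2.1.freeList ++ z.2.2.freeList).toFinset.card
        (max (rs.getD 0 0) (rs.getD 1 0)))
      (fun z => max (z.2.1 :: z.2.2.freeList).toFinset.card (rs.getD 0 0))
  refine primrec_of_calls (m := code) (calls := cases (fun _ => []) (fun φ => [φ])
      (fun z => [z.2.1, z.2.2]) (fun z => [z.2.2])) (g := g) primrec_code ?_ ?_ ?_ ?_
  · exact primrec_cases .id (Primrec₂.const _) (list_cons.comp snd (const []))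
      (list_cons.comp (fst.comp (snd.comp snd)) (list_cons.comp (snd.comp (snd.comp snd))
        (const []))) (list_cons.comp (snd.comp (snd.comp snd)) (const []))
  · have hr {β : Type} [Primcodable β] (i : ℕ) : Primrec fun a :
        (Formula × List ℕ) × β => a.1.2.getD i 0 :=
      (list_getD _).comp (snd.comp fst) (const i)
    have h₁ : Primrec₂ fun (_ : Formula × List ℕ) (z : ℕ × List ℕ) => z.2.toFinset.card :=
      primrec_card_toFinset.comp (snd.comp snd)
    have h₂ : Primrec₂ fun (a : Formula × List ℕ) (_ : Formula) => a.2.getD 0 0 := hr 0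
    have h₃ : Primrec₂ fun (a : Formula × List ℕ) (z : Bool × Formula × Formula) =>
        max (z.2.1.freeList ++ z.2.2.freeList).toFinset.card
          (max (a.2.getD 0 0) (a.2.getD 1 0)) :=
      nat_max.comp (primrec_card_toFinset.comp (list_append.comp
        (primrec_freeList.comp (fst.comp (snd.comp snd)))
        (primrec_freeList.comp (snd.comp (snd.comp snd))))) (nat_max.comp (hr 0) (hr 1))
    have h₄ : Primrec₂ fun (a : Formula × List ℕ) (z : Bool × ℕ × Formula) =>
        max (z.2.1 :: z.2.2.freeList).toFinset.card (a.2.getD 0 0) :=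
      nat_max.comp (primrec_card_toFinset.comp (list_cons.comp (fst.comp (snd.comp snd))
        (primrec_freeList.comp (snd.comp (snd.comp snd))))) (hr 0)
    exact primrec_cases fst h₁ h₂ h₃ h₄
  · intro φ b hb
    cases φ <;> simp only [cases, List.mem_cons, List.not_mem_nil, or_false] at hb
    · rw [hb]; exact code_lt_code_not _
    · rcases hb with rfl | rfl
      exacts [(code_lt_code_and _ _).1, (code_lt_code_and _ _).2]
    · rcases hb with rfl | rfl
      exacts [(code_lt_code_or _ _).1, (code_lt_code_or _ _).2]
    · rw [hb]; exact code_lt_code_ex _ _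
    · rw [hb]; exact code_lt_code_all _ _
  · intro φ
    cases φ <;> simp [width, g, cases, toFinset_freeList, List.toFinset_append]

theorem primrec_look : Primrec₂ look := option_getD.comp (listLookup.comp snd fst) snd

theorem primrec_freshVar : Primrec fun y : List ℕ × List (ℕ × ℕ) × ℕ × List ℕ =>
    freshVar y.1 y.2.1 y.2.2.1 y.2.2.2 := by
  have hused : Primrec fun y : List ℕ × List (ℕ × ℕ) × ℕ × List ℕ =>
      (y.2.2.2.filter fun z => z ≠ y.2.2.1).map (look y.2.1) := by
    refine list_map (primrec_filter (snd.comp (snd.comp snd)) ?_) ?_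
    · exact (Primrec.eq.comp snd (fst.comp (snd.comp (snd.comp fst)))).not
    · exact primrec_look.comp (fst.comp (snd.comp fst)) snd
  exact list_headI.comp (primrec_filter fst
    (primrecRel_mem.comp snd (hused.comp fst)).not)

theorem primrec_recolor : Primrec fun y : List ℕ × List (ℕ × ℕ) × Formula =>
    recolor y.1 y.2.1 y.2.2 := by
  let Y := List ℕ × List (ℕ × ℕ) × Formula
  let g (y : Y) (rs : List Formula) : Formula :=
    y.2.2.cases (fun z => atom z.1 (z.2.map (look y.2.1))) (fun _ => not (rs.getD 0 (atom 0 [])))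
      (fun z => if z.1 = true then and (rs.getD 0 (atom 0 [])) (rs.getD 1 (atom 0 []))
        else or (rs.getD 0 (atom 0 [])) (rs.getD 1 (atom 0 [])))
      (fun z => if z.1 = true
        then ex (freshVar y.1 y.2.1 z.2.1 z.2.2.freeList) (rs.getD 0 (atom 0 []))
        else all (freshVar y.1 y.2.1 z.2.1 z.2.2.freeList) (rs.getD 0 (atom 0 [])))
  have hfresh {β : Type} [Primcodable β] {f : β → Y} {z : β → Bool × ℕ × Formula}
      (hf : Primrec f) (hz : Primrec z) : Primrec fun b =>
        freshVar (f b).1 (f b).2.1 (z b).2.1 (z b).2.2.freeList :=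
    primrec_freshVar.comp (pair (fst.comp hf) (pair (fst.comp (snd.comp hf))
      (pair (fst.comp (snd.comp hz)) (primrec_freeList.comp (snd.comp (snd.comp hz))))))
  refine primrec_of_calls (m := fun y => y.2.2.code)
    (calls := fun y => y.2.2.cases (fun _ => []) (fun φ => [(y.1, y.2.1, φ)])
      (fun z => [(y.1, y.2.1, z.2.1), (y.1, y.2.1, z.2.2)])
      (fun z => [(y.1, (z.2.1, freshVar y.1 y.2.1 z.2.1 z.2.2.freeList) :: y.2.1, z.2.2)]))
    (g := g) (primrec_code.comp (snd.comp snd)) ?_ ?_ ?_ ?_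
  · have h₂ : Primrec₂ fun (y : Y) (φ : Formula) => [(y.1, y.2.1, φ)] :=
      list_cons.comp (pair (fst.comp fst) (pair (fst.comp (snd.comp fst)) snd)) (const [])
    have h₃ : Primrec₂ fun (y : Y) (z : Bool × Formula × Formula) =>
        [(y.1, y.2.1, z.2.1), (y.1, y.2.1, z.2.2)] :=
      list_cons.comp (pair (fst.comp fst) (pair (fst.comp (snd.comp fst))
        (fst.comp (snd.comp snd)))) (list_cons.comp (pair (fst.comp fst)
        (pair (fst.comp (snd.comp fst)) (snd.comp (snd.comp snd)))) (const []))
    have h₄ : Primrec₂ fun (y : Y) (z : Bool × ℕ × Formula) =>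
        [(y.1, (z.2.1, freshVar y.1 y.2.1 z.2.1 z.2.2.freeList) :: y.2.1, z.2.2)] :=
      list_cons.comp (pair (fst.comp fst) (pair (list_cons.comp
        (pair (fst.comp (snd.comp snd)) (hfresh fst snd)) (fst.comp (snd.comp fst)))
        (snd.comp (snd.comp snd)))) (const [])
    exact primrec_cases (snd.comp snd) (Primrec₂.const _) h₂ h₃ h₄
  · have hr {β : Type} [Primcodable β] (i : ℕ) : Primrec fun a :
        (Y × List Formula) × β => a.1.2.getD i (atom 0 []) :=
      (list_getD _).comp (snd.comp fst) (const i)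
    have hb {β : Type} [Primcodable β] : PrimrecPred fun a :
        (Y × List Formula) × (Bool × β) => a.2.1 = true :=
      Primrec.eq.comp (fst.comp snd) (const true)
    have h₁ : Primrec₂ fun (a : Y × List Formula) (z : ℕ × List ℕ) =>
        atom z.1 (z.2.map (look a.1.2.1)) :=
      primrec_atom.comp (fst.comp snd) (list_map (snd.comp snd)
        (primrec_look.comp (fst.comp (snd.comp (fst.comp (fst.comp fst)))) snd))
    have h₂ : Primrec₂ fun (a : Y × List Formula) (_ : Formula) =>
        not (a.2.getD 0 (atom 0 [])) := primrec_not.comp (hr 0)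
    have h₃ : Primrec₂ fun (a : Y × List Formula) (z : Bool × Formula × Formula) =>
        if z.1 = true then and (a.2.getD 0 (atom 0 [])) (a.2.getD 1 (atom 0 []))
        else or (a.2.getD 0 (atom 0 [])) (a.2.getD 1 (atom 0 [])) :=
      ite hb (primrec_and.comp (hr 0) (hr 1)) (primrec_or.comp (hr 0) (hr 1))
    have h₄ : Primrec₂ fun (a : Y × List Formula) (z : Bool × ℕ × Formula) =>
        if z.1 = true
        then ex (freshVar a.1.1 a.1.2.1 z.2.1 z.2.2.freeList) (a.2.getD 0 (atom 0 []))
        else all (freshVar a.1.1 a.1.2.1 z.2.1 z.2.2.freeList) (a.2.getD 0 (atom 0 [])) :=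
      ite hb (primrec_ex.comp (hfresh (fst.comp fst) snd) (hr 0))
        (primrec_all.comp (hfresh (fst.comp fst) snd) (hr 0))
    exact primrec_cases (snd.comp (snd.comp fst)) h₁ h₂ h₃ h₄
  · rintro ⟨V, env, φ⟩ b hb
    cases φ <;> simp only [cases, List.mem_cons, List.not_mem_nil, or_false] at hb
    · rw [hb]; exact code_lt_code_not _
    · rcases hb with rfl | rfl
      exacts [(code_lt_code_and _ _).1, (code_lt_code_and _ _).2]
    · rcases hb with rfl | rfl
      exacts [(code_lt_code_or _ _).1, (code_lt_code_or _ _).2]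
    · rw [hb]; exact code_lt_code_ex _ _
    · rw [hb]; exact code_lt_code_all _ _
  · rintro ⟨V, env, φ⟩
    cases φ <;> simp only [] <;> rw [recolor] <;> rfl

theorem primrec_palette : Primrec₂ palette := by
  have hmax : Primrec fun l : List ℕ => l.foldr max 0 :=
    list_foldr .id (const 0) (nat_max.comp (fst.comp snd) (snd.comp snd)).to₂
  exact list_append.comp (primrec_nub.comp fst) (primrec_range'.comp
    (succ.comp (hmax.comp fst)) (nat_sub.comp snd (list_length.comp (primrec_nub.comp fst))))

theorem primrec_compress : Primrec₂ compress :=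
  primrec_recolor.comp (pair (primrec_palette.comp (primrec_freeList.comp fst)
    (primrec_width.comp snd)) (pair (const []) snd))

theorem primrec_bigOp : Primrec₂ bigOp :=
  ite (Primrec.eq.comp fst (const true)) (primrec_conj.comp snd) (primrec_disj.comp snd)

theorem primrec_quant : Primrec fun y : Bool × ℕ × Formula => quant y.1 y.2.1 y.2.2 :=
  ite (Primrec.eq.comp fst (const true)) (primrec_ex.comp (fst.comp snd) (snd.comp snd))
    (primrec_all.comp (fst.comp snd) (snd.comp snd))

theorem primrec_elimVar : Primrec fun y : Bool × List Formula × ℕ => elimVar y.1 y.2.1 y.2.2 := by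
  have hx : PrimrecRel fun (y : Bool × List Formula × ℕ) (φ : Formula) => y.2.2 ∈ φ.free :=
    primrecRel_mem_free.comp (snd.comp (snd.comp fst)) snd
  have hi : Primrec fun y : Bool × List Formula × ℕ => y.2.1.filter fun φ => y.2.2 ∈ φ.free :=
    primrec_filter (fst.comp snd) hx
  have ho : Primrec fun y : Bool × List Formula × ℕ => y.2.1.filter fun φ => y.2.2 ∉ φ.free :=
    primrec_filter (fst.comp snd) hx.not
  exact ite (Primrec.eq.comp hi (const [])) (fst.comp snd) (list_cons.comp
    (primrec_quant.comp (pair fst (pair (snd.comp snd) (primrec_bigOp.comp fst hi)))) ho)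

theorem primrec_elim : Primrec fun y : Bool × List ℕ × List Formula => elim y.1 y.2.1 y.2.2 := by
  have h : Primrec₂ fun (y : Bool × List ℕ × List Formula) (z : List Formula × ℕ) =>
      elimVar y.1 z.1 z.2 :=
    primrec_elimVar.comp (pair (fst.comp fst) (pair (fst.comp snd) (snd.comp snd)))
  exact list_foldl (fst.comp snd) (snd.comp snd) h

theorem primrec_minWidth : Primrec₂ minWidth := by
  have h : Primrec₂ fun (_ : Formula × List Formula) (z : Formula × Formula) =>
      if z.2.width < z.1.width then z.2 else z.1 :=
    ite (nat_lt.comp (primrec_width.comp (snd.comp snd)) (primrec_width.comp (fst.comp snd)))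
      (snd.comp snd) (fst.comp snd)
  exact list_foldl snd fst h

theorem primrec_elimBest :
    Primrec fun y : Bool × List ℕ × List Formula => elimBest y.1 y.2.1 y.2.2 := by
  have hX : Primrec fun y : Bool × List ℕ × List Formula => (y.2.1.map fun _ => y.2.1).sections :=
    primrec_sections.comp (list_map (fst.comp snd) (fst.comp (snd.comp fst)))
  have hc : Primrec₂ fun (y : Bool × List ℕ × List Formula) (π : List ℕ) =>
      bigOp y.1 (elim y.1 (π ++ y.2.1) y.2.2) :=
    primrec_bigOp.comp (fst.comp fst) (primrec_elim.comp (pair (fst.comp fst)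
      (pair (list_append.comp snd (fst.comp (snd.comp fst))) (snd.comp (snd.comp fst)))))
  exact primrec_minWidth.comp (primrec_bigOp.comp fst primrec_elim) (list_map hX hc)

end Formula

-- Computability of the assembled formula

section Main

open Primrec

theorem BlockFormula.primrec_toFormula_lit :
    Primrec fun y : Bool × ℕ × List ℕ => (lit y.1 y.2.1 y.2.2).toFormula := by
  have h : Primrec fun y : Bool × ℕ × List ℕ => Formula.atom y.2.1 y.2.2 :=
    Formula.primrec_atom.comp (fst.comp snd) (snd.comp snd)
  refine (ite (Primrec.eq.comp fst (const true)) h (Formula.primrec_not.comp h)).of_eq ?_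
  rintro ⟨_ | _, R, vs⟩ <;> simp [toFormula]

theorem BlockFormula.primrec_best : Primrec best :=
  primrec_rec (g := fun y => (lit y.1 y.2.1 y.2.2).toFormula)
    (h := fun y rs => Formula.elimBest y.1 y.2.1 rs) primrec_toFormula_lit
    (Formula.primrec_elimBest.comp (pair (fst.comp fst)
      (pair (fst.comp (snd.comp fst)) snd)))
    (fun p R vs => by rw [best]) (fun q X cs => by rw [best])

theorem PosComb.primrec_assemble : Primrec PosComb.assemble :=
  PosComb.primrec_rec (g := best) (h := fun b φ ψ => bif b then .and φ ψ else .or φ ψ)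
    primrec_best
    (fun b => by cases b; exacts [Formula.primrec_or, Formula.primrec_and])
    (fun _ => rfl) (fun _ _ => rfl) (fun _ _ => rfl)

theorem IsLayering.computable_toPosComb {L : Formula → PosComb} (hL : IsLayering.{u} L) :
    Computable L :=
  Computable.encode_iff.1 hL.computable

end Main

end Thickness

theorem mainTheorem6 :
    IsLayering.{u} lay ∧
    ∀ L : Formula → PosComb, IsLayering.{u} L →
      ∃ A : Formula → Formula, Computable A ∧
        ∀ φ : Formula,
          Formula.Equivalent.{u} (A φ) φ ∧
          (A φ).free ⊆ φ.free ∧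
          (A φ).symbols ⊆ φ.symbols ∧
          (A φ).vars.card ≤ max (thick L φ) φ.free.card := by
  refine ⟨isLayering_lay, fun L hL => ⟨fun φ => Formula.compress φ (L φ).assemble, ?_, fun φ => ?_⟩⟩
  -- Everything applied after `L` is primitive recursive; only `L` itself is merely computable.
  · exact Formula.primrec_compress.to_comp.comp Computable.id
      (PosComb.primrec_assemble.to_comp.comp hL.computable_toPosComb)
  have hproper : ∀ t ∈ (L φ).parts, t.Proper := fun t ht => by
    obtain ⟨-, q, h⟩ := hL.layered φ t ht
    exact h.proper
  have hfree := ((L φ).free_assemble_subset).trans (hL.free_subset φ)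
  refine ⟨fun A I s => ?_, (Formula.free_compress_subset _ _).trans hfree, ?_, ?_⟩
  · rw [Formula.compress_equivalent φ _ A I s, PosComb.assemble_equivalent hproper A I s,
      hL.equivalent φ A I s]
  · refine (Formula.symbols_compress φ _).subset.trans ?_
    exact (PosComb.symbols_assemble_subset hproper).trans (hL.symbols_subset φ)
  · refine (Formula.card_vars_compress_le hfree).trans (max_le ?_ (le_max_right _ _))
    -- The layered parts are bounded by the thickness, and the combination above them by the number
    -- of free variables.
    refine PosComb.width_assemble_le (fun t ht => ?_)
      ((Finset.card_le_card (hL.free_subset φ)).trans (le_max_right _ _))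
    exact (BlockFormula.width_best_le t (hL.layered φ t ht).1).trans
      ((thickl_le_thick ht).trans (le_max_left _ _))
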